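/- **Notation.** $(a)_k$ denotes the Pochhammer symbol, $(a)_k=a(a+1)\cdots(a+k-1)$ and $(a)_{-k}=\frac{1}{(a-1)(a-2)\cdots(a-k)}$ for $k\in\mathbb N_0$. $K_\nu$ is the Macdonald function. All powers and square roots are principal ($-\pi<\arg z\le\pi$), with $\sqrt{\frac{\pi}{2z}}:=\sqrt{\pi}/\sqrt{2z}$. For $a,b\in\{\pm\frac12,\frac32\}$ and $\zeta=(\zeta_1,\zeta_2,\zeta_3)\in\mathbb C^3$ put $$X(a,b;\zeta)=\sum_{m,n,p=0}^\infty\frac{\zeta_1^m\zeta_2^n\zeta_3^p}{m!\,p!\,(a)_{2m+n+p}(b)_{m+n}},\qquad X'(a,b;\zeta)=\sum_{m,n,p=0}^\infty\frac{\zeta_1^m\zeta_2^n\zeta_3^p\,(a)_{2m-n-p}}{(m-n)!\,p!\,(b)_m},$$ where $1/(m-n)!=0$ for $n>m$. Further, $$\Xi_2(a,b;c;u,v)=\sum_{m,n}\frac{(a)_m(b)_m}{(c)_{m+n}}\frac{u^m}{m!}\frac{v^n}{n!},\quad \mathrm H_{10}(a;c;u,v)=\sum_{m,n}\frac{(a)_{2m-n}}{(c)_m}\frac{u^m}{m!}\frac{v^n}{n!},\quad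 H_3(a,b;c;u,v)=\sum_{m,n}\frac{(a)_{2m+n}(b)_n}{(c)_{m+n}}\frac{u^m}{m!}\frac{v^n}{n!}.$$ **Lemma.** Let $x,y,z\in\mathbb C$, $z\ne0$, satisfy at least one of the conditions (i) $4|x|\le|z|^2$ and $|yz|<4$; (ii) $4|x|<|z|^2$ and $|xy|\le|z|+\sqrt{|z|^2-4|x|}$, where, in the case of equality, $x/z^2$ and $yz$ are not both positive real numbers; (iii) $|x|<R|z|^2$ and $|xy|<2S|z|$ for some real $R,S$ with $R+(S-\frac12)^2=\frac14$. Then $$\sum_{m=0}^\infty\sum_{n=0}^m\frac{m!\,x^my^n}{(2m+1)!\,(m-n)!}K_{2m-n+\frac12}(z)=\sqrt{\frac{\pi}{2z}}\,X'\Big(\tfrac12,\tfrac32;\tfrac{x}{z^2},\tfrac{yz}{2},-\tfrac{z^2}{4}\Big)-\sqrt{\frac{\pi z}{2}}\,X\Big(\tfrac32,\tfrac32;\tfrac{xz^2}{16},-\tfrac{xyz}{8},\tfrac{z^2}{4}\Big),$$ $$\sum_{m=0}^\infty\sum_{n=0}^m\frac{m!\,x^my^n}{(2m)!\,(m-n)!}K_{2m-n-\frac12}(z)=\sqrt{\frac{\pi}{2z}}\,X\Big(\tfrac12,\tfrac12;\tfrac{xz^2}{16},-\tfrac{xyz}{8},\tfrac{z^2}{4}\Big)-\sqrt{\frac{\pi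 z}{2}}\,X'\Big(-\tfrac12,\tfrac12;\tfrac{x}{z^2},\tfrac{yz}{2},-\tfrac{z^2}{4}\Big).$$ Under (i), under (iii), and under (ii) with strict inequality, the double series on the left and the triple series $X'$ are absolutely convergent. In the case of equality in (ii) the series over $m$ on the left (of the finite sums over $n\le m$) converge, possibly only conditionally, and $X'$ stands for the sum, in the natural order of $n$ and possibly only conditional, of the second of the following representations. With $\zeta_1=\frac{x}{z^2}$, $\zeta_2=\frac{yz}2$, $\zeta_3=-\frac{z^2}4$ and $(a,b)=(\frac12,\frac32)$ or $(-\frac12,\frac12)$, $$X'(a,b;\zeta)=\begin{cases}\displaystyle\sum_{n=0}^\infty\frac{\zeta_1^n(a)_{2n}}{n!\,(b)_n}\,\Xi_2(1,-n;1-a-2n;\zeta_2,-\zeta_3)&\text{under (i)},\\[2mm]\displaystyle\sum_{n=0}^\infty\frac{(\zeta_1\zeta_2)^n(a)_n}{(b)_n}\,\mathrm H_{10}(a+n;b+n;\zeta_1,\zeta_3)&\text{under (ii)},\\[2mm]\displaystyle\sum_{n=0}^\infty\frac{(-\zeta_3)^n}{n!\,(1-a)_n}\,H_3(a-n,1;b;\zeta_1,\zeta_1\zeta_2)&\text{under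 (iii)}.\end{cases}$$ For all $x,y,z$ with $z\neq0$ the triple series $X$ at the arguments above converges absolutely, and for $(a,b)=(\frac32,\frac32)$ and $(\frac12,\frac12)$, with $\zeta_1=\frac{xz^2}{16}$, $\zeta_2=-\frac{xyz}8$, $\zeta_3=\frac{z^2}4$, it can also be summed as $$X(a,b;\zeta)=\sum_{n}\frac{\zeta_1^n}{n!(a)_{2n}(b)_n}\sum_{r,s}\frac{(1)_r\,\zeta_2^r\zeta_3^s}{(a+2n)_{r+s}(b+n)_r\,r!s!}=\sum_n\frac{\zeta_2^n}{(a)_n(b)_n}\sum_{r,s}\frac{\zeta_1^r\zeta_3^s}{(a+n)_{2r+s}(b+n)_r\,r!s!}=\sum_n\frac{\zeta_3^n}{n!(a)_n}\sum_{r,s}\frac{(1)_s\,\zeta_1^r\zeta_2^s}{(a+n)_{2r+s}(b)_{r+s}\,r!s!},$$ where the inner double sums, absolutely convergent, are the Kampé de Fériet function $F^{0:1;0}_{1:1;0}$ and the generalized Lauricella functions $F^{0:0;0}_{1:1;0}$ and $F^{0:0;1}_{2:0;0}$. -/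

import Mathlib

/-- The Pochhammer symbol `(a)_k = a (a + 1) ⋯ (a + k - 1)` with a natural index. -/
noncomputable def poch (a : ℂ) (k : ℕ) : ℂ := (ascPochhammer ℂ k).eval a

/-- The Pochhammer symbol `(a)_k = Γ(a + k) / Γ(a)` with an integer index; for a negative index it
is `(a)_{-j} = 1 / ((a - 1) (a - 2) ⋯ (a - j))`. -/
noncomputable def pochInt (a : ℂ) : ℤ → ℂ
  | Int.ofNat k => poch a k
  | Int.negSucc k => (poch (a - (k + 1)) (k + 1))⁻¹

/-- The modified Bessel function of the first kind `I_ν(z)`, principal branch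
(the inverse of `Complex.Gamma` vanishes at the poles of the Gamma function). -/
noncomputable def besselI (ν z : ℂ) : ℂ :=
  (z / 2) ^ ν * ∑' k : ℕ, (z ^ 2 / 4) ^ k / ((k.factorial : ℂ) * Complex.Gamma (ν + k + 1))

open Classical in
/-- The Macdonald function `K_ν(z)`, principal branch:
`(π / 2) (I_{-ν}(z) - I_ν(z)) / sin (π ν)` if `ν` is not an integer, and the limit of this
expression in the order if `ν` is an integer. -/
noncomputable def macdonaldK (ν z : ℂ) : ℂ :=
  if ∃ k : ℤ, ν = k then
    Filter.limUnder (nhdsWithin ν {ν}ᶜ) fun μ =>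
      (Real.pi / 2 : ℂ) * ((besselI (-μ) z - besselI μ z) / Complex.sin (Real.pi * μ))
  else (Real.pi / 2 : ℂ) * ((besselI (-ν) z - besselI ν z) / Complex.sin (Real.pi * ν))

/-- General term of the Kampé de Fériet double series with parameters
`(a) : (b); (c);` over `(α) : (β); (γ);`. -/
noncomputable def kampeDeFerietTerm (a b c α β γ : List ℂ) (u v : ℂ) (q : ℕ × ℕ) : ℂ :=
  ((a.map fun t => poch t (q.1 + q.2)).prod * (b.map fun t => poch t q.1).prod
      * (c.map fun t => poch t q.2).prod)
    / ((α.map fun t => poch t (q.1 + q.2)).prod * (β.map fun t => poch t q.1).prod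
      * (γ.map fun t => poch t q.2).prod)
    * (u ^ q.1 * v ^ q.2 / ((q.1.factorial : ℂ) * (q.2.factorial : ℂ)))

/-- The Kampé de Fériet function. -/
noncomputable def kampeDeFeriet (a b c α β γ : List ℂ) (u v : ℂ) : ℂ :=
  ∑' q : ℕ × ℕ, kampeDeFerietTerm a b c α β γ u v q

/-- General term of the generalized Lauricella (Srivastava–Daoust) double series, for natural
coefficients. An entry `(t, θ, η)` of `a` or `c` stands for `(t : θ, η)`, that is, for the factor
`(t)_{r θ + s η}`; an entry `(t, φ)` of `b` or `d` for `(t)_{r φ}`, one of `b₂` or `d₂` for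
`(t)_{s φ}`. -/
noncomputable def lauricellaTerm (a : List (ℂ × ℕ × ℕ)) (b b₂ : List (ℂ × ℕ))
    (c : List (ℂ × ℕ × ℕ)) (d d₂ : List (ℂ × ℕ)) (u v : ℂ) (q : ℕ × ℕ) : ℂ :=
  ((a.map fun t => poch t.1 (q.1 * t.2.1 + q.2 * t.2.2)).prod
      * (b.map fun t => poch t.1 (q.1 * t.2)).prod * (b₂.map fun t => poch t.1 (q.2 * t.2)).prod)
    / ((c.map fun t => poch t.1 (q.1 * t.2.1 + q.2 * t.2.2)).prod
      * (d.map fun t => poch t.1 (q.1 * t.2)).prod * (d₂.map fun t => poch t.1 (q.2 * t.2)).prod)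
    * (u ^ q.1 * v ^ q.2 / ((q.1.factorial : ℂ) * (q.2.factorial : ℂ)))

/-- The generalized Lauricella function of two variables. -/
noncomputable def lauricella (a : List (ℂ × ℕ × ℕ)) (b b₂ : List (ℂ × ℕ))
    (c : List (ℂ × ℕ × ℕ)) (d d₂ : List (ℂ × ℕ)) (u v : ℂ) : ℂ :=
  ∑' q : ℕ × ℕ, lauricellaTerm a b b₂ c d d₂ u v q

/-- General term of the complete Horn series `H₃(a, b; c; u, v)`. -/
noncomputable def hornH3Term (a b c u v : ℂ) (q : ℕ × ℕ) : ℂ :=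
  poch a (2 * q.1 + q.2) * poch b q.2 / poch c (q.1 + q.2)
    * (u ^ q.1 / (q.1.factorial : ℂ)) * (v ^ q.2 / (q.2.factorial : ℂ))

/-- The complete Horn function `H₃(a, b; c; u, v)`. -/
noncomputable def hornH3 (a b c u v : ℂ) : ℂ := ∑' q : ℕ × ℕ, hornH3Term a b c u v q

/-- General term of the confluent Horn series `H₁₀(a; c; u, v)`. -/
noncomputable def hornH10Term (a c u v : ℂ) (q : ℕ × ℕ) : ℂ :=
  pochInt a (2 * (q.1 : ℤ) - q.2) / poch c q.1
    * (u ^ q.1 / (q.1.factorial : ℂ)) * (v ^ q.2 / (q.2.factorial : ℂ))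

/-- The confluent Horn function `H₁₀(a; c; u, v)`. -/
noncomputable def hornH10 (a c u v : ℂ) : ℂ := ∑' q : ℕ × ℕ, hornH10Term a c u v q

/-- General term of the confluent Appell (Humbert) series `Ξ₂(a, b; c; u, v)`. -/
noncomputable def humbertXi2Term (a b c u v : ℂ) (q : ℕ × ℕ) : ℂ :=
  poch a q.1 * poch b q.1 / poch c (q.1 + q.2)
    * (u ^ q.1 / (q.1.factorial : ℂ)) * (v ^ q.2 / (q.2.factorial : ℂ))

/-- The confluent Appell (Humbert) function `Ξ₂(a, b; c; u, v)`. -/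
noncomputable def humbertXi2 (a b c u v : ℂ) : ℂ := ∑' q : ℕ × ℕ, humbertXi2Term a b c u v q

/-- General term, at `(m, n, p)`, of the triple series `X(a, b; ζ)`. -/
noncomputable def XTerm (a b ζ₁ ζ₂ ζ₃ : ℂ) (q : ℕ × ℕ × ℕ) : ℂ :=
  ζ₁ ^ q.1 * ζ₂ ^ q.2.1 * ζ₃ ^ q.2.2
    / ((q.1.factorial : ℂ) * (q.2.2.factorial : ℂ) * poch a (2 * q.1 + q.2.1 + q.2.2)
      * poch b (q.1 + q.2.1))

/-- The triple series `X(a, b; ζ)`. -/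
noncomputable def XSeries (a b ζ₁ ζ₂ ζ₃ : ℂ) : ℂ := ∑' q : ℕ × ℕ × ℕ, XTerm a b ζ₁ ζ₂ ζ₃ q

/-- General term, at `(m, n, p)`, of the triple series `X′(a, b; ζ)`; as `1 / (m - n)! = 0` for
`m < n`, only the terms with `n ≤ m` are present. -/
noncomputable def XpTerm (a b ζ₁ ζ₂ ζ₃ : ℂ) (q : ℕ × ℕ × ℕ) : ℂ :=
  if q.2.1 ≤ q.1 then
    ζ₁ ^ q.1 * ζ₂ ^ q.2.1 * ζ₃ ^ q.2.2 * pochInt a (2 * (q.1 : ℤ) - q.2.1 - q.2.2)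
      / (((q.1 - q.2.1).factorial : ℂ) * (q.2.2.factorial : ℂ) * poch b q.1)
  else 0

/-- The triple series `X′(a, b; ζ)`. -/
noncomputable def XpSeries (a b ζ₁ ζ₂ ζ₃ : ℂ) : ℂ := ∑' q : ℕ × ℕ × ℕ, XpTerm a b ζ₁ ζ₂ ζ₃ q

/-- The triple series `X(a, b; ζ)` converges absolutely and has its three representations as a
series of Kampé de Fériet and generalized Lauricella functions, all series being absolutely
convergent. -/
def XRepresentations (a b ζ₁ ζ₂ ζ₃ : ℂ) : Prop :=
  Summable (XTerm a b ζ₁ ζ₂ ζ₃) ∧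
  ((∀ n : ℕ, Summable (kampeDeFerietTerm [] [1] [] [a + 2 * n] [b + n] [] ζ₂ ζ₃)) ∧
    HasSum (fun n : ℕ => ζ₁ ^ n / ((n.factorial : ℂ) * poch a (2 * n) * poch b n)
      * kampeDeFeriet [] [1] [] [a + 2 * n] [b + n] [] ζ₂ ζ₃) (XSeries a b ζ₁ ζ₂ ζ₃)) ∧
  ((∀ n : ℕ, Summable (lauricellaTerm [] [] [] [(a + n, 2, 1)] [(b + n, 1)] [] ζ₁ ζ₃)) ∧
    HasSum (fun n : ℕ => ζ₂ ^ n / (poch a n * poch b n)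
      * lauricella [] [] [] [(a + n, 2, 1)] [(b + n, 1)] [] ζ₁ ζ₃) (XSeries a b ζ₁ ζ₂ ζ₃)) ∧
  ((∀ n : ℕ, Summable (lauricellaTerm [] [] [(1, 1)] [(a + n, 2, 1), (b, 1, 1)] [] [] ζ₁ ζ₂)) ∧
    HasSum (fun n : ℕ => ζ₃ ^ n / ((n.factorial : ℂ) * poch a n)
      * lauricella [] [] [(1, 1)] [(a + n, 2, 1), (b, 1, 1)] [] [] ζ₁ ζ₂) (XSeries a b ζ₁ ζ₂ ζ₃))

/-- The `n`-th term of the representation of `X′` as a series of functions `Ξ₂`. -/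
noncomputable def XpXi2Term (a b ζ₁ ζ₂ ζ₃ : ℂ) (n : ℕ) : ℂ :=
  ζ₁ ^ n * poch a (2 * n) / ((n.factorial : ℂ) * poch b n)
    * humbertXi2 1 (-n) (1 - a - 2 * n) ζ₂ (-ζ₃)

/-- The `n`-th term of the representation of `X′` as a series of functions `H₁₀`. -/
noncomputable def XpH10Term (a b ζ₁ ζ₂ ζ₃ : ℂ) (n : ℕ) : ℂ :=
  (ζ₁ * ζ₂) ^ n * poch a n / poch b n * hornH10 (a + n) (b + n) ζ₁ ζ₃

/-- The `n`-th term of the representation of `X′` as a series of functions `H₃`. -/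
noncomputable def XpH3Term (a b ζ₁ ζ₂ ζ₃ : ℂ) (n : ℕ) : ℂ :=
  (-ζ₃) ^ n / ((n.factorial : ℂ) * poch (1 - a) n) * hornH3 (a - n) 1 b ζ₁ (ζ₁ * ζ₂)

/-- The series `∑ f n`, summed in the natural order, converges to `s` (possibly conditionally). -/
def SeriesTendsto (f : ℕ → ℂ) (s : ℂ) : Prop :=
  Filter.Tendsto (fun N : ℕ => ∑ n ∈ Finset.range N, f n) Filter.atTop (nhds s)

/-- Term of the first double series in Macdonald functions (for `n ≤ m`). -/
noncomputable def macdonaldTerm1 (x y z : ℂ) (m n : ℕ) : ℂ :=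
  (m.factorial : ℂ) * x ^ m * y ^ n / (((2 * m + 1).factorial : ℂ) * ((m - n).factorial : ℂ))
    * macdonaldK (2 * m - n + 1 / 2) z

/-- Term of the second double series in Macdonald functions (for `n ≤ m`). -/
noncomputable def macdonaldTerm2 (x y z : ℂ) (m n : ℕ) : ℂ :=
  (m.factorial : ℂ) * x ^ m * y ^ n / (((2 * m).factorial : ℂ) * ((m - n).factorial : ℂ))
    * macdonaldK (2 * m - n - 1 / 2) z

/-- Absolute convergence of the double series `∑_m ∑_{n ≤ m} f m n`. -/
def TriangleSummable (f : ℕ → ℕ → ℂ) : Prop :=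
  Summable fun q : ℕ × ℕ => if q.2 ≤ q.1 then f q.1 q.2 else 0

/-- Condition (i). -/
def CondI (x y z : ℂ) : Prop := 4 * ‖x‖ ≤ ‖z‖ ^ 2 ∧ ‖y * z‖ < 4

/-- Condition (ii). In the case of equality, the numbers `x / z ^ 2` and `y z` must not both be
positive real numbers (there all the series diverge). -/
def CondII (x y z : ℂ) : Prop :=
  4 * ‖x‖ < ‖z‖ ^ 2 ∧ ‖x * y‖ ≤ ‖z‖ + √(‖z‖ ^ 2 - 4 * ‖x‖) ∧
  (‖x * y‖ = ‖z‖ + √(‖z‖ ^ 2 - 4 * ‖x‖) →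
    ¬ ∃ s t : ℝ, 0 < s ∧ 0 < t ∧ x / z ^ 2 = s ∧ y * z = t)

/-- Condition (iii). -/
def CondIII (x y z : ℂ) : Prop :=
  ∃ R S : ℝ, R + (S - 1 / 2) ^ 2 = 1 / 4 ∧ ‖x‖ < R * ‖z‖ ^ 2 ∧ ‖x * y‖ < 2 * S * ‖z‖

/-!
Both double series have terms with `K_{a + k}(z)`, `k = 2 m - n`, where `a = 1 / 2` or `a = -1 / 2`;
the parameters of `X'` are then `(a, a + 1)` and those of `X` are `(a + 1, a + 1)`. Writing
`K_{a + k}` through `I_{-(a + k)}` and `I_{a + k}`, expanding both in powers of `z`, and using the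
reflection formula for `Γ`, each term becomes a series over `p` of terms of `X'` minus one of terms
of `X` (`NotInteger.macdonald_term`). What remains is the convergence of these triple series.

The series `X` is dominated by a product of three exponential series. For `X'`, put `m + n` for `m`,
so that the sum runs over all `(m, n, p)`, and let `N = 2 m + n`. A Pochhammer symbol of a half-odd
parameter drops by a factor of at most four when its index is lowered
(`IsHalf.norm_pochInt_sub_le`), which disposes of `p`; and `(a)_N / (a + 1)_{m + n}` is
`O(N! / ((m + n)! (N + 1)))` (`IsHalf.norm_pochQuot_le`). So everything is dominated by
`∑ C(N, m) |ζ₁| ^ m |ζ₁ ζ₂| ^ n / (N + 1)`. The binomial theorem gives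
`C(N, m) (1 - q) ^ m q ^ (m + n) ≤ 1`, hence geometric convergence as soon as `|ζ₁ ζ₂| < q` and
`|ζ₁| < q (1 - q)` for some `q`; this covers condition (iii), with `q = S`, and condition (ii) with
strict inequality. Under condition (i) the sum is compared with `∑ C(2 M, M) 4 ^ (-M) / (M + 1)`,
which telescopes. The representations of `X` and `X'` are rearrangements.

In the case of equality in (ii) one has `|ζ₁| = P Q` and `|ζ₁ ζ₂| = P` with `P + Q = 1` and
`0 < Q < 1 / 2`, and `C(N, m) |ζ₁| ^ m |ζ₁ ζ₂| ^ n` is the binomial probability of `m` successes in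
`N` trials. As the binomial distribution is concentrated at `m = Q N`, the coefficients may be
replaced by `κ C(N, m) / N`, at the cost of an error that contributes `O(N ^ (-3 / 2))` on
`2 m + n = N` and so is absolutely summable (`exists_summable_triTerm_sub`). For this model both
orders of summation are explicit. Summed over `m` first it gives `∑ w ^ n / n`, `w = ζ₂ G`, where
`G` is the smaller root of `G (1 - G) = ζ₁` (`hasSum_modelTerm_fst`). Summed over triangles it gives
`∑ v ^ M / M`, `v = ζ₁ / (q (1 - q))`, `q = 1 / ζ₂`, up to tails of negative binomial series, which
decay geometrically (`norm_sum_modelTerm_sub_le`). Both `w` and `v` lie in the closed unit disc, and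
either is `1` only if `ζ₁ = P Q` and `ζ₂ = 1 / Q`, the excluded case of positive numbers; so both
series converge, and Abel's theorem, applied along `σ ζ₂` with `σ → 1-`, shows that their sums agree
(`exists_seriesTendsto_model`).
-/

open Filter Topology

/-! ### Pochhammer symbols -/

theorem poch_zero (a : ℂ) : poch a 0 = 1 := by simp [poch]

theorem poch_succ (a : ℂ) (k : ℕ) : poch a (k + 1) = poch a k * (a + k) :=
  ascPochhammer_succ_eval k a

theorem poch_add (a : ℂ) (j k : ℕ) : poch a (j + k) = poch a j * poch (a + j) k := by
  induction k with
  | zero => simp [poch_zero]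
  | succ k ih =>
    rw [← add_assoc, poch_succ, poch_succ, ih]
    push_cast
    ring

theorem poch_one_left (k : ℕ) : poch 1 k = (k.factorial : ℂ) := by
  simp [poch]

theorem poch_neg_natCast {m r : ℕ} (h : r ≤ m) :
    poch (-(m : ℂ)) r = (-1) ^ r * ((m.factorial : ℂ) / ((m - r).factorial : ℂ)) := by
  induction r with
  | zero =>
    have : (m.factorial : ℂ) ≠ 0 := by exact_mod_cast m.factorial_ne_zero
    simp [poch_zero, this]
  | succ r ih =>
    rw [poch_succ, ih (by omega)]
    have h1 : m - r = (m - (r + 1)) + 1 := by omega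
    have h2 : (m : ℂ) = ((m - (r + 1) : ℕ) : ℂ) + (r + 1) := by
      rw [Nat.cast_sub h]
      push_cast
      ring
    have h3 : ((m - (r + 1)).factorial : ℂ) ≠ 0 := by exact_mod_cast (m - (r + 1)).factorial_ne_zero
    have h4 : ((m - (r + 1) : ℕ) : ℂ) + 1 ≠ 0 := by exact_mod_cast Nat.succ_ne_zero (m - (r + 1))
    rw [h1, Nat.factorial_succ, pow_succ]
    push_cast
    rw [show -(m : ℂ) + r = -(((m - (r + 1) : ℕ) : ℂ) + 1) by rw [h2]; ring]
    field_simp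

theorem poch_neg_natCast_of_lt {m r : ℕ} (h : m < r) : poch (-(m : ℂ)) r = 0 :=
  ascPochhammer_eval_neg_coe_nat_of_lt h

/-- `a` is not an integer; in this form the hypothesis excludes all the zeros and poles of the
Pochhammer symbols of `a` at once. -/
def NotInteger (a : ℂ) : Prop := ∀ k : ℤ, a + k ≠ 0

namespace NotInteger

theorem add_int {a : ℂ} (ha : NotInteger a) (k : ℤ) : NotInteger (a + k) := fun j => by
  have := ha (k + j)
  push_cast at this
  rwa [add_assoc]

theorem add_one {a : ℂ} (ha : NotInteger a) : NotInteger (a + 1) := by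
  simpa using ha.add_int 1

theorem neg {a : ℂ} (ha : NotInteger a) : NotInteger (-a) := fun j h => by
  apply ha (-j)
  push_cast
  linear_combination -h

theorem one_sub {a : ℂ} (ha : NotInteger a) : NotInteger (1 - a) := by
  have := ha.neg.add_int 1
  rwa [show -a + ((1 : ℤ) : ℂ) = 1 - a by push_cast; ring] at this

theorem ne_neg_nat {a : ℂ} (ha : NotInteger a) (k : ℕ) : a ≠ -k := fun h => by
  apply ha k
  rw [h]
  simp

theorem Gamma_ne_zero {a : ℂ} (ha : NotInteger a) : Complex.Gamma a ≠ 0 :=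
  Complex.Gamma_ne_zero ha.ne_neg_nat

theorem poch_ne_zero {a : ℂ} (ha : NotInteger a) (k : ℕ) : poch a k ≠ 0 := by
  induction k with
  | zero => simp [poch_zero]
  | succ k ih =>
    rw [poch_succ]
    exact mul_ne_zero ih (by simpa using ha k)

theorem Gamma_add_nat {a : ℂ} (ha : NotInteger a) (k : ℕ) :
    Complex.Gamma (a + k) = poch a k * Complex.Gamma a := by
  induction k with
  | zero => simp [poch_zero]
  | succ k ih =>
    rw [poch_succ]
    push_cast
    rw [← add_assoc, Complex.Gamma_add_one _ (by simpa using ha k), ih]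
    ring

theorem Gamma_add_int {a : ℂ} (ha : NotInteger a) (k : ℤ) :
    Complex.Gamma (a + k) = pochInt a k * Complex.Gamma a := by
  cases k with
  | ofNat k => simpa [pochInt] using ha.Gamma_add_nat k
  | negSucc k =>
    have hb := ha.add_int (Int.negSucc k)
    have h := hb.Gamma_add_nat (k + 1)
    have e : a + ((Int.negSucc k : ℤ) : ℂ) = a - (k + 1) := by
      rw [Int.cast_negSucc]
      push_cast
      ring
    rw [e] at h hb ⊢
    have e2 : a - ((k : ℂ) + 1) + ((k + 1 : ℕ) : ℂ) = a := by
      push_cast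
      ring
    rw [e2] at h
    rw [h]
    simp only [pochInt]
    have := hb.poch_ne_zero (k + 1)
    field_simp

theorem pochInt_add_nat {a : ℂ} (ha : NotInteger a) (k : ℤ) (j : ℕ) :
    pochInt a (k + j) = pochInt a k * poch (a + k) j := by
  have h1 := ha.Gamma_add_int (k + j)
  have h2 := (ha.add_int k).Gamma_add_nat j
  have h3 := ha.Gamma_add_int k
  push_cast at h1
  rw [← add_assoc, h2, h3] at h1
  apply mul_right_cancel₀ ha.Gamma_ne_zero
  rw [← h1]
  ring

theorem pochInt_add_int {a : ℂ} (ha : NotInteger a) (k j : ℤ) :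
    pochInt a (k + j) = pochInt a k * pochInt (a + k) j := by
  have h1 := ha.Gamma_add_int (k + j)
  have h2 := (ha.add_int k).Gamma_add_int j
  have h3 := ha.Gamma_add_int k
  push_cast at h1
  rw [← add_assoc, h2, h3] at h1
  apply mul_right_cancel₀ ha.Gamma_ne_zero
  rw [← h1]
  ring

theorem pochInt_succ {a : ℂ} (ha : NotInteger a) (k : ℤ) :
    pochInt a (k + 1) = pochInt a k * (a + k) := by
  have := ha.pochInt_add_nat k 1
  simpa [poch_succ, poch_zero] using this

end NotInteger

theorem pochInt_natCast (a : ℂ) (k : ℕ) : pochInt a k = poch a k := rfl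

/-- The reflection `(a)_{-j} = (-1) ^ j / (1 - a)_j`. -/
theorem pochInt_neg_natCast (a : ℂ) (j : ℕ) : pochInt a (-(j : ℤ)) = (-1) ^ j / poch (1 - a) j := by
  have key : ∀ j : ℕ, poch (a - j) j = (-1) ^ j * poch (1 - a) j := by
    intro j
    induction j with
    | zero => simp [poch_zero]
    | succ j ih =>
      have h : poch (a - ((j + 1 : ℕ) : ℂ)) (1 + j) = _ := poch_add _ 1 j
      rw [add_comm 1 j] at h
      rw [h, poch_succ, poch_succ, poch_zero, pow_succ]
      have e : a - ((j + 1 : ℕ) : ℂ) + ((1 : ℕ) : ℂ) = a - j := by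
        push_cast
        ring
      rw [e, ih]
      push_cast
      ring
  cases j with
  | zero => simp [poch_zero, show pochInt a 0 = poch a 0 from rfl]
  | succ j =>
    have h := key (j + 1)
    have e : -((j + 1 : ℕ) : ℤ) = Int.negSucc j := rfl
    rw [e]
    simp only [pochInt]
    push_cast at h
    rw [h, mul_inv, div_eq_mul_inv, ← inv_pow]
    norm_num

/-- Splitting off `p` downward steps: `(a)_{k - p} = (-1) ^ p (a)_k / (1 - a - k)_p`. -/
theorem NotInteger.pochInt_sub_nat {a : ℂ} (ha : NotInteger a) (k : ℤ) (p : ℕ) :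
    pochInt a (k - p) = (-1) ^ p * pochInt a k / poch (1 - a - k) p := by
  rw [sub_eq_add_neg, ha.pochInt_add_int, pochInt_neg_natCast]
  rw [show (1 : ℂ) - (a + k) = 1 - a - k by ring]
  ring

/-! ### Bounds for half-odd parameters -/

/-- The two first parameters occurring in the series `X'`. -/
def IsHalf (a : ℝ) : Prop := a = 1 / 2 ∨ a = -1 / 2

namespace IsHalf

theorem notInteger {a : ℝ} (ha : IsHalf a) : NotInteger (a : ℂ) := fun k h => by
  have h1 : a + k = 0 := by exact_mod_cast h
  rcases ha with rfl | rfl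
  · have : (1 + 2 * k : ℝ) = 0 := by linarith
    have : (1 + 2 * k : ℤ) = 0 := by exact_mod_cast this
    omega
  · have : (-1 + 2 * k : ℝ) = 0 := by linarith
    have : (-1 + 2 * k : ℤ) = 0 := by exact_mod_cast this
    omega

/-- `|(a)_k|` decreases only at the two steps of `k` where `|a + k| = 1 / 2`, and there it is
halved; so it never drops by more than a factor of four. -/
theorem norm_pochInt_le {a : ℝ} (ha : IsHalf a) (k : ℤ) (j : ℕ) :
    ‖pochInt a k‖ ≤ 4 * ‖pochInt a (k + j)‖ := by
  set c : ℤ → ℝ := fun k => if a + k < 0 then 1 else if a + k < 1 then 2 else 4 with hc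
  have hc1 : ∀ k, 1 ≤ c k ∧ c k ≤ 4 := by
    intro k
    simp only [hc]
    split_ifs <;> norm_num
  have hmono : Monotone fun k : ℤ => ‖pochInt a k‖ * c k := by
    apply monotone_int_of_le_succ
    intro k
    have hs : ‖pochInt a (k + 1)‖ = ‖pochInt a k‖ * |a + k| := by
      rw [ha.notInteger.pochInt_succ, norm_mul, show (a : ℂ) + k = ((a + k : ℝ) : ℂ) by push_cast; rfl,
        Complex.norm_real, Real.norm_eq_abs]
    rw [hs, mul_assoc]
    refine mul_le_mul_of_nonneg_left ?_ (norm_nonneg _)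
    obtain ⟨j, hj⟩ : ∃ j : ℤ, a + k = j + 1 / 2 := by
      rcases ha with rfl | rfl
      · exact ⟨k, by ring⟩
      · exact ⟨k - 1, by push_cast; ring⟩
    simp only [hc]
    push_cast
    rw [show a + ((k : ℝ) + 1) = (j + 1 / 2) + 1 by linarith, hj]
    rcases lt_trichotomy j (-1) with h | rfl | h
    · have h' : (j : ℝ) ≤ -2 := by exact_mod_cast (by omega : j ≤ -2)
      rw [if_pos (by linarith), if_pos (by linarith), abs_of_neg (by linarith)]
      linarith
    · norm_num
    · rcases eq_or_lt_of_le (show 0 ≤ j by omega) with rfl | h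
      · norm_num
      · have h' : (1 : ℝ) ≤ j := by exact_mod_cast h
        rw [if_neg (by linarith), if_neg (by linarith), if_neg (by linarith), if_neg (by linarith),
          abs_of_pos (by linarith)]
        linarith
  have h := hmono (show k ≤ k + j by omega)
  simp only at h
  have h1 := hc1 k
  have h2 := hc1 (k + j)
  nlinarith [norm_nonneg (pochInt a k), norm_nonneg (pochInt a (k + j))]

theorem norm_pochInt_sub_le {a : ℝ} (ha : IsHalf a) (k : ℤ) (p : ℕ) :
    ‖pochInt a (k - p)‖ ≤ 4 * ‖pochInt a k‖ := by
  simpa using ha.norm_pochInt_le (k - p) p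

/-- With at least one downward step, a factor `1 / (N + 1)` is gained. -/
theorem norm_pochInt_sub_succ_le {a : ℝ} (ha : IsHalf a) (N : ℕ) (p : ℕ) :
    ‖pochInt a ((N : ℤ) - (p + 1 : ℕ))‖ ≤ 24 / ((N : ℝ) + 1) * ‖poch a N‖ := by
  have h := ha.norm_pochInt_sub_le ((N : ℤ) - 1) p
  have e : (N : ℤ) - (p + 1 : ℕ) = N - 1 - p := by push_cast; ring
  rw [e]
  refine h.trans ?_
  have hs := ha.notInteger.pochInt_succ ((N : ℤ) - 1)
  rw [sub_add_cancel, pochInt_natCast] at hs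
  rw [hs, norm_mul]
  have h3 : ((N : ℝ) + 1) / 6 ≤ ‖(a : ℂ) + ((N - 1 : ℤ) : ℂ)‖ := by
    rw [show (a : ℂ) + ((N - 1 : ℤ) : ℂ) = ((a + (N - 1) : ℝ) : ℂ) by push_cast; rfl,
      Complex.norm_real, Real.norm_eq_abs]
    rcases N with _ | _ | _ | N
    · rcases ha with rfl | rfl <;> norm_num
    · rcases ha with rfl | rfl <;> norm_num
    · rcases ha with rfl | rfl <;> norm_num
    · refine le_trans ?_ (le_abs_self _)
      have := Nat.cast_nonneg (α := ℝ) N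
      push_cast
      rcases ha with rfl | rfl <;> linarith
  have hN : (0 : ℝ) < (N : ℝ) + 1 := by positivity
  rw [div_mul_eq_mul_div, le_div_iff₀ hN]
  have := norm_nonneg (pochInt (a : ℂ) (N - 1))
  nlinarith

end IsHalf

/-! ### The Macdonald function of order `a + k` -/

theorem sin_pi_mul_add_nat_sub_nat (a : ℂ) (k j : ℕ) :
    Complex.sin (Real.pi * (a + k - j)) = (-1) ^ k * (-1) ^ j * Complex.sin (Real.pi * a) := by
  have h1 := Complex.sin_antiperiodic.add_nat_mul_eq (x := Real.pi * a) k
  have h2 := Complex.sin_antiperiodic.sub_nat_mul_eq (x := Real.pi * a + k * Real.pi) j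
  rw [h1] at h2
  rw [show (Real.pi : ℂ) * (a + k - j) = Real.pi * a + k * Real.pi - j * Real.pi by ring, h2]
  ring

theorem NotInteger.sin_ne_zero {a : ℂ} (ha : NotInteger a) : Complex.sin (Real.pi * a) ≠ 0 := by
  intro h
  obtain ⟨k, hk⟩ := Complex.sin_eq_zero_iff.1 h
  have hpi : (Real.pi : ℂ) ≠ 0 := by exact_mod_cast Real.pi_ne_zero
  apply ha (-k)
  have : a = k := mul_left_cancel₀ hpi (by rw [hk]; ring)
  rw [this]
  push_cast
  ring

/-- The reciprocal Gamma factors in `I_{-(a + k)}`, by the reflection formula. -/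
theorem NotInteger.inv_Gamma_reflect {a : ℂ} (ha : NotInteger a) (k j : ℕ) :
    (Complex.Gamma (-(k + a) + j + 1))⁻¹
      = (-1) ^ k * (-1) ^ j * Complex.sin (Real.pi * a) / Real.pi * Complex.Gamma a
        * pochInt a ((k : ℤ) - j) := by
  have h1 := Complex.Gamma_mul_Gamma_one_sub (a + k - j)
  have h2 := ha.Gamma_add_int ((k : ℤ) - j)
  have hn := (ha.add_int ((k : ℤ) - j))
  push_cast at h2 hn
  rw [← add_sub_assoc] at h2 hn
  rw [sin_pi_mul_add_nat_sub_nat] at h1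
  rw [show (1 : ℂ) - (a + k - j) = -(k + a) + j + 1 by ring] at h1
  have hpi : (Real.pi : ℂ) ≠ 0 := by exact_mod_cast Real.pi_ne_zero
  have hs := ha.sin_ne_zero
  rw [inv_eq_iff_eq_inv]
  rw [mul_assoc, ← mul_comm (pochInt a _), ← h2]
  have hg2 := hn.Gamma_ne_zero
  have hs2 : (-1 : ℂ) ^ k * (-1) ^ j * Complex.sin (Real.pi * a) ≠ 0 :=
    mul_ne_zero (mul_ne_zero (pow_ne_zero _ (by norm_num)) (pow_ne_zero _ (by norm_num))) hs
  generalize (-1 : ℂ) ^ k * (-1) ^ j * Complex.sin (Real.pi * a) = σ at *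
  rw [eq_div_iff hs2] at h1
  rw [eq_comm, inv_eq_one_div, div_eq_iff (mul_ne_zero (div_ne_zero hs2 hpi) hg2)]
  field_simp
  linear_combination -h1

theorem NotInteger.macdonaldK_add_nat {a : ℂ} (ha : NotInteger a) (k : ℕ) {z : ℂ} (hz : z ≠ 0) :
    macdonaldK (k + a) z
      = Complex.Gamma a / 2 * (z / 2) ^ (-a) * (((z / 2) ^ k)⁻¹
          * ∑' j : ℕ, (-(z ^ 2 / 4)) ^ j / (j.factorial : ℂ) * pochInt a ((k : ℤ) - j))
        - Real.pi / 2 / (Complex.sin (Real.pi * a) * Complex.Gamma (a + 1)) * (z / 2) ^ a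
          * ((-1) ^ k * (z / 2) ^ k
            * ∑' j : ℕ, (z ^ 2 / 4) ^ j / ((j.factorial : ℂ) * poch (a + 1) (k + j))) := by
  have hz2 : z / 2 ≠ 0 := div_ne_zero hz two_ne_zero
  have hpi : (Real.pi : ℂ) ≠ 0 := by exact_mod_cast Real.pi_ne_zero
  have hs := ha.sin_ne_zero
  have hsk : Complex.sin (Real.pi * (k + a)) = (-1) ^ k * Complex.sin (Real.pi * a) := by
    have := sin_pi_mul_add_nat_sub_nat a k 0
    simpa [add_comm] using this
  have hcond : ¬ ∃ l : ℤ, (k : ℂ) + a = l := by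
    rintro ⟨l, hl⟩
    apply ha (k - l)
    push_cast
    linear_combination hl
  have hI1 : besselI (-(k + a)) z
      = (z / 2) ^ (-a) * ((z / 2) ^ k)⁻¹ * ((-1) ^ k * Complex.sin (Real.pi * a) / Real.pi
        * Complex.Gamma a
        * ∑' j : ℕ, (-(z ^ 2 / 4)) ^ j / (j.factorial : ℂ) * pochInt a ((k : ℤ) - j)) := by
    rw [besselI, ← tsum_mul_left (a := (-1) ^ k * Complex.sin (Real.pi * a) / Real.pi
      * Complex.Gamma a)]
    congr 1
    · rw [show -((k : ℂ) + a) = -a + -k by ring, Complex.cpow_add _ _ hz2, Complex.cpow_neg _ (k : ℂ),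
        Complex.cpow_natCast]
    · refine tsum_congr fun j => ?_
      rw [div_eq_mul_inv, mul_inv, ha.inv_Gamma_reflect, neg_pow (z ^ 2 / 4)]
      ring
  have hI2 : besselI (k + a) z
      = (z / 2) ^ a * (z / 2) ^ k * ((Complex.Gamma (a + 1))⁻¹
        * ∑' j : ℕ, (z ^ 2 / 4) ^ j / ((j.factorial : ℂ) * poch (a + 1) (k + j))) := by
    rw [besselI, ← tsum_mul_left (a := (Complex.Gamma (a + 1))⁻¹)]
    congr 1
    · rw [show (k : ℂ) + a = a + k by ring, Complex.cpow_add _ _ hz2, Complex.cpow_natCast]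
    · refine tsum_congr fun j => ?_
      have h := ha.add_one.Gamma_add_nat (k + j)
      rw [show (k : ℂ) + a + j + 1 = a + 1 + ((k + j : ℕ) : ℂ) by push_cast; ring, h]
      simp only [div_eq_mul_inv, mul_inv]
      ring
  rw [macdonaldK, if_neg hcond, hI1, hI2, hsk]
  generalize ∑' j : ℕ, (-(z ^ 2 / 4)) ^ j / (j.factorial : ℂ) * pochInt a ((k : ℤ) - j) = A
  generalize ∑' j : ℕ, (z ^ 2 / 4) ^ j / ((j.factorial : ℂ) * poch (a + 1) (k + j)) = B
  have e : ((-1 : ℂ) ^ k) * (-1) ^ k = 1 := by rw [← mul_pow]; norm_num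
  have einv : ((-1 : ℂ) ^ k)⁻¹ = (-1) ^ k := (eq_inv_of_mul_eq_one_left e).symm
  have hg := ha.add_one.Gamma_ne_zero
  generalize ((z / 2) ^ k)⁻¹ = Z'
  generalize (z / 2) ^ k = Z
  generalize (z / 2) ^ a = Y
  generalize (z / 2) ^ (-a) = Y'
  rw [div_eq_mul_inv _ ((-1) ^ k * Complex.sin (Real.pi * a)), mul_inv, einv]
  generalize (-1 : ℂ) ^ k = s at *
  field_simp
  linear_combination (Z' * A * Complex.Gamma (a + 1) * Complex.Gamma a * Y' * Complex.sin (Real.pi * a)) * e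

/-- The term with index `(m + n, n)` of the double series in Macdonald functions of order
`2 m + n + a`, up to the elementary factors, splits into terms of `X'` and of `X`, each summed over
the last index. -/
theorem NotInteger.macdonald_term {a : ℂ} (ha : NotInteger a) (x y : ℂ) {z : ℂ} (hz : z ≠ 0)
    (m n : ℕ) :
    x ^ (m + n) * y ^ n / (4 ^ (m + n) * poch (a + 1) (m + n) * (m.factorial : ℂ))
        * macdonaldK ((2 * m + n : ℕ) + a) z
      = Complex.Gamma a / 2 * (z / 2) ^ (-a)
          * ∑' p, XpTerm a (a + 1) (x / z ^ 2) (y * z / 2) (-(z ^ 2 / 4)) (m + n, n, p)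
        - Real.pi / 2 / (Complex.sin (Real.pi * a) * Complex.Gamma (a + 1)) * (z / 2) ^ a
          * ∑' p, XTerm (a + 1) (a + 1) (x * z ^ 2 / 16) (-(x * y * z / 8)) (z ^ 2 / 4) (m, n, p) := by
  have h1 : ∑' p, XpTerm a (a + 1) (x / z ^ 2) (y * z / 2) (-(z ^ 2 / 4)) (m + n, n, p)
      = x ^ (m + n) * y ^ n / (4 ^ (m + n) * poch (a + 1) (m + n) * (m.factorial : ℂ))
        * (((z / 2) ^ (2 * m + n))⁻¹ * ∑' j : ℕ, (-(z ^ 2 / 4)) ^ j / (j.factorial : ℂ)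
          * pochInt a (((2 * m + n : ℕ) : ℤ) - j)) := by
    rw [← mul_assoc, ← tsum_mul_left]
    refine tsum_congr fun j => ?_
    simp only [XpTerm]
    rw [if_pos (by omega), show 2 * ((m + n : ℕ) : ℤ) - n - j = ((2 * m + n : ℕ) : ℤ) - j by
      push_cast; ring, Nat.add_sub_cancel]
    have hp := ha.add_one.poch_ne_zero (m + n)
    have hm : (m.factorial : ℂ) ≠ 0 := by exact_mod_cast m.factorial_ne_zero
    have hj : (j.factorial : ℂ) ≠ 0 := by exact_mod_cast j.factorial_ne_zero
    have e4 : (4 : ℂ) = 2 ^ 2 := by norm_num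
    rw [e4]
    simp only [div_pow, mul_pow, ← pow_mul]
    field_simp
    ring
  have h2 : ∑' p, XTerm (a + 1) (a + 1) (x * z ^ 2 / 16) (-(x * y * z / 8)) (z ^ 2 / 4) (m, n, p)
      = x ^ (m + n) * y ^ n / (4 ^ (m + n) * poch (a + 1) (m + n) * (m.factorial : ℂ))
        * ((-1) ^ (2 * m + n) * (z / 2) ^ (2 * m + n)
            * ∑' j : ℕ, (z ^ 2 / 4) ^ j / ((j.factorial : ℂ) * poch (a + 1) (2 * m + n + j))) := by
    rw [← mul_assoc, ← tsum_mul_left]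
    refine tsum_congr fun j => ?_
    simp only [XTerm]
    have hp := ha.add_one.poch_ne_zero (m + n)
    have hp2 := ha.add_one.poch_ne_zero (2 * m + n + j)
    have hm : (m.factorial : ℂ) ≠ 0 := by exact_mod_cast m.factorial_ne_zero
    have hj : (j.factorial : ℂ) ≠ 0 := by exact_mod_cast j.factorial_ne_zero
    have e4 : (4 : ℂ) = 2 ^ 2 := by norm_num
    have e8 : (8 : ℂ) = 2 ^ 3 := by norm_num
    have e16 : (16 : ℂ) = 2 ^ 4 := by norm_num
    have e1 : (-1 : ℂ) ^ (2 * m + n) = (-1) ^ n := by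
      rw [pow_add, pow_mul]
      norm_num
    rw [e4, e8, e16, e1, neg_pow (x * y * z / 2 ^ 3)]
    simp only [div_pow, mul_pow, ← pow_mul]
    field_simp
    ring
  rw [ha.macdonaldK_add_nat _ hz, h1, h2]
  ring

theorem factorial_two_mul (M : ℕ) :
    ((2 * M).factorial : ℂ) = M.factorial * (4 ^ M * poch (1 / 2) M) := by
  induction M with
  | zero => simp [poch_zero]
  | succ M ih =>
    rw [show 2 * (M + 1) = 2 * M + 1 + 1 by ring, Nat.factorial_succ, Nat.factorial_succ,
      Nat.factorial_succ, poch_succ, pow_succ]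
    push_cast
    rw [ih]
    ring

theorem factorial_two_mul_add_one (M : ℕ) :
    ((2 * M + 1).factorial : ℂ) = M.factorial * (4 ^ M * poch (3 / 2) M) := by
  induction M with
  | zero => simp [poch_zero]
  | succ M ih =>
    rw [show 2 * (M + 1) + 1 = 2 * M + 1 + 1 + 1 by ring, Nat.factorial_succ, Nat.factorial_succ,
      Nat.factorial_succ M, poch_succ, pow_succ]
    push_cast
    rw [ih]
    ring

theorem ofReal_mul_cpow {r : ℝ} (hr : 0 < r) {z : ℂ} (hz : z ≠ 0) (c : ℂ) :
    ((r : ℂ) * z) ^ c = (r : ℂ) ^ c * z ^ c := by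
  have hr' : (r : ℂ) ≠ 0 := by exact_mod_cast hr.ne'
  rw [Complex.cpow_def_of_ne_zero (mul_ne_zero hr' hz), Complex.cpow_def_of_ne_zero hr',
    Complex.cpow_def_of_ne_zero hz, Complex.log_ofReal_mul hr hz, Complex.ofReal_log hr.le,
    add_mul, Complex.exp_add]

theorem ofReal_cpow_half {r : ℝ} (hr : 0 ≤ r) : (r : ℂ) ^ (1 / 2 : ℂ) = (√r : ℝ) := by
  rw [Real.sqrt_eq_rpow, Complex.ofReal_cpow hr]
  push_cast
  rfl

theorem sqrt_pi_mul_self : ((√Real.pi : ℝ) : ℂ) * (√Real.pi : ℝ) = Real.pi := by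
  exact_mod_cast Real.mul_self_sqrt Real.pi_pos.le

theorem Gamma_half : Complex.Gamma (1 / 2) = (√Real.pi : ℝ) := by
  rw [Complex.Gamma_one_half_eq, ofReal_cpow_half Real.pi_pos.le]

theorem Gamma_three_halves : Complex.Gamma (1 / 2 + 1) = (√Real.pi : ℝ) / 2 := by
  rw [Complex.Gamma_add_one _ (by norm_num), Gamma_half]
  ring

theorem Gamma_neg_half : Complex.Gamma (-1 / 2) = -2 * (√Real.pi : ℝ) := by
  have h := Complex.Gamma_add_one (-1 / 2) (by norm_num)
  rw [show (-1 / 2 : ℂ) + 1 = 1 / 2 by norm_num, Gamma_half] at h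
  rw [h]
  ring

/-- The two prefactors `√(π / (2 z))` and `√(π z / 2)` in terms of `√(z / 2)`. -/
theorem prefactor_left {z : ℂ} (hz : z ≠ 0) :
    ((√Real.pi : ℝ) : ℂ) / (2 * z) ^ (1 / 2 : ℂ) = (√Real.pi : ℝ) / 2 * (z / 2) ^ (-(1 / 2) : ℂ) := by
  have e : (2 : ℂ) * z = ((4 : ℝ) : ℂ) * (z / 2) := by push_cast; ring
  have e2 : √(4 : ℝ) = 2 := by
    rw [show (4 : ℝ) = 2 ^ 2 by norm_num]
    exact Real.sqrt_sq (by norm_num)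
  rw [e, ofReal_mul_cpow (by norm_num) (div_ne_zero hz two_ne_zero), ofReal_cpow_half (by norm_num),
    e2, Complex.cpow_neg]
  push_cast
  ring

theorem prefactor_right {z : ℂ} (hz : z ≠ 0) :
    (Real.pi * z / 2) ^ (1 / 2 : ℂ) = (√Real.pi : ℝ) * (z / 2) ^ (1 / 2 : ℂ) := by
  rw [mul_div_assoc, ofReal_mul_cpow Real.pi_pos (div_ne_zero hz two_ne_zero),
    ofReal_cpow_half Real.pi_pos.le]

theorem sin_pi_half : Complex.sin (Real.pi * (1 / 2)) = 1 := by
  rw [mul_one_div]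
  exact Complex.sin_pi_div_two

theorem sin_neg_pi_half : Complex.sin (Real.pi * (-1 / 2)) = -1 := by
  rw [show (Real.pi : ℂ) * (-1 / 2) = -(Real.pi / 2) by ring, Complex.sin_neg,
    Complex.sin_pi_div_two]

theorem notInteger_half : NotInteger (1 / 2) := by
  have := IsHalf.notInteger (a := 1 / 2) (Or.inl rfl)
  push_cast at this
  exact this

theorem notInteger_neg_half : NotInteger (-1 / 2) := by
  have := IsHalf.notInteger (a := -1 / 2) (Or.inr rfl)
  push_cast at this
  exact this

theorem macdonaldTerm1_eq (x y : ℂ) {z : ℂ} (hz : z ≠ 0) (m n : ℕ) :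
    macdonaldTerm1 x y z (m + n) n
      = (√Real.pi : ℝ) / (2 * z) ^ (1 / 2 : ℂ)
          * ∑' p, XpTerm (1 / 2) (3 / 2) (x / z ^ 2) (y * z / 2) (-(z ^ 2 / 4)) (m + n, n, p)
        - (Real.pi * z / 2) ^ (1 / 2 : ℂ)
          * ∑' p, XTerm (3 / 2) (3 / 2) (x * z ^ 2 / 16) (-(x * y * z / 8)) (z ^ 2 / 4) (m, n, p) := by
  have h := notInteger_half.macdonald_term x y hz m n
  rw [Gamma_half, Gamma_three_halves, sin_pi_half, show (1 / 2 : ℂ) + 1 = 3 / 2 by norm_num] at h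
  have hspi : ((√Real.pi : ℝ) : ℂ) ≠ 0 := by exact_mod_cast (Real.sqrt_pos.2 Real.pi_pos).ne'
  have e : (Real.pi : ℂ) / 2 / (1 * ((√Real.pi : ℝ) / 2)) = (√Real.pi : ℝ) := by
    rw [← sqrt_pi_mul_self]
    field_simp
  rw [e] at h
  rw [prefactor_left hz, prefactor_right hz, ← h, macdonaldTerm1, factorial_two_mul_add_one,
    Nat.add_sub_cancel]
  have h1 : (((m + n).factorial : ℕ) : ℂ) ≠ 0 := by exact_mod_cast (m + n).factorial_ne_zero
  have h2 : ((m.factorial : ℕ) : ℂ) ≠ 0 := by exact_mod_cast m.factorial_ne_zero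
  have e2 : 2 * ((m + n : ℕ) : ℂ) - n + 1 / 2 = ((2 * m + n : ℕ) : ℂ) + 1 / 2 := by
    push_cast
    ring
  rw [e2]
  congr 1
  have h3 : poch (3 / 2) (m + n) ≠ 0 := by
    have := notInteger_half.add_one.poch_ne_zero (m + n)
    rwa [show (1 / 2 : ℂ) + 1 = 3 / 2 by norm_num] at this
  field_simp

theorem macdonaldTerm2_eq (x y : ℂ) {z : ℂ} (hz : z ≠ 0) (m n : ℕ) :
    macdonaldTerm2 x y z (m + n) n
      = (√Real.pi : ℝ) / (2 * z) ^ (1 / 2 : ℂ)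
          * ∑' p, XTerm (1 / 2) (1 / 2) (x * z ^ 2 / 16) (-(x * y * z / 8)) (z ^ 2 / 4) (m, n, p)
        - (Real.pi * z / 2) ^ (1 / 2 : ℂ)
          * ∑' p, XpTerm (-1 / 2) (1 / 2) (x / z ^ 2) (y * z / 2) (-(z ^ 2 / 4)) (m + n, n, p) := by
  have h := notInteger_neg_half.macdonald_term x y hz m n
  rw [show (-1 / 2 : ℂ) + 1 = 1 / 2 by norm_num, Gamma_half, Gamma_neg_half, sin_neg_pi_half] at h
  have hspi : ((√Real.pi : ℝ) : ℂ) ≠ 0 := by exact_mod_cast (Real.sqrt_pos.2 Real.pi_pos).ne'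
  have e : (Real.pi : ℂ) / 2 / (-1 * (√Real.pi : ℝ)) = -((√Real.pi : ℝ) / 2) := by
    rw [← sqrt_pi_mul_self]
    field_simp
  rw [e, show -(-1 / 2 : ℂ) = 1 / 2 by norm_num, show (-1 / 2 : ℂ) = -(1 / 2) by norm_num] at h
  rw [prefactor_left hz, prefactor_right hz, macdonaldTerm2, factorial_two_mul, Nat.add_sub_cancel]
  have h1 : (((m + n).factorial : ℕ) : ℂ) ≠ 0 := by exact_mod_cast (m + n).factorial_ne_zero
  have h2 : ((m.factorial : ℕ) : ℂ) ≠ 0 := by exact_mod_cast m.factorial_ne_zero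
  have e2 : 2 * ((m + n : ℕ) : ℂ) - n - 1 / 2 = ((2 * m + n : ℕ) : ℂ) + -(1 / 2) := by
    push_cast
    ring
  have h3 : poch (1 / 2) (m + n) ≠ 0 := notInteger_half.poch_ne_zero (m + n)
  have e3 : (((m + n).factorial : ℕ) : ℂ) * x ^ (m + n) * y ^ n
      / ((m + n).factorial * (4 ^ (m + n) * poch (1 / 2) (m + n)) * m.factorial)
      = x ^ (m + n) * y ^ n / (4 ^ (m + n) * poch (1 / 2) (m + n) * m.factorial) := by
    field_simp
  rw [e2, e3, h, show (-1 / 2 : ℂ) = -(1 / 2) by norm_num]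
  ring

/-! ### Rearrangements and the series `X` -/

/-- A summable family over `ι` may be summed over the fibres of a parametrization of its support
by `ℕ × κ`, a factor being pulled out of each fibre. -/
theorem hasSum_fiberwise {ι κ : Type*} {f : ι → ℂ} (hf : Summable f) {i : ℕ × κ → ι}
    (hi : Function.Injective i) (h0 : ∀ x ∉ Set.range i, f x = 0) {c : ℕ → ℂ} {g : ℕ → κ → ℂ}
    (h : ∀ n q, c n * g n q = f (i (n, q))) :
    HasSum (fun n => c n * ∑' q, g n q) (∑' x, f x) := by
  have h1 : HasSum (f ∘ i) (∑' x, f x) := (hi.hasSum_iff h0).2 hf.hasSum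
  refine h1.prod_fiberwise fun n => ?_
  rw [← tsum_mul_left]
  have h2 : (fun q => (f ∘ i) (n, q)) = fun q => c n * g n q := funext fun q => (h n q).symm
  rw [h2]
  apply Summable.hasSum
  rw [← h2]
  exact h1.summable.prod_factor n

theorem summable_of_mul_eq_comp {ι κ : Type*} {f : ι → ℂ} (hf : Summable f) {i : κ → ι}
    (hi : Function.Injective i) {c : ℂ} (hc : c ≠ 0) {g : κ → ℂ} (h : ∀ q, c * g q = f (i q)) :
    Summable g := by
  rw [← summable_mul_left_iff hc]
  exact (hf.comp_injective hi).congr fun q => (h q).symm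

theorem factorial_le_norm_poch {c : ℝ} (hc : 1 / 2 ≤ c) (k : ℕ) :
    (k.factorial : ℝ) / 2 ^ k ≤ ‖poch c k‖ := by
  induction k with
  | zero => simp [poch_zero]
  | succ k ih =>
    have hk : (0 : ℝ) ≤ k := k.cast_nonneg
    rw [poch_succ, norm_mul, show (c : ℂ) + k = ((c + k : ℝ) : ℂ) by push_cast; rfl,
      Complex.norm_real, Real.norm_of_nonneg (by linarith), Nat.factorial_succ, pow_succ]
    push_cast
    rw [show ((k : ℝ) + 1) * k.factorial / (2 ^ k * 2) = k.factorial / 2 ^ k * ((k + 1) / 2) by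
      field_simp]
    exact mul_le_mul ih (by linarith) (by positivity) (norm_nonneg _)

theorem inv_norm_poch_le {c : ℝ} (hc : 1 / 2 ≤ c) (k : ℕ) :
    ‖poch c k‖⁻¹ ≤ 2 ^ k / (k.factorial : ℝ) := by
  have h := inv_anti₀ (by positivity) (factorial_le_norm_poch hc k)
  rwa [inv_div] at h

theorem poch_ne_zero_of_pos {c : ℝ} (hc : 1 / 2 ≤ c) (k : ℕ) : poch c k ≠ 0 := by
  rw [← norm_pos_iff]
  exact lt_of_lt_of_le (by positivity) (factorial_le_norm_poch hc k)

theorem summable_exp_triple (u v w : ℝ) (hu : 0 ≤ u) (hv : 0 ≤ v) (hw : 0 ≤ w) :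
    Summable fun q : ℕ × ℕ × ℕ => u ^ q.1 / (q.1.factorial : ℝ) *
      (v ^ q.2.1 / (q.2.1.factorial : ℝ) * (w ^ q.2.2 / (q.2.2.factorial : ℝ))) := by
  have h1 := Real.summable_pow_div_factorial u
  have h2 := Real.summable_pow_div_factorial v
  have h3 := Real.summable_pow_div_factorial w
  exact h1.mul_of_nonneg (h2.mul_of_nonneg h3 (fun _ => by positivity) fun _ => by positivity)
    (fun _ => by positivity) fun _ => by positivity

theorem summable_XTerm {a b : ℝ} (ha : 1 / 2 ≤ a) (hb : 1 / 2 ≤ b) (ζ₁ ζ₂ ζ₃ : ℂ) :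
    Summable (XTerm a b ζ₁ ζ₂ ζ₃) := by
  refine Summable.of_norm_bounded (summable_exp_triple (8 * ‖ζ₁‖) (4 * ‖ζ₂‖) (2 * ‖ζ₃‖)
    (by positivity) (by positivity) (by positivity)) ?_
  rintro ⟨m, n, p⟩
  simp only [XTerm, norm_div, norm_mul, norm_pow, RCLike.norm_natCast]
  have h1 : ‖poch (a : ℂ) (2 * m + n + p)‖⁻¹ ≤ 2 ^ (2 * m + n + p) / (n.factorial : ℝ) := by
    refine (inv_norm_poch_le ha _).trans ?_
    have : ((n.factorial : ℕ) : ℝ) ≤ ((2 * m + n + p).factorial : ℕ) := by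
      exact_mod_cast Nat.factorial_le (by omega)
    gcongr
  have h2 : ‖poch (b : ℂ) (m + n)‖⁻¹ ≤ 2 ^ (m + n) := by
    refine (inv_norm_poch_le hb _).trans ?_
    apply div_le_self (by positivity)
    exact_mod_cast Nat.succ_le_of_lt (Nat.factorial_pos _)
  calc ‖ζ₁‖ ^ m * ‖ζ₂‖ ^ n * ‖ζ₃‖ ^ p /
        (m.factorial * p.factorial * ‖poch (a : ℂ) (2 * m + n + p)‖ * ‖poch (b : ℂ) (m + n)‖)
      = ‖ζ₁‖ ^ m * ‖ζ₂‖ ^ n * ‖ζ₃‖ ^ p / (m.factorial * p.factorial)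
        * (‖poch (a : ℂ) (2 * m + n + p)‖⁻¹ * ‖poch (b : ℂ) (m + n)‖⁻¹) := by
        simp only [div_eq_mul_inv, mul_inv]
        ring
    _ ≤ ‖ζ₁‖ ^ m * ‖ζ₂‖ ^ n * ‖ζ₃‖ ^ p / (m.factorial * p.factorial)
        * (2 ^ (2 * m + n + p) / (n.factorial : ℝ) * 2 ^ (m + n)) := by gcongr
    _ = _ := by
        rw [show (8 : ℝ) = 2 ^ 3 by norm_num, show (4 : ℝ) = 2 ^ 2 by norm_num]
        simp only [mul_pow, ← pow_mul]
        field_simp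
        ring

theorem XRepresentations_of_half_le {a b : ℝ} (ha : 1 / 2 ≤ a) (hb : 1 / 2 ≤ b) (ζ₁ ζ₂ ζ₃ : ℂ) :
    XRepresentations a b ζ₁ ζ₂ ζ₃ := by
  have hp := fun k => poch_ne_zero_of_pos ha k
  have hq := fun k => poch_ne_zero_of_pos hb k
  have hf : ∀ k : ℕ, (k.factorial : ℂ) ≠ 0 := fun k => by exact_mod_cast k.factorial_ne_zero
  have key1 : ∀ (ζ₁ : ℂ) (n : ℕ) (q : ℕ × ℕ), ζ₁ ^ n / ((n.factorial : ℂ) * poch a (2 * n) * poch b n)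
      * kampeDeFerietTerm [] [1] [] [(a : ℂ) + 2 * n] [(b : ℂ) + n] [] ζ₂ ζ₃ q
      = XTerm a b ζ₁ ζ₂ ζ₃ (n, q) := by
    rintro ζ₁ n ⟨r, s⟩
    have h1 := poch_add a (2 * n) (r + s)
    have h2 := poch_add b n r
    push_cast at h1
    simp only [kampeDeFerietTerm, XTerm, List.map_cons, List.map_nil, List.prod_cons,
      List.prod_nil, poch_one_left]
    rw [add_assoc (2 * n), h1, h2]
    have := mul_inv_cancel₀ (hf r)
    simp only [div_eq_mul_inv, mul_inv]
    generalize ((r.factorial : ℕ) : ℂ) = F at *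
    grind
  have key2 : ∀ (ζ₂ : ℂ) (n : ℕ) (q : ℕ × ℕ), ζ₂ ^ n / (poch a n * poch b n)
      * lauricellaTerm [] [] [] [((a : ℂ) + n, 2, 1)] [((b : ℂ) + n, 1)] [] ζ₁ ζ₃ q
      = XTerm a b ζ₁ ζ₂ ζ₃ (q.1, n, q.2) := by
    rintro ζ₂ n ⟨r, s⟩
    have h1 := poch_add a n (2 * r + s)
    have h2 := poch_add b n r
    simp only [lauricellaTerm, XTerm, List.map_cons, List.map_nil, List.prod_cons,
      List.prod_nil, mul_one]
    rw [show 2 * r + n + s = n + (2 * r + s) by ring, add_comm r n, mul_comm r 2, h1, h2]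
    simp only [div_eq_mul_inv, mul_inv]
    ring
  have key3 : ∀ (ζ₃ : ℂ) (n : ℕ) (q : ℕ × ℕ), ζ₃ ^ n / ((n.factorial : ℂ) * poch a n)
      * lauricellaTerm [] [] [(1, 1)] [((a : ℂ) + n, 2, 1), ((b : ℂ), 1, 1)] [] [] ζ₁ ζ₂ q
      = XTerm a b ζ₁ ζ₂ ζ₃ (q.1, q.2, n) := by
    rintro ζ₃ n ⟨r, s⟩
    have h1 := poch_add a n (2 * r + s)
    simp only [lauricellaTerm, XTerm, List.map_cons, List.map_nil, List.prod_cons,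
      List.prod_nil, mul_one, poch_one_left]
    rw [show 2 * r + s + n = n + (2 * r + s) by ring, mul_comm r 2, h1]
    have := mul_inv_cancel₀ (hf s)
    simp only [div_eq_mul_inv, mul_inv]
    generalize ((s.factorial : ℕ) : ℂ) = F at *
    grind
  have i1 : Function.Injective fun q : ℕ × (ℕ × ℕ) => ((q.1, q.2) : ℕ × ℕ × ℕ) := fun x y h => h
  have i2 : Function.Injective fun q : ℕ × (ℕ × ℕ) => ((q.2.1, q.1, q.2.2) : ℕ × ℕ × ℕ) := by
    rintro ⟨x, x', x''⟩ ⟨y, y', y''⟩ h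
    simp only [Prod.mk.injEq] at h ⊢
    tauto
  have i3 : Function.Injective fun q : ℕ × (ℕ × ℕ) => ((q.2.1, q.2.2, q.1) : ℕ × ℕ × ℕ) := by
    rintro ⟨x, x', x''⟩ ⟨y, y', y''⟩ h
    simp only [Prod.mk.injEq] at h ⊢
    tauto
  have inj : ∀ n : ℕ, Function.Injective fun q : ℕ × ℕ => ((n, q) : ℕ × (ℕ × ℕ)) := fun n x y h => by
    simpa using h
  have hX := summable_XTerm ha hb
  -- The inner series do not involve the variable pulled out; its value 1 gives their convergence.
  refine ⟨hX _ _ _, ⟨fun n => ?_, ?_⟩, ⟨fun n => ?_, ?_⟩, fun n => ?_, ?_⟩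
  · refine summable_of_mul_eq_comp (hX 1 ζ₂ ζ₃) (i1.comp (inj n)) ?_ (key1 1 n)
    exact div_ne_zero (by simp) (mul_ne_zero (mul_ne_zero (hf _) (hp _)) (hq _))
  · exact hasSum_fiberwise (hX ζ₁ ζ₂ ζ₃) i1 (fun x hx => (hx ⟨x, rfl⟩).elim) (key1 ζ₁)
  · refine summable_of_mul_eq_comp (hX ζ₁ 1 ζ₃) (i2.comp (inj n)) ?_ (key2 1 n)
    exact div_ne_zero (by simp) (mul_ne_zero (hp _) (hq _))
  · exact hasSum_fiberwise (hX ζ₁ ζ₂ ζ₃) i2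
      (fun x hx => (hx ⟨(x.2.1, x.1, x.2.2), rfl⟩).elim) (key2 ζ₂)
  · refine summable_of_mul_eq_comp (hX ζ₁ ζ₂ 1) (i3.comp (inj n)) ?_ (key3 1 n)
    exact div_ne_zero (by simp) (mul_ne_zero (hf _) (hp _))
  · exact hasSum_fiberwise (hX ζ₁ ζ₂ ζ₃) i3
      (fun x hx => (hx ⟨(x.2.2, x.1, x.2.1), rfl⟩).elim) (key3 ζ₃)

/-! ### Quotients of Pochhammer symbols -/

/-- The quotient `(3 / 2)_N / N!`. -/
noncomputable def threeHalvesRatio (N : ℕ) : ℝ := (poch (3 / 2) N).re / N.factorial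

theorem poch_three_halves_re (N : ℕ) : poch (3 / 2) N = ((poch (3 / 2) N).re : ℂ) := by
  induction N with
  | zero => simp [poch_zero]
  | succ N ih =>
    rw [poch_succ, ih]
    have : (3 / 2 : ℂ) + N = ((3 / 2 + N : ℝ) : ℂ) := by push_cast; rfl
    rw [this, ← Complex.ofReal_mul, Complex.ofReal_re]

theorem threeHalvesRatio_zero : threeHalvesRatio 0 = 1 := by
  simp [threeHalvesRatio, poch_zero]

theorem threeHalvesRatio_succ (N : ℕ) :
    threeHalvesRatio (N + 1) = threeHalvesRatio N * ((N + 3 / 2) / (N + 1)) := by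
  have : (3 / 2 : ℂ) + N = ((3 / 2 + N : ℝ) : ℂ) := by push_cast; rfl
  rw [threeHalvesRatio, threeHalvesRatio, poch_succ, poch_three_halves_re, this,
    ← Complex.ofReal_mul, Complex.ofReal_re, Complex.ofReal_re, Nat.factorial_succ]
  have h : (N.factorial : ℝ) ≠ 0 := by exact_mod_cast N.factorial_ne_zero
  push_cast
  field_simp
  ring

theorem threeHalvesRatio_pos (N : ℕ) : 0 < threeHalvesRatio N := by
  induction N with
  | zero => simp [threeHalvesRatio_zero]
  | succ N ih =>
    rw [threeHalvesRatio_succ]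
    positivity

theorem poch_three_halves (N : ℕ) :
    poch (3 / 2) N = (N.factorial * threeHalvesRatio N : ℝ) := by
  have h : (N.factorial : ℝ) ≠ 0 := by exact_mod_cast N.factorial_ne_zero
  rw [threeHalvesRatio, mul_div_cancel₀ _ h]
  exact poch_three_halves_re N

theorem poch_half (N : ℕ) :
    poch (1 / 2) N = (N.factorial * threeHalvesRatio N / (2 * N + 1) : ℝ) := by
  have h1 := poch_add (1 / 2) 1 N
  have h2 := poch_succ (1 / 2) N
  rw [add_comm 1 N, h2, poch_succ, poch_zero] at h1
  rw [show (1 / 2 : ℂ) + ((1 : ℕ) : ℂ) = 3 / 2 by norm_num, poch_three_halves] at h1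
  have h3 : (2 * N + 1 : ℂ) ≠ 0 := by exact_mod_cast (2 * N).succ_ne_zero
  push_cast at h1 ⊢
  rw [eq_div_iff h3]
  linear_combination 2 * h1

theorem two_mul_sub_one_ne_zero (N : ℕ) : (2 * N - 1 : ℝ) ≠ 0 := by
  intro h
  have : (2 * N : ℝ) = 1 := by linarith
  have : 2 * N = 1 := by exact_mod_cast this
  omega

theorem poch_neg_half (N : ℕ) :
    poch (-1 / 2) N
      = (-(N.factorial * threeHalvesRatio N / ((2 * N + 1) * (2 * N - 1))) : ℝ) := by
  have h1 := poch_add (-1 / 2) 1 N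
  have h2 := poch_succ (-1 / 2) N
  rw [add_comm 1 N, h2, poch_succ, poch_zero] at h1
  rw [show (-1 / 2 : ℂ) + ((1 : ℕ) : ℂ) = 1 / 2 by norm_num, poch_half] at h1
  have h3 : (2 * N + 1 : ℂ) ≠ 0 := by exact_mod_cast (2 * N).succ_ne_zero
  have h4 : (2 * N - 1 : ℂ) ≠ 0 := by exact_mod_cast two_mul_sub_one_ne_zero N
  push_cast at h1 ⊢
  field_simp at h1 ⊢
  linear_combination h1

theorem sq_threeHalvesRatio_le {M N : ℕ} (h : M ≤ N) :
    (threeHalvesRatio N / threeHalvesRatio M) ^ 2 ≤ (N + 3 / 4) / (M + 3 / 4) := by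
  have hmono : Antitone fun N : ℕ => threeHalvesRatio N ^ 2 / (N + 3 / 4) := by
    apply antitone_nat_of_succ_le
    intro N
    have hN : (0 : ℝ) ≤ N := N.cast_nonneg
    rw [threeHalvesRatio_succ, mul_pow, mul_div_assoc, div_eq_mul_inv (_ ^ 2)]
    refine mul_le_mul_of_nonneg_left ?_ (sq_nonneg _)
    push_cast
    rw [div_pow, ← div_eq_mul_inv, div_div, inv_eq_one_div, div_le_div_iff₀ (by positivity) (by positivity)]
    nlinarith
  have := hmono h
  simp only at this
  have h1 := threeHalvesRatio_pos M
  rw [div_pow, div_le_div_iff₀ (by positivity) (by positivity)]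
  rw [div_le_div_iff₀ (by positivity) (by positivity)] at this
  linarith

theorem le_sq_threeHalvesRatio {M N : ℕ} (h : M ≤ N) :
    ((N : ℝ) + 1) / (M + 1) ≤ (threeHalvesRatio N / threeHalvesRatio M) ^ 2 := by
  have hmono : Monotone fun N : ℕ => threeHalvesRatio N ^ 2 / (N + 1) := by
    apply monotone_nat_of_le_succ
    intro N
    have hN : (0 : ℝ) ≤ N := N.cast_nonneg
    rw [threeHalvesRatio_succ, mul_pow, mul_div_assoc, div_eq_mul_inv (_ ^ 2) (N + 1 : ℝ)]
    refine mul_le_mul_of_nonneg_left ?_ (sq_nonneg _)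
    push_cast
    rw [div_pow, div_div, inv_eq_one_div, div_le_div_iff₀ (by positivity) (by positivity)]
    nlinarith
  have := hmono h
  simp only at this
  have h1 := threeHalvesRatio_pos M
  rw [div_pow, div_le_div_iff₀ (by positivity) (by positivity)]
  rw [div_le_div_iff₀ (by positivity) (by positivity)] at this
  linarith

/-- The quotient `(a)_N / (a + 1)_M`, divided by its analogue `N! / M!` for `a = 1`. -/
noncomputable def pochQuot (a : ℝ) (N M : ℕ) : ℂ :=
  poch a N * M.factorial / (poch (a + 1) M * N.factorial)

theorem pochQuot_half (N M : ℕ) :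
    pochQuot (1 / 2) N M = (threeHalvesRatio N / threeHalvesRatio M / (2 * N + 1) : ℝ) := by
  have h1 : (N.factorial : ℂ) ≠ 0 := by exact_mod_cast N.factorial_ne_zero
  have h2 : (M.factorial : ℂ) ≠ 0 := by exact_mod_cast M.factorial_ne_zero
  have h3 : (threeHalvesRatio M : ℂ) ≠ 0 := by exact_mod_cast (threeHalvesRatio_pos M).ne'
  rw [pochQuot]
  push_cast
  rw [show (1 / 2 : ℂ) + 1 = 3 / 2 by norm_num, poch_half, poch_three_halves]
  push_cast
  field_simp

theorem pochQuot_neg_half (N M : ℕ) :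
    pochQuot (-1 / 2) N M
      = (-(threeHalvesRatio N / threeHalvesRatio M * (2 * M + 1) / ((2 * N + 1) * (2 * N - 1))) :
        ℝ) := by
  have h1 : (N.factorial : ℂ) ≠ 0 := by exact_mod_cast N.factorial_ne_zero
  have h2 : (M.factorial : ℂ) ≠ 0 := by exact_mod_cast M.factorial_ne_zero
  have h3 : (threeHalvesRatio M : ℂ) ≠ 0 := by exact_mod_cast (threeHalvesRatio_pos M).ne'
  have h4 : (2 * M + 1 : ℂ) ≠ 0 := by exact_mod_cast (2 * M).succ_ne_zero
  rw [pochQuot]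
  push_cast
  rw [show (-1 / 2 : ℂ) + 1 = 1 / 2 by norm_num, poch_neg_half, poch_half]
  push_cast
  field_simp

theorem threeHalvesRatio_div_le {M N : ℕ} (h : M ≤ N) (h2 : N ≤ 2 * M) :
    threeHalvesRatio N / threeHalvesRatio M ≤ 2 := by
  have h3 := sq_threeHalvesRatio_le h
  have h4 : ((N : ℝ) + 3 / 4) / (M + 3 / 4) ≤ 2 := by
    have : (N : ℝ) ≤ 2 * M := by exact_mod_cast h2
    rw [div_le_iff₀ (by positivity)]
    linarith
  nlinarith

theorem IsHalf.norm_pochQuot_le {a : ℝ} (ha : IsHalf a) {M N : ℕ} (h : M ≤ N) (h2 : N ≤ 2 * M) :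
    ‖pochQuot a N M‖ ≤ 4 / ((N : ℝ) + 1) := by
  have h3 := threeHalvesRatio_div_le h h2
  have h0 : 0 < threeHalvesRatio N / threeHalvesRatio M :=
    div_pos (threeHalvesRatio_pos N) (threeHalvesRatio_pos M)
  have hM : (M : ℝ) ≤ N := by exact_mod_cast h
  rcases ha with rfl | rfl
  · rw [pochQuot_half, Complex.norm_real, Real.norm_of_nonneg (by positivity)]
    rw [div_le_div_iff₀ (by positivity) (by positivity)]
    nlinarith
  · rw [pochQuot_neg_half, Complex.norm_real, norm_neg, Real.norm_eq_abs, abs_div, abs_mul,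
      abs_of_pos h0, abs_mul, abs_of_pos (by positivity : (0 : ℝ) < 2 * M + 1),
      abs_of_pos (by positivity : (0 : ℝ) < 2 * N + 1)]
    have h4 : ((N : ℝ) + 1) / 2 ≤ |2 * (N : ℝ) - 1| := by
      rcases N with _ | N
      · norm_num
      · refine le_trans ?_ (le_abs_self _)
        push_cast
        have := N.cast_nonneg (α := ℝ)
        linarith
    have h5 : threeHalvesRatio N / threeHalvesRatio M * (2 * M + 1) ≤ 2 * (2 * N + 1) := by
      nlinarith
    rw [div_le_div_iff₀ (mul_pos (by positivity) (by linarith [N.cast_nonneg (α := ℝ)]))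
      (by positivity)]
    have : (0 : ℝ) < 2 * N + 1 := by positivity
    calc _ ≤ 2 * (2 * (N : ℝ) + 1) * (N + 1) := by gcongr
      _ = 4 * ((2 * N + 1) * (((N : ℝ) + 1) / 2)) := by ring
      _ ≤ _ := by gcongr

/-- For `M` close to `P N` the quotient `(3 / 2)_N M! / ((3 / 2)_M N!)` is close to `1 / √P`. -/
theorem abs_threeHalvesRatio_sub_le {P : ℝ} (hP : 0 < P) (hP1 : P ≤ 1) {M N : ℕ} (h : M ≤ N)
    (h2 : N ≤ 2 * M) (hN : 0 < N) :
    |threeHalvesRatio N / threeHalvesRatio M - (√P)⁻¹| ≤ 2 / P * (|P * N - M| + 1) / N := by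
  have hN' : (0 : ℝ) < N := by exact_mod_cast hN
  have hM : (N : ℝ) / 2 ≤ M := by
    have : (N : ℝ) ≤ 2 * M := by exact_mod_cast h2
    linarith
  have key : ∀ c : ℝ, 0 ≤ c → c ≤ 1 →
      |((N : ℝ) + c) / (M + c) - P⁻¹| ≤ 2 / P * (|P * N - M| + 1) / N := by
    intro c hc hc1
    have hMc : (N : ℝ) / 2 ≤ M + c := by linarith
    have hMc0 : 0 < M + c := by linarith
    have e : ((N : ℝ) + c) / (M + c) - P⁻¹ = (P * N - M - (1 - P) * c) / (P * (M + c)) := by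
      field_simp
      ring
    rw [e, abs_div, abs_of_pos (mul_pos hP hMc0)]
    have h3 : |P * N - M - (1 - P) * c| ≤ |P * N - M| + 1 := by
      refine (abs_sub _ _).trans ?_
      rw [abs_of_nonneg (mul_nonneg (by linarith) hc)]
      nlinarith
    calc _ ≤ (|P * N - M| + 1) / (P * (N / 2)) := by gcongr
      _ = _ := by field_simp
  have hu := sq_threeHalvesRatio_le h
  have hl := le_sq_threeHalvesRatio h
  set ρ := threeHalvesRatio N / threeHalvesRatio M with hρ
  have h0 : 0 < ρ := div_pos (threeHalvesRatio_pos N) (threeHalvesRatio_pos M)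
  set B := 2 / P * (|P * N - M| + 1) / N
  have hsq : |ρ ^ 2 - P⁻¹| ≤ B := by
    have k1 := abs_le.1 (key (3 / 4) (by norm_num) (by norm_num))
    have k2 := abs_le.1 (key 1 (by norm_num) (by norm_num))
    exact abs_le.2 ⟨by linarith [k2.1], by linarith [k1.2]⟩
  have hs : 1 ≤ (√P)⁻¹ := by
    rw [one_le_inv₀ (Real.sqrt_pos.2 hP)]
    exact Real.sqrt_le_one.2 hP1
  have hs2 : (√P)⁻¹ ^ 2 = P⁻¹ := by rw [inv_pow, Real.sq_sqrt hP.le]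
  rw [← hs2, show ρ ^ 2 - (√P)⁻¹ ^ 2 = (ρ - (√P)⁻¹) * (ρ + (√P)⁻¹) by ring, abs_mul,
    abs_of_pos (by linarith : 0 < ρ + (√P)⁻¹)] at hsq
  refine le_trans ?_ hsq
  exact le_mul_of_one_le_right (abs_nonneg _) (by linarith)

/-- Asymptotically, `(a)_N M! / ((a + 1)_M N!)` is `κ / N` for `M` close to `P N`. -/
theorem IsHalf.exists_norm_pochQuot_sub_le {a : ℝ} (ha : IsHalf a) {P : ℝ} (hP : 0 < P)
    (hP1 : P ≤ 1) : ∃ (κ : ℂ) (C : ℝ), 0 ≤ C ∧ ∀ M N : ℕ, M ≤ N → N ≤ 2 * M → 0 < N →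
      ‖pochQuot a N M - κ / N‖ ≤ C * (|P * N - M| + 1) / (N : ℝ) ^ 2 := by
  have hs0 : 0 < (√P)⁻¹ := inv_pos.2 (Real.sqrt_pos.2 hP)
  rcases ha with rfl | rfl
  · refine ⟨((√P)⁻¹ / 2 : ℝ), 2 / P + (√P)⁻¹, by positivity, fun M N h h2 hN => ?_⟩
    have hN' : (0 : ℝ) < N := by exact_mod_cast hN
    have h3 := abs_threeHalvesRatio_sub_le hP hP1 h h2 hN
    rw [pochQuot_half, ← Complex.ofReal_natCast, ← Complex.ofReal_div, ← Complex.ofReal_sub,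
      Complex.norm_real, Real.norm_eq_abs]
    set ρ := threeHalvesRatio N / threeHalvesRatio M
    set D := |P * N - M|
    have hD : 0 ≤ D := abs_nonneg _
    have e : ρ / (2 * N + 1) - (√P)⁻¹ / 2 / N
        = (ρ - (√P)⁻¹) / (2 * N + 1) - (√P)⁻¹ / (2 * N * (2 * N + 1)) := by
      field_simp
      ring
    rw [e]
    refine (abs_sub _ _).trans ?_
    rw [abs_div, abs_of_pos (by positivity : (0 : ℝ) < 2 * N + 1),
      abs_of_pos (by positivity : (0 : ℝ) < (√P)⁻¹ / (2 * N * (2 * N + 1)))]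
    calc |ρ - (√P)⁻¹| / (2 * N + 1) + (√P)⁻¹ / (2 * N * (2 * N + 1))
        ≤ 2 / P * (D + 1) / N / N + (√P)⁻¹ * (D + 1) / (N * N) := by
          gcongr
          · linarith
          · nlinarith
          · linarith
          · linarith
      _ = _ := by field_simp
  · refine ⟨(-((√P)⁻¹ * P / 2) : ℝ), 2 / P + (√P)⁻¹, by positivity, fun M N h h2 hN => ?_⟩
    have hN' : (1 : ℝ) ≤ N := by exact_mod_cast hN
    have hM : (M : ℝ) ≤ N := by exact_mod_cast h
    have h3 := abs_threeHalvesRatio_sub_le hP hP1 h h2 hN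
    rw [pochQuot_neg_half, ← Complex.ofReal_natCast, ← Complex.ofReal_div, ← Complex.ofReal_sub,
      Complex.norm_real, Real.norm_eq_abs]
    set ρ := threeHalvesRatio N / threeHalvesRatio M
    set D := |P * N - M| with hDdef
    have hD : 0 ≤ D := abs_nonneg _
    have h21 : (0 : ℝ) < 2 * N - 1 := by linarith
    have e : -(ρ * (2 * M + 1) / ((2 * N + 1) * (2 * N - 1))) - -((√P)⁻¹ * P / 2) / N
        = -((ρ - (√P)⁻¹) * ((2 * M + 1) / (2 * N + 1) / (2 * N - 1))
          + (√P)⁻¹ * ((-(4 * N * (P * N - M)) + (2 * N + P))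
            / (2 * N * ((2 * N + 1) * (2 * N - 1))))) := by
      field_simp
      ring
    rw [e, abs_neg]
    refine (abs_add_le _ _).trans ?_
    have h4 : |(2 * (M : ℝ) + 1) / (2 * N + 1) / (2 * N - 1)| ≤ 1 / N := by
      rw [abs_of_nonneg (by positivity)]
      have : (2 * (M : ℝ) + 1) / (2 * N + 1) ≤ 1 := by
        rw [div_le_one (by positivity)]
        linarith
      gcongr
      linarith
    have h5 : |(-(4 * N * (P * N - M)) + (2 * N + P)) / (2 * N * ((2 * N + 1) * (2 * N - 1)))|
        ≤ (D + 1) / (N * N) := by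
      rw [abs_div, abs_of_pos (by positivity : (0 : ℝ) < 2 * N * ((2 * N + 1) * (2 * N - 1)))]
      have : |-(4 * N * (P * N - M)) + (2 * N + P)| ≤ 4 * N * D + 3 * N := by
        refine (abs_add_le _ _).trans ?_
        rw [abs_neg, abs_mul, abs_of_pos (by positivity : (0 : ℝ) < 4 * N),
          abs_of_pos (by positivity : (0 : ℝ) < 2 * N + P)]
        linarith
      rw [div_le_div_iff₀ (by positivity) (by positivity)]
      have h6 : 3 * ((N : ℝ) * N) ≤ (2 * N + 1) * (2 * N - 1) := by nlinarith
      calc _ ≤ (4 * N * D + 3 * N) * ((N : ℝ) * N) := by gcongr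
        _ ≤ (D + 1) * (2 * N * (3 * ((N : ℝ) * N))) := by
          have : 0 ≤ (N : ℝ) * N * N := by positivity
          nlinarith [mul_nonneg this hD]
        _ ≤ _ := by gcongr
    rw [abs_mul, abs_mul, abs_of_pos hs0]
    calc _ ≤ 2 / P * (D + 1) / N * (1 / N) + (√P)⁻¹ * ((D + 1) / (N * N)) := by gcongr
      _ = _ := by field_simp

/-! ### The terms of `X'` on the triangle `n ≤ m` -/

/-- The term of `X'(a, a + 1; ζ)` at `(m + n, n, p)`, written in `u = ζ₁`, `t = ζ₁ ζ₂` and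
`w = ζ₃`; in these variables the sum runs over all `(m, n, p)`. -/
noncomputable def triTerm (a : ℝ) (u t w : ℂ) (q : ℕ × ℕ × ℕ) : ℂ :=
  u ^ q.1 * t ^ q.2.1 * (w ^ q.2.2 / (q.2.2.factorial : ℂ))
    * pochInt a (((2 * q.1 + q.2.1 : ℕ) : ℤ) - q.2.2)
    / ((q.1.factorial : ℂ) * poch (a + 1) (q.1 + q.2.1))

theorem XpTerm_add (a : ℝ) (ζ₁ ζ₂ ζ₃ : ℂ) (m n p : ℕ) :
    XpTerm a (a + 1) ζ₁ ζ₂ ζ₃ (m + n, n, p) = triTerm a ζ₁ (ζ₁ * ζ₂) ζ₃ (m, n, p) := by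
  simp only [XpTerm, triTerm]
  rw [if_pos (by omega), Nat.add_sub_cancel, pow_add, mul_pow,
    show 2 * ((m + n : ℕ) : ℤ) - n - p = ((2 * m + n : ℕ) : ℤ) - p by push_cast; ring]
  simp only [div_eq_mul_inv, mul_inv]
  ring

theorem triangle_injective :
    Function.Injective fun q : ℕ × ℕ × ℕ => ((q.1 + q.2.1, q.2) : ℕ × ℕ × ℕ) := by
  rintro ⟨x, x', x''⟩ ⟨y, y', y''⟩ h
  simp only [Prod.mk.injEq] at h ⊢
  omega

theorem XpTerm_eq_zero_of_notMem_range (a b ζ₁ ζ₂ ζ₃ : ℂ) (x : ℕ × ℕ × ℕ)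
    (hx : x ∉ Set.range fun q : ℕ × ℕ × ℕ => ((q.1 + q.2.1, q.2) : ℕ × ℕ × ℕ)) :
    XpTerm a b ζ₁ ζ₂ ζ₃ x = 0 := by
  obtain ⟨M, n, p⟩ := x
  simp only [XpTerm]
  rw [if_neg]
  intro h
  exact hx ⟨(M - n, n, p), by simp [Nat.sub_add_cancel h]⟩

theorem summable_XpTerm_iff (a : ℝ) (ζ₁ ζ₂ ζ₃ : ℂ) :
    Summable (XpTerm a (a + 1) ζ₁ ζ₂ ζ₃) ↔ Summable (triTerm a ζ₁ (ζ₁ * ζ₂) ζ₃) := by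
  rw [← triangle_injective.summable_iff (XpTerm_eq_zero_of_notMem_range _ _ ζ₁ ζ₂ ζ₃)]
  refine summable_congr fun q => ?_
  exact XpTerm_add a ζ₁ ζ₂ ζ₃ q.1 q.2.1 q.2.2

theorem choose_two_mul_add (m n : ℕ) :
    ((2 * m + n).choose m : ℂ) = (2 * m + n).factorial / (m.factorial * (m + n).factorial) := by
  rw [Nat.cast_choose ℂ (show m ≤ 2 * m + n by omega), show 2 * m + n - m = m + n by omega]

theorem poch_div_eq_choose_mul (a : ℝ) (m n : ℕ) :
    poch a (2 * m + n) / ((m.factorial : ℂ) * poch (a + 1) (m + n))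
      = (2 * m + n).choose m * pochQuot a (2 * m + n) (m + n) := by
  rw [choose_two_mul_add, pochQuot]
  have h1 : ((2 * m + n).factorial : ℂ) ≠ 0 := by exact_mod_cast Nat.factorial_ne_zero (2 * m + n)
  have h2 : ((m + n).factorial : ℂ) ≠ 0 := by exact_mod_cast Nat.factorial_ne_zero (m + n)
  field_simp

theorem triTerm_zero (a : ℝ) (u t w : ℂ) (m n : ℕ) :
    triTerm a u t w (m, n, 0)
      = u ^ m * t ^ n * (2 * m + n).choose m * pochQuot a (2 * m + n) (m + n) := by
  rw [mul_assoc (u ^ m * t ^ n), ← poch_div_eq_choose_mul]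
  simp only [triTerm, pow_zero, Nat.factorial_zero, Nat.cast_zero, Nat.cast_one, div_one, sub_zero,
    mul_one, pochInt_natCast, mul_div_assoc]

/-- The size `C(2 m + n, m) |u|^m |t|^n` that governs the terms of `X'`. -/
noncomputable def chooseWeight (u t : ℂ) (q : ℕ × ℕ) : ℝ :=
  (2 * q.1 + q.2).choose q.1 * ‖u‖ ^ q.1 * ‖t‖ ^ q.2

theorem chooseWeight_nonneg (u t : ℂ) (q : ℕ × ℕ) : 0 ≤ chooseWeight u t q := by
  unfold chooseWeight
  positivity

theorem norm_triTerm_le_of {a : ℝ} (ha : IsHalf a) (u t w : ℂ) (m n p : ℕ) {B : ℝ}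
    (h : ‖pochInt a (((2 * m + n : ℕ) : ℤ) - p)‖ ≤ B * ‖poch a (2 * m + n)‖) (hB : 0 ≤ B) :
    ‖triTerm a u t w (m, n, p)‖
      ≤ B * (4 / ((2 * m + n : ℕ) + 1 : ℝ)) * chooseWeight u t (m, n)
        * (‖w‖ ^ p / p.factorial) := by
  have h1 := ha.norm_pochQuot_le (show m + n ≤ 2 * m + n by omega)
    (show 2 * m + n ≤ 2 * (m + n) by omega)
  have h2 := congrArg norm (poch_div_eq_choose_mul a m n)
  simp only [norm_div, norm_mul, RCLike.norm_natCast] at h2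
  simp only [triTerm, chooseWeight, norm_div, norm_mul, norm_pow, RCLike.norm_natCast]
  calc ‖u‖ ^ m * ‖t‖ ^ n * (‖w‖ ^ p / p.factorial) * ‖pochInt a (((2 * m + n : ℕ) : ℤ) - p)‖
        / (m.factorial * ‖poch (a + 1) (m + n)‖)
      ≤ ‖u‖ ^ m * ‖t‖ ^ n * (‖w‖ ^ p / p.factorial) * (B * ‖poch a (2 * m + n)‖)
        / (m.factorial * ‖poch (a + 1) (m + n)‖) := by gcongr
    _ = ‖u‖ ^ m * ‖t‖ ^ n * (‖w‖ ^ p / p.factorial) * B * (‖poch a (2 * m + n)‖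
        / (m.factorial * ‖poch (a + 1) (m + n)‖)) := by ring
    _ ≤ ‖u‖ ^ m * ‖t‖ ^ n * (‖w‖ ^ p / p.factorial) * B
        * ((2 * m + n).choose m * (4 / ((2 * m + n : ℕ) + 1 : ℝ))) := by
        rw [h2]
        gcongr
    _ = _ := by ring

theorem norm_triTerm_le {a : ℝ} (ha : IsHalf a) (u t w : ℂ) (m n p : ℕ) :
    ‖triTerm a u t w (m, n, p)‖
      ≤ 16 * (chooseWeight u t (m, n) / ((2 * m + n : ℕ) + 1 : ℝ)) * (‖w‖ ^ p / p.factorial) := by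
  refine (norm_triTerm_le_of ha u t w m n p (B := 4) ?_ (by norm_num)).trans_eq (by ring)
  rw [← pochInt_natCast]
  exact ha.norm_pochInt_sub_le _ p

theorem norm_triTerm_succ_le {a : ℝ} (ha : IsHalf a) (u t w : ℂ) (m n p : ℕ) :
    ‖triTerm a u t w (m, n, p + 1)‖
      ≤ 96 * (chooseWeight u t (m, n) / ((2 * m + n : ℕ) + 1 : ℝ) ^ 2)
        * (‖w‖ ^ (p + 1) / (p + 1).factorial) := by
  refine (norm_triTerm_le_of ha u t w m n (p + 1) (B := 24 / ((2 * m + n : ℕ) + 1 : ℝ)) ?_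
    (by positivity)).trans_eq (by simp only [div_eq_mul_inv, ← inv_pow]; ring)
  exact ha.norm_pochInt_sub_succ_le _ p

theorem summable_triTerm {a : ℝ} (ha : IsHalf a) {u t : ℂ} (w : ℂ)
    (h : Summable fun q : ℕ × ℕ => chooseWeight u t q / ((2 * q.1 + q.2 : ℕ) + 1 : ℝ)) :
    Summable (triTerm a u t w) := by
  have h1 : Summable fun x : (ℕ × ℕ) × ℕ =>
      16 * (chooseWeight u t x.1 / ((2 * x.1.1 + x.1.2 : ℕ) + 1 : ℝ)) *
        (‖w‖ ^ x.2 / x.2.factorial) :=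
    (h.mul_left 16).mul_of_nonneg (Real.summable_pow_div_factorial ‖w‖)
      (fun q => by have := chooseWeight_nonneg u t q; positivity) fun _ => by positivity
  rw [← (Equiv.prodAssoc ℕ ℕ ℕ).summable_iff]
  refine Summable.of_norm_bounded h1 ?_
  rintro ⟨⟨m, n⟩, p⟩
  exact norm_triTerm_le ha u t w m n p

/-! ### Domains of absolute convergence -/

/-- By the binomial theorem `C(2 m + n, m) (1 - q) ^ m q ^ (m + n) ≤ 1`. -/
theorem choose_mul_le_one {q : ℝ} (h0 : 0 ≤ q) (h1 : q ≤ 1) (m n : ℕ) :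
    ((2 * m + n).choose m : ℝ) * (q * (1 - q)) ^ m * q ^ n ≤ 1 := by
  have h := add_pow (1 - q) q (2 * m + n)
  rw [sub_add_cancel, one_pow] at h
  have hle := Finset.single_le_sum (f := fun k => (1 - q) ^ k * q ^ (2 * m + n - k)
    * ((2 * m + n).choose k : ℝ)) (s := Finset.range (2 * m + n + 1))
    (fun k _ => mul_nonneg (mul_nonneg (pow_nonneg (by linarith) _) (pow_nonneg h0 _))
      (Nat.cast_nonneg _)) (Finset.mem_range.2 (show m < 2 * m + n + 1 by omega))
  rw [← h] at hle
  refine le_trans (le_of_eq ?_) hle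
  rw [show 2 * m + n - m = m + n by omega, mul_pow, pow_add]
  ring

theorem summable_chooseWeight {u t : ℂ} {q : ℝ} (ht : ‖t‖ < q) (hu : ‖u‖ < q * (1 - q)) :
    Summable (chooseWeight u t) := by
  have hq : 0 < q := (norm_nonneg t).trans_lt ht
  have hqq : 0 < q * (1 - q) := (norm_nonneg u).trans_lt hu
  have hq1 : 0 < 1 - q := by
    by_contra h
    nlinarith
  have hA : ‖u‖ / (q * (1 - q)) < 1 := (div_lt_one hqq).2 hu
  have hB : ‖t‖ / q < 1 := (div_lt_one hq).2 ht
  have hs := (summable_geometric_of_lt_one (by positivity) hA).mul_of_nonneg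
    (summable_geometric_of_lt_one (by positivity) hB) (fun _ => by positivity)
    (fun _ => by positivity)
  refine Summable.of_nonneg_of_le (chooseWeight_nonneg u t) ?_ hs
  rintro ⟨m, n⟩
  have h := choose_mul_le_one hq.le (by linarith) m n
  simp only [chooseWeight]
  calc ((2 * m + n).choose m : ℝ) * ‖u‖ ^ m * ‖t‖ ^ n
      = (((2 * m + n).choose m : ℝ) * (q * (1 - q)) ^ m * q ^ n)
        * ((‖u‖ / (q * (1 - q))) ^ m * (‖t‖ / q) ^ n) := by
        rw [div_pow, div_pow]
        field_simp
    _ ≤ 1 * ((‖u‖ / (q * (1 - q))) ^ m * (‖t‖ / q) ^ n) := by gcongr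
    _ = _ := one_mul _

theorem summable_chooseWeight_div {u t : ℂ} {q : ℝ} (ht : ‖t‖ < q) (hu : ‖u‖ < q * (1 - q)) :
    Summable fun q : ℕ × ℕ => chooseWeight u t q / ((2 * q.1 + q.2 : ℕ) + 1 : ℝ) := by
  refine Summable.of_nonneg_of_le (fun q => ?_) (fun q => ?_) (summable_chooseWeight ht hu)
  · have := chooseWeight_nonneg u t q
    positivity
  · refine div_le_self (chooseWeight_nonneg u t q) ?_
    have : (0 : ℝ) ≤ (2 * q.1 + q.2 : ℕ) := Nat.cast_nonneg _
    linarith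

/-- The series `∑ C(2 M, M) 4 ^ (-M) / (M + 1)` telescopes. -/
theorem summable_centralBinom_div :
    Summable fun M : ℕ => ((2 * M).choose M : ℝ) / 4 ^ M / (M + 1) := by
  set v : ℕ → ℝ := fun M => ((2 * M).choose M : ℝ) / 4 ^ M with hv
  have hstep : ∀ M : ℕ, v M / (M + 1) = 2 * (v M - v (M + 1)) := by
    intro M
    have h := Nat.succ_mul_centralBinom_succ M
    rw [Nat.centralBinom, Nat.centralBinom] at h
    have h' : ((M : ℝ) + 1) * ((2 * (M + 1)).choose (M + 1) : ℝ)
        = 2 * (2 * M + 1) * ((2 * M).choose M : ℝ) := by exact_mod_cast h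
    simp only [hv, pow_succ]
    field_simp
    linear_combination 2 * h'
  have hv0 : ∀ M, 0 ≤ v M := fun M => by simp only [hv]; positivity
  refine summable_of_sum_range_le (c := 2 * v 0) (fun M => by positivity) fun K => ?_
  have : ∀ K, ∑ M ∈ Finset.range K, v M / (M + 1) = 2 * (v 0 - v K) := by
    intro K
    induction K with
    | zero => simp
    | succ K ih =>
      rw [Finset.sum_range_succ, ih, hstep]
      ring
  rw [this]
  linarith [hv0 K]

theorem choose_mul_two_pow_le (m n : ℕ) :
    (2 * m + n).choose m * 2 ^ n ≤ (2 * (m + n)).choose (m + n) := by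
  have key : ∀ n m : ℕ, (2 * m + n).choose (m + n) * 2 ^ n ≤ (2 * (m + n)).choose (m + n) := by
    intro n
    induction n with
    | zero => simp
    | succ n ih =>
      intro m
      have h1 := ih (m + 1)
      rw [show m + 1 + n = m + (n + 1) by ring, show 2 * (m + 1) + n = 2 * m + (n + 1) + 1 by ring]
        at h1
      have h3 := Nat.choose_succ_right_eq (2 * m + (n + 1)) (m + n)
      have h4 : (2 * m + (n + 1) + 1).choose (m + n + 1)
          = (2 * m + (n + 1)).choose (m + n) + (2 * m + (n + 1)).choose (m + n + 1) :=
        Nat.choose_succ_succ _ _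
      have h5 : 2 * (2 * m + (n + 1)).choose (m + n + 1) ≤ (2 * m + (n + 1) + 1).choose (m + n + 1) := by
        rw [h4]
        have : (2 * m + (n + 1)).choose (m + n + 1) ≤ (2 * m + (n + 1)).choose (m + n) := by
          refine Nat.le_of_mul_le_mul_right (c := m + n + 1) ?_ (by omega)
          rw [h3]
          exact Nat.mul_le_mul_left _ (by omega)
        omega
      rw [show m + n + 1 = m + (n + 1) by ring] at h5
      calc _ = 2 * (2 * m + (n + 1)).choose (m + (n + 1)) * 2 ^ n := by ring
        _ ≤ (2 * m + (n + 1) + 1).choose (m + (n + 1)) * 2 ^ n := by gcongr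
        _ ≤ _ := h1
  have := key n m
  rwa [show (2 * m + n).choose (m + n) = (2 * m + n).choose m by
    rw [← Nat.choose_symm (show m ≤ 2 * m + n by omega)]; congr 1; omega] at this

theorem summable_chooseWeight_div_of_le {u ζ : ℂ} (hu : 4 * ‖u‖ ≤ 1) (hζ : ‖ζ‖ < 2) :
    Summable fun q : ℕ × ℕ => chooseWeight u (u * ζ) q / ((2 * q.1 + q.2 : ℕ) + 1 : ℝ) := by
  have h1 := summable_centralBinom_div.mul_of_nonneg
    (summable_geometric_of_lt_one (r := ‖ζ‖ / 2) (by positivity) (by linarith))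
    (fun _ => by positivity) (fun _ => by positivity)
  have hinj : Function.Injective fun q : ℕ × ℕ => ((q.1 + q.2, q.2) : ℕ × ℕ) := by
    rintro ⟨x, x'⟩ ⟨y, y'⟩ h
    simp only [Prod.mk.injEq] at h ⊢
    omega
  refine Summable.of_nonneg_of_le (fun q => ?_) ?_ (h1.comp_injective hinj)
  · have := chooseWeight_nonneg u (u * ζ) q
    positivity
  · rintro ⟨m, n⟩
    simp only [chooseWeight, Function.comp]
    have h2 : ((2 * m + n).choose m : ℝ) * 2 ^ n ≤ ((2 * (m + n)).choose (m + n) : ℝ) := by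
      exact_mod_cast choose_mul_two_pow_le m n
    have h3 : ‖u‖ ^ (m + n) ≤ (1 / 4) ^ (m + n) := by
      gcongr
      linarith
    calc ((2 * m + n).choose m : ℝ) * ‖u‖ ^ m * ‖u * ζ‖ ^ n / ((2 * m + n : ℕ) + 1 : ℝ)
        = (((2 * m + n).choose m : ℝ) * 2 ^ n) * ‖u‖ ^ (m + n) / ((2 * m + n : ℕ) + 1 : ℝ)
          * (‖ζ‖ / 2) ^ n := by
          rw [norm_mul, mul_pow, div_pow, pow_add]
          field_simp
      _ ≤ ((2 * (m + n)).choose (m + n) : ℝ) * (1 / 4) ^ (m + n) / ((m + n : ℕ) + 1 : ℝ)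
          * (‖ζ‖ / 2) ^ n := by
          gcongr
          omega
      _ = _ := by
          rw [div_pow, one_pow]
          ring

/-! ### The representations of `X'` -/

theorem XpSeries_eq_tsum_triTerm (a : ℝ) (ζ₁ ζ₂ ζ₃ : ℂ) :
    XpSeries a (a + 1) ζ₁ ζ₂ ζ₃ = ∑' q, triTerm a ζ₁ (ζ₁ * ζ₂) ζ₃ q := by
  have h : Function.support (XpTerm a (a + 1) ζ₁ ζ₂ ζ₃)
      ⊆ Set.range fun q : ℕ × ℕ × ℕ => ((q.1 + q.2.1, q.2) : ℕ × ℕ × ℕ) := by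
    intro x hx
    by_contra hx'
    exact hx (XpTerm_eq_zero_of_notMem_range _ _ ζ₁ ζ₂ ζ₃ x hx')
  rw [XpSeries, ← triangle_injective.tsum_eq h]
  exact tsum_congr fun q => XpTerm_add a ζ₁ ζ₂ ζ₃ q.1 q.2.1 q.2.2

theorem mul_humbertXi2Term {a : ℝ} (ha : IsHalf a) (ζ₁ ζ₂ ζ₃ : ℂ) (M : ℕ) (q : ℕ × ℕ) :
    ζ₁ ^ M * poch a (2 * M) / ((M.factorial : ℂ) * poch (a + 1) M)
        * humbertXi2Term 1 (-M) (1 - a - 2 * M) ζ₂ (-ζ₃) q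
      = XpTerm a (a + 1) ζ₁ ζ₂ ζ₃ (M, q) := by
  obtain ⟨r, s⟩ := q
  simp only [humbertXi2Term, XpTerm, poch_one_left]
  split_ifs with h
  · have h1 := ha.notInteger.pochInt_sub_nat ((2 * M : ℕ) : ℤ) (r + s)
    rw [pochInt_natCast] at h1
    push_cast at h1
    rw [show 2 * (M : ℤ) - r - s = 2 * (M : ℤ) - (r + s) by ring, h1, poch_neg_natCast h,
      neg_pow ζ₃, pow_add]
    have hM : (M.factorial : ℂ) ≠ 0 := by exact_mod_cast M.factorial_ne_zero
    have hr : (r.factorial : ℂ) ≠ 0 := by exact_mod_cast r.factorial_ne_zero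
    have e := mul_inv_cancel₀ hM
    have e' := mul_inv_cancel₀ hr
    simp only [div_eq_mul_inv, mul_inv]
    generalize (M.factorial : ℂ) = F at *
    generalize (r.factorial : ℂ) = G at *
    generalize (F : ℂ)⁻¹ = F' at *
    generalize (G : ℂ)⁻¹ = G' at *
    linear_combination (ζ₁ ^ M * poch a (2 * M) * (poch (a + 1) M)⁻¹ * (-1) ^ r * (-1) ^ s * ζ₂ ^ r
      * ζ₃ ^ s * (((M - r).factorial : ℕ) : ℂ)⁻¹ * ((s.factorial : ℕ) : ℂ)⁻¹
      * (poch (1 - a - 2 * M) (r + s))⁻¹) * (e * (G * G') + e')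
  · rw [poch_neg_natCast_of_lt (by omega)]
    simp

theorem slice_injective (n : ℕ) : Function.Injective fun q : ℕ × ℕ => ((n, q) : ℕ × ℕ × ℕ) :=
  fun x y h => by simpa using h

theorem rotate_injective :
    Function.Injective fun q : ℕ × (ℕ × ℕ) => ((q.2.1, q.1, q.2.2) : ℕ × ℕ × ℕ) := by
  rintro ⟨x, x', x''⟩ ⟨y, y', y''⟩ h
  simp only [Prod.mk.injEq] at h ⊢
  tauto

theorem rotate_injective' :
    Function.Injective fun q : ℕ × (ℕ × ℕ) => ((q.2.1, q.2.2, q.1) : ℕ × ℕ × ℕ) := by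
  rintro ⟨x, x', x''⟩ ⟨y, y', y''⟩ h
  simp only [Prod.mk.injEq] at h ⊢
  tauto

theorem summable_humbertXi2Term {a : ℝ} (ha : IsHalf a) (ζ₂ ζ₃ : ℂ) (M : ℕ) :
    Summable (humbertXi2Term 1 (-M) (1 - a - 2 * M) ζ₂ (-ζ₃)) := by
  -- The function does not involve `ζ₁`, which may therefore be taken small and nonzero.
  obtain ⟨ε, hε, h1, h2⟩ : ∃ ε : ℝ, 0 < ε ∧ ε < 1 / 4 ∧ ε * ‖ζ₂‖ < 1 / 2 := by
    refine ⟨1 / (5 + 2 * ‖ζ₂‖), by positivity, ?_, ?_⟩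
    · rw [div_lt_div_iff₀ (by positivity) (by norm_num)]
      linarith [norm_nonneg ζ₂]
    · rw [div_mul_eq_mul_div, div_lt_div_iff₀ (by positivity) (by norm_num)]
      linarith [norm_nonneg ζ₂]
  have hs : Summable (XpTerm a (a + 1) ε ζ₂ ζ₃) := by
    rw [summable_XpTerm_iff]
    refine summable_triTerm ha ζ₃ (summable_chooseWeight_div (q := 1 / 2) ?_ ?_)
    · rwa [norm_mul, Complex.norm_real, Real.norm_of_nonneg hε.le]
    · rw [Complex.norm_real, Real.norm_of_nonneg hε.le]
      linarith
  refine summable_of_mul_eq_comp hs (slice_injective M) ?_ (mul_humbertXi2Term ha ε ζ₂ ζ₃ M)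
  refine div_ne_zero (mul_ne_zero (pow_ne_zero _ (by exact_mod_cast hε.ne'))
    (ha.notInteger.poch_ne_zero _)) (mul_ne_zero ?_ (ha.notInteger.add_one.poch_ne_zero _))
  exact_mod_cast M.factorial_ne_zero

theorem hasSum_XpXi2Term {a : ℝ} (ha : IsHalf a) {ζ₁ ζ₂ ζ₃ : ℂ}
    (h : Summable (XpTerm a (a + 1) ζ₁ ζ₂ ζ₃)) :
    HasSum (XpXi2Term a (a + 1) ζ₁ ζ₂ ζ₃) (XpSeries a (a + 1) ζ₁ ζ₂ ζ₃) :=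
  hasSum_fiberwise h (i := fun q => q) (fun _ _ h => h) (fun x hx => (hx ⟨x, rfl⟩).elim)
    (mul_humbertXi2Term ha ζ₁ ζ₂ ζ₃)

theorem mul_hornH10Term {a : ℝ} (ha : IsHalf a) (u t w : ℂ) (n : ℕ) (q : ℕ × ℕ) :
    t ^ n * poch a n / poch (a + 1) n * hornH10Term (a + n) (a + 1 + n) u w q
      = triTerm a u t w (q.1, n, q.2) := by
  obtain ⟨m, p⟩ := q
  simp only [hornH10Term, triTerm]
  have h1 := ha.notInteger.pochInt_add_int (n : ℤ) (2 * (m : ℤ) - p)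
  rw [pochInt_natCast] at h1
  rw [show ((2 * m + n : ℕ) : ℤ) - p = (n : ℤ) + (2 * (m : ℤ) - p) by push_cast; ring, h1,
    add_comm m n, poch_add (a + 1) n m]
  simp only [div_eq_mul_inv, mul_inv, Int.cast_natCast]
  ring

theorem summable_hornH10Term {a : ℝ} (ha : IsHalf a) {u : ℂ} (hu : ‖u‖ < 1 / 4) (w : ℂ) (n : ℕ) :
    Summable (hornH10Term (a + n) (a + 1 + n) u w) := by
  -- The variable `t` may be given any small nonzero value.
  have hs : Summable (triTerm a u (1 / 4) w) := by
    refine summable_triTerm ha w (summable_chooseWeight_div (q := 1 / 2) ?_ (by linarith))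
    norm_num
  refine summable_of_mul_eq_comp hs (rotate_injective.comp (slice_injective n)) ?_
    (mul_hornH10Term ha u (1 / 4) w n)
  exact div_ne_zero (mul_ne_zero (pow_ne_zero _ (by norm_num)) (ha.notInteger.poch_ne_zero _))
    (ha.notInteger.add_one.poch_ne_zero _)

theorem XpH10Term_eq_tsum {a : ℝ} (ha : IsHalf a) (ζ₁ ζ₂ ζ₃ : ℂ) (n : ℕ) :
    XpH10Term a (a + 1) ζ₁ ζ₂ ζ₃ n = ∑' q : ℕ × ℕ, triTerm a ζ₁ (ζ₁ * ζ₂) ζ₃ (q.1, n, q.2) := by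
  rw [XpH10Term, hornH10, ← tsum_mul_left]
  exact tsum_congr (mul_hornH10Term ha ζ₁ (ζ₁ * ζ₂) ζ₃ n)

theorem hasSum_XpH10Term {a : ℝ} (ha : IsHalf a) {ζ₁ ζ₂ ζ₃ : ℂ}
    (h : Summable (XpTerm a (a + 1) ζ₁ ζ₂ ζ₃)) :
    HasSum (XpH10Term a (a + 1) ζ₁ ζ₂ ζ₃) (XpSeries a (a + 1) ζ₁ ζ₂ ζ₃) := by
  rw [summable_XpTerm_iff] at h
  rw [XpSeries_eq_tsum_triTerm]
  exact hasSum_fiberwise h rotate_injective (fun x hx => (hx ⟨(x.2.1, x.1, x.2.2), rfl⟩).elim)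
    (mul_hornH10Term ha ζ₁ (ζ₁ * ζ₂) ζ₃)

theorem mul_hornH3Term {a : ℝ} (ha : IsHalf a) (u t w : ℂ) (p : ℕ) (q : ℕ × ℕ) :
    (-w) ^ p / ((p.factorial : ℂ) * poch (1 - a) p) * hornH3Term (a - p) 1 (a + 1) u t q
      = triTerm a u t w (q.1, q.2, p) := by
  obtain ⟨m, n⟩ := q
  simp only [hornH3Term, triTerm, poch_one_left]
  have h1 := ha.notInteger.pochInt_add_nat (-(p : ℤ)) (2 * m + n)
  rw [pochInt_neg_natCast] at h1
  rw [show ((2 * m + n : ℕ) : ℤ) - p = -(p : ℤ) + (2 * m + n : ℕ) by ring, h1, neg_pow w,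
    Int.cast_neg, Int.cast_natCast, ← sub_eq_add_neg]
  have e := mul_inv_cancel₀ (show (n.factorial : ℂ) ≠ 0 by exact_mod_cast n.factorial_ne_zero)
  simp only [div_eq_mul_inv, mul_inv]
  generalize (n.factorial : ℂ) = F at *
  generalize (F : ℂ)⁻¹ = F' at *
  linear_combination ((-1) ^ p * w ^ p * ((p.factorial : ℕ) : ℂ)⁻¹ * (poch (1 - a) p)⁻¹
    * poch (a - p) (2 * m + n) * (poch (a + 1) (m + n))⁻¹ * u ^ m * t ^ n
    * ((m.factorial : ℕ) : ℂ)⁻¹) * e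

theorem summable_hornH3Term {a : ℝ} (ha : IsHalf a) {u t : ℂ} {q : ℝ} (ht : ‖t‖ < q)
    (hu : ‖u‖ < q * (1 - q)) (p : ℕ) : Summable (hornH3Term (a - p) 1 (a + 1) u t) := by
  have hs : Summable (triTerm a u t 1) := summable_triTerm ha 1 (summable_chooseWeight_div ht hu)
  refine summable_of_mul_eq_comp hs (rotate_injective'.comp (slice_injective p)) ?_
    (mul_hornH3Term ha u t 1 p)
  refine div_ne_zero (pow_ne_zero _ (by norm_num)) (mul_ne_zero ?_
    (ha.notInteger.one_sub.poch_ne_zero _))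
  exact_mod_cast p.factorial_ne_zero

theorem hasSum_XpH3Term {a : ℝ} (ha : IsHalf a) {ζ₁ ζ₂ ζ₃ : ℂ}
    (h : Summable (XpTerm a (a + 1) ζ₁ ζ₂ ζ₃)) :
    HasSum (XpH3Term a (a + 1) ζ₁ ζ₂ ζ₃) (XpSeries a (a + 1) ζ₁ ζ₂ ζ₃) := by
  rw [summable_XpTerm_iff] at h
  rw [XpSeries_eq_tsum_triTerm]
  exact hasSum_fiberwise h rotate_injective' (fun x hx => (hx ⟨(x.2.2, x.1, x.2.1), rfl⟩).elim)
    (mul_hornH3Term ha ζ₁ (ζ₁ * ζ₂) ζ₃)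

/-! ### Summation over triangles -/

theorem hasSum_triangle {F : ℕ × ℕ → ℂ} (hF : Summable F) :
    HasSum (fun M => ∑ n ∈ Finset.range (M + 1), F (M - n, n)) (∑' q, F q) := by
  have h1 := (Finset.HasAntidiagonal.sigmaAntidiagonalEquivProd (A := ℕ)).hasSum_iff.2
    ((Equiv.prodComm ℕ ℕ).hasSum_iff.2 hF.hasSum)
  refine h1.sigma fun M => ?_
  have h2 := hasSum_fintype fun c : Finset.HasAntidiagonal.antidiagonal M =>
    F ((c : ℕ × ℕ).2, (c : ℕ × ℕ).1)
  rw [Finset.sum_coe_sort (Finset.HasAntidiagonal.antidiagonal M) fun c : ℕ × ℕ => F (c.2, c.1),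
    Finset.Nat.sum_antidiagonal_eq_sum_range_succ_mk] at h2
  exact h2

theorem triangleSummable_of_add {T : ℕ → ℕ → ℂ} (h : Summable fun q : ℕ × ℕ => T (q.1 + q.2) q.2) :
    TriangleSummable T := by
  have hinj : Function.Injective fun q : ℕ × ℕ => ((q.1 + q.2, q.2) : ℕ × ℕ) := by
    rintro ⟨x, x'⟩ ⟨y, y'⟩ h
    simp only [Prod.mk.injEq] at h ⊢
    omega
  rw [TriangleSummable, ← hinj.summable_iff]
  · refine h.congr fun q => ?_
    simp
  · rintro ⟨M, n⟩ hx
    simp only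
    rw [if_neg]
    intro h
    exact hx ⟨(M - n, n), by simp [Nat.sub_add_cancel h]⟩

theorem Summable.tsum_last {f : ℕ × ℕ × ℕ → ℂ} (hf : Summable f) :
    HasSum (fun q : ℕ × ℕ => ∑' p, f (q.1, q.2, p)) (∑' x, f x) := by
  have h := (Equiv.prodAssoc ℕ ℕ ℕ).hasSum_iff.2 hf.hasSum
  exact h.prod_fiberwise fun q => (h.summable.prod_factor q).hasSum

theorem Summable.last_slice {f : ℕ × ℕ × ℕ → ℂ} (hf : Summable f) (m n : ℕ) :
    Summable fun p => f (m, n, p) :=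
  ((Equiv.prodAssoc ℕ ℕ ℕ).summable_iff.2 hf).prod_factor (m, n)

/-- A double series whose terms are sums of terms of two absolutely convergent triple series
converges absolutely. -/
theorem triangleSummable_of_split {T : ℕ → ℕ → ℂ} {α β : ℂ} {f g : ℕ × ℕ × ℕ → ℂ}
    (hT : ∀ m n, T (m + n) n = α * ∑' p, f (m, n, p) + β * ∑' p, g (m, n, p))
    (hf : Summable f) (hg : Summable g) : TriangleSummable T :=
  triangleSummable_of_add <| ((hf.tsum_last.summable.mul_left α).add
    (hg.tsum_last.summable.mul_left β)).congr fun q => (hT q.1 q.2).symm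

theorem hasSum_of_split {T : ℕ → ℕ → ℂ} {α β : ℂ} {f g : ℕ × ℕ × ℕ → ℂ}
    (hT : ∀ m n, T (m + n) n = α * ∑' p, f (m, n, p) + β * ∑' p, g (m, n, p))
    (hf : Summable f) (hg : Summable g) :
    HasSum (fun M => ∑ n ∈ Finset.range (M + 1), T M n) (α * ∑' x, f x + β * ∑' x, g x) := by
  have h1 := (hasSum_triangle hf.tsum_last.summable).mul_left α
  have h2 := (hasSum_triangle hg.tsum_last.summable).mul_left β
  rw [hf.tsum_last.tsum_eq] at h1
  rw [hg.tsum_last.tsum_eq] at h2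
  refine (h1.add h2).congr_fun fun M => ?_
  rw [Finset.mul_sum, Finset.mul_sum, ← Finset.sum_add_distrib]
  refine Finset.sum_congr rfl fun n hn => ?_
  rw [← hT, Nat.sub_add_cancel (Nat.lt_succ_iff.1 (Finset.mem_range.1 hn))]

/-- The conditionally convergent analogue: `f` splits into an absolutely convergent part `e` and a
double series `h` that may be summed over triangles only conditionally. -/
theorem seriesTendsto_of_split {T : ℕ → ℕ → ℂ} {α β s : ℂ} {f g e : ℕ × ℕ × ℕ → ℂ}
    {h : ℕ × ℕ → ℂ}
    (hT : ∀ m n, T (m + n) n = α * ∑' p, f (m, n, p) + β * ∑' p, g (m, n, p))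
    (hfe : ∀ m n p, f (m, n, p) = e (m, n, p) + if p = 0 then h (m, n) else 0)
    (he : Summable e) (hg : Summable g)
    (hh : SeriesTendsto (fun M => ∑ n ∈ Finset.range (M + 1), h (M - n, n)) s) :
    SeriesTendsto (fun M => ∑ n ∈ Finset.range (M + 1), T M n)
      (α * (∑' x, e x + s) + β * ∑' x, g x) := by
  have hf : ∀ m n, ∑' p, f (m, n, p) = ∑' p, e (m, n, p) + h (m, n) := by
    intro m n
    have h1 := (he.last_slice m n).hasSum.add (hasSum_ite_eq 0 (h (m, n)))
    rw [← h1.tsum_eq]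
    exact tsum_congr fun p => hfe m n p
  have h1 := (hasSum_of_split (T := fun M n => α * ∑' p, e (M - n, n, p)
    + β * ∑' p, g (M - n, n, p)) (fun m n => by rw [Nat.add_sub_cancel]) he hg).tendsto_sum_nat
  have h2 := h1.add (hh.const_mul α)
  rw [show α * (∑' x, e x + s) + β * ∑' x, g x = α * ∑' x, e x + β * ∑' x, g x + α * s by ring]
  refine h2.congr fun N => ?_
  rw [Finset.mul_sum, ← Finset.sum_add_distrib]
  refine Finset.sum_congr rfl fun M _ => ?_
  rw [Finset.mul_sum, ← Finset.sum_add_distrib]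
  refine Finset.sum_congr rfl fun n hn => ?_
  have hM : M - n + n = M := Nat.sub_add_cancel (Nat.lt_succ_iff.1 (Finset.mem_range.1 hn))
  have h3 := hT (M - n) n
  rw [hM, hf] at h3
  rw [h3]
  ring

/-! ### The boundary: remainder of the comparison with a binomial model -/

theorem sum_binomial_eq_one (Q : ℝ) (N : ℕ) :
    ∑ m ∈ Finset.range (N + 1), (N.choose m : ℝ) * Q ^ m * (1 - Q) ^ (N - m) = 1 := by
  have h := add_pow Q (1 - Q) N
  rw [add_sub_cancel, one_pow] at h
  refine Eq.trans ?_ h.symm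
  exact Finset.sum_congr rfl fun m _ => by ring

/-- The mean absolute deviation of the binomial distribution is at most `√N`. -/
theorem sum_binomial_abs_le {Q : ℝ} (h0 : 0 ≤ Q) (h1 : Q ≤ 1) (N : ℕ) :
    ∑ m ∈ Finset.range (N + 1), ((N.choose m : ℝ) * Q ^ m * (1 - Q) ^ (N - m)) * |N * Q - m|
      ≤ √N := by
  rcases Nat.eq_zero_or_pos N with rfl | hN
  · simp
  have hN' : (0 : ℝ) < N := by exact_mod_cast hN
  have hsN : 0 < √(N : ℝ) := Real.sqrt_pos.2 hN'
  have hw : ∀ m, 0 ≤ (N.choose m : ℝ) * Q ^ m * (1 - Q) ^ (N - m) := fun m =>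
    mul_nonneg (by positivity) (pow_nonneg (by linarith) _)
  have hsum := sum_binomial_eq_one Q N
  have hvar : ∑ m ∈ Finset.range (N + 1),
      ((N.choose m : ℝ) * Q ^ m * (1 - Q) ^ (N - m)) * (N * Q - m) ^ 2 = N * Q * (1 - Q) := by
    have h := congrArg (Polynomial.eval Q) (bernsteinPolynomial.variance ℝ N)
    simp only [bernsteinPolynomial, Polynomial.eval_finsetSum, Polynomial.eval_mul,
      Polynomial.eval_pow, Polynomial.eval_sub, Polynomial.eval_X, Polynomial.eval_natCast,
      Polynomial.eval_one, nsmul_eq_mul] at h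
    rw [← h]
    exact Finset.sum_congr rfl fun m _ => by ring
  have hpt : ∀ m : ℕ, |N * Q - m| ≤ √N / 2 + (N * Q - m) ^ 2 / (2 * √N) := by
    intro m
    rw [← sq_abs (N * Q - m : ℝ)]
    have : √(N : ℝ) / 2 + |N * Q - m| ^ 2 / (2 * √N) - |N * Q - m|
        = (√N - |N * Q - m|) ^ 2 / (2 * √N) := by
      field_simp
      ring
    have h2 : 0 ≤ (√(N : ℝ) - |N * Q - m|) ^ 2 / (2 * √N) := by positivity
    linarith
  calc _ ≤ ∑ m ∈ Finset.range (N + 1), ((N.choose m : ℝ) * Q ^ m * (1 - Q) ^ (N - m))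
        * (√N / 2 + (N * Q - m) ^ 2 / (2 * √N)) :=
        Finset.sum_le_sum fun m _ => mul_le_mul_of_nonneg_left (hpt m) (hw m)
    _ = √N / 2 + N * Q * (1 - Q) / (2 * √N) := by
        rw [← hvar, Finset.sum_div]
        have e : √(N : ℝ) / 2 = ∑ m ∈ Finset.range (N + 1),
            ((N.choose m : ℝ) * Q ^ m * (1 - Q) ^ (N - m)) * (√N / 2) := by
          rw [← Finset.sum_mul, hsum, one_mul]
        rw [e, ← Finset.sum_add_distrib, ← e]
        exact Finset.sum_congr rfl fun m _ => by ring
    _ ≤ √N / 2 + √N / 2 := by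
        refine add_le_add le_rfl ?_
        rw [div_le_iff₀ (by positivity), show √(N : ℝ) / 2 * (2 * √N) = √N * √N by ring,
          Real.mul_self_sqrt hN'.le]
        nlinarith [mul_nonneg h0 h0, mul_nonneg hN'.le h0]
    _ = √N := by ring

/-- The error terms of the comparison are summable: on `2 m + n = N` they are binomial
probabilities times the deviation from the mean, hence contribute `O(N ^ (-3 / 2))`. -/
theorem summable_binomial_error {Q : ℝ} (h0 : 0 ≤ Q) (h1 : Q ≤ 1) :
    Summable fun q : ℕ × ℕ => ((2 * q.1 + q.2).choose q.1 : ℝ) * ((1 - Q) * Q) ^ q.1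
      * (1 - Q) ^ q.2 * (|(1 - Q) * (2 * q.1 + q.2 : ℕ) - (q.1 + q.2 : ℕ)| + 1)
        / ((2 * q.1 + q.2 : ℕ) + 1 : ℝ) ^ 2 := by
  set g : ℕ × ℕ → ℝ := fun x => ((x.1.choose x.2 : ℝ) * Q ^ x.2 * (1 - Q) ^ (x.1 - x.2))
    * (|x.1 * Q - x.2| + 1) / ((x.1 : ℝ) + 1) ^ 2 with hg
  have hw : ∀ N m, 0 ≤ (N.choose m : ℝ) * Q ^ m * (1 - Q) ^ (N - m) := fun N m =>
    mul_nonneg (by positivity) (pow_nonneg (by linarith) _)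
  have hg0 : ∀ x, 0 ≤ g x := fun x => div_nonneg (mul_nonneg (hw _ _) (by positivity))
    (by positivity)
  have hfin : ∀ N m, m ∉ Finset.range (N + 1) → g (N, m) = 0 := by
    intro N m hm
    simp only [hg]
    rw [Nat.choose_eq_zero_of_lt (by simpa using hm)]
    simp
  have hgs : Summable g := by
    rw [summable_prod_of_nonneg hg0]
    refine ⟨fun N => summable_of_ne_finset_zero (hfin N), ?_⟩
    have hb : Summable fun N : ℕ => 2 * (((N + 1 : ℕ) : ℝ) ^ (3 / 2 : ℝ))⁻¹ :=
      ((summable_nat_add_iff 1).2 (Real.summable_nat_rpow_inv.2 (by norm_num : (1 : ℝ) < 3 / 2))).mul_left 2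
    refine Summable.of_nonneg_of_le (fun N => tsum_nonneg fun m => hg0 _) (fun N => ?_) hb
    rw [tsum_eq_sum (hfin N)]
    simp only [hg]
    rw [← Finset.sum_div]
    simp only [mul_add, mul_one, Finset.sum_add_distrib]
    rw [sum_binomial_eq_one]
    have hN1 : (0 : ℝ) < ((N + 1 : ℕ) : ℝ) := by positivity
    have hs1 : 1 ≤ √((N + 1 : ℕ) : ℝ) := by
      rw [Real.one_le_sqrt]
      push_cast
      linarith [N.cast_nonneg (α := ℝ)]
    have hs2 : √(N : ℝ) ≤ √((N + 1 : ℕ) : ℝ) := Real.sqrt_le_sqrt (by push_cast; linarith)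
    have e : (((N + 1 : ℕ) : ℝ) ^ (3 / 2 : ℝ)) = ((N + 1 : ℕ) : ℝ) * √((N + 1 : ℕ) : ℝ) := by
      rw [show (3 / 2 : ℝ) = 1 + 1 / 2 by norm_num, Real.rpow_add hN1, Real.rpow_one,
        Real.sqrt_eq_rpow]
    rw [e, ← div_eq_mul_inv, div_le_div_iff₀ (by positivity) (by positivity)]
    have hsq := Real.mul_self_sqrt hN1.le
    have hle := sum_binomial_abs_le h0 h1 N
    set y := √((N + 1 : ℕ) : ℝ)
    calc _ ≤ (y + y) * (((N + 1 : ℕ) : ℝ) * y) := by gcongr; linarith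
      _ = 2 * (y * y) * ((N + 1 : ℕ) : ℝ) := by ring
      _ = _ := by
        rw [hsq]
        push_cast
        ring
  have hinj : Function.Injective fun q : ℕ × ℕ => ((2 * q.1 + q.2, q.1) : ℕ × ℕ) := by
    rintro ⟨x, x'⟩ ⟨y, y'⟩ h
    simp only [Prod.mk.injEq] at h ⊢
    omega
  refine (hgs.comp_injective hinj).congr ?_
  rintro ⟨m, n⟩
  simp only [hg, Function.comp]
  rw [show 2 * m + n - m = m + n by omega, mul_pow, pow_add,
    show (1 - Q) * ((2 * m + n : ℕ) : ℝ) - (m + n : ℕ) = -(((2 * m + n : ℕ) : ℝ) * Q - m) by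
      push_cast; ring, abs_neg]
  ring

/-- The model for the terms of `X'` on the boundary: for `n > 0` the coefficient of `u ^ m t ^ n` is
`C(2 m + n, m) / (2 m + n)`. -/
noncomputable def modelTerm (u t : ℂ) (q : ℕ × ℕ) : ℂ :=
  if q.2 = 0 then 0
  else (2 * q.1 + q.2).choose q.1 / ((2 * q.1 + q.2 : ℕ) : ℂ) * u ^ q.1 * t ^ q.2

/-- On the boundary the terms of `X'` are a multiple of the model up to an absolutely convergent
series. -/
theorem exists_summable_triTerm_sub {a : ℝ} (ha : IsHalf a) {u t : ℂ} (w : ℂ) {Q : ℝ} (h0 : 0 < Q)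
    (h1 : Q < 1 / 2) (hu : ‖u‖ = (1 - Q) * Q) (ht : ‖t‖ = 1 - Q) :
    ∃ κ : ℂ, Summable fun q : ℕ × ℕ × ℕ =>
      triTerm a u t w q - if q.2.2 = 0 then κ * modelTerm u t (q.1, q.2.1) else 0 := by
  obtain ⟨κ, C, hC, hκ⟩ := ha.exists_norm_pochQuot_sub_le (P := 1 - Q) (by linarith) (by linarith)
  refine ⟨κ, ?_⟩
  have hQ4 : ‖u‖ < 1 / 2 * (1 - 1 / 2) := by
    rw [hu]
    nlinarith
  have hs0 := summable_chooseWeight (t := 0) (q := 1 / 2) (by simp) hQ4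
  have hs1 := summable_binomial_error h0.le (by linarith : Q ≤ 1)
  have hs := ((hs1.mul_left (96 + 4 * C)).add (hs0.mul_left 16)).mul_of_nonneg
    (Real.summable_pow_div_factorial ‖w‖) (fun q => by
      have hQ1 : 0 ≤ 1 - Q := by linarith
      have := chooseWeight_nonneg u 0 q
      positivity) (fun _ => by positivity)
  rw [← (Equiv.prodAssoc ℕ ℕ ℕ).summable_iff]
  refine Summable.of_norm_bounded hs ?_
  rintro ⟨⟨m, n⟩, p⟩
  simp only [Function.comp, Equiv.prodAssoc_apply]
  set D := |(1 - Q) * ((2 * m + n : ℕ) : ℝ) - (m + n : ℕ)| with hD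
  have hD0 : 0 ≤ D := abs_nonneg _
  have hW : ((2 * m + n).choose m : ℝ) * ((1 - Q) * Q) ^ m * (1 - Q) ^ n = chooseWeight u t (m, n) := by
    simp only [chooseWeight, hu, ht]
  rw [hW]
  have hW0 := chooseWeight_nonneg u t (m, n)
  have hW1 := chooseWeight_nonneg u 0 (m, n)
  rcases p with _ | p
  · rw [if_pos rfl]
    rcases Nat.eq_zero_or_pos n with rfl | hn
    · -- the terms with `n = 0` decay geometrically
      have h2 := norm_triTerm_le ha u t w m 0 0
      have e : chooseWeight u t (m, 0) = chooseWeight u 0 (m, 0) := by simp [chooseWeight]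
      have h3 : chooseWeight u t (m, 0) / ((2 * m + 0 : ℕ) + 1 : ℝ) ≤ chooseWeight u 0 (m, 0) := by
        rw [e]
        refine div_le_self hW1 ?_
        have : (0 : ℝ) ≤ (2 * m + 0 : ℕ) := Nat.cast_nonneg _
        linarith
      simp only [modelTerm, if_true, mul_zero, sub_zero]
      refine h2.trans (mul_le_mul_of_nonneg_right ?_ (by positivity))
      have : 0 ≤ (96 + 4 * C) * (chooseWeight u t (m, 0) * (D + 1)
        / ((2 * m + 0 : ℕ) + 1 : ℝ) ^ 2) := by positivity
      linarith
    · have hN : 0 < 2 * m + n := by omega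
      have hN1 : (1 : ℝ) ≤ (2 * m + n : ℕ) := by exact_mod_cast hN
      have h2 := hκ (m + n) (2 * m + n) (by omega) (by omega) hN
      rw [triTerm_zero, modelTerm, if_neg hn.ne']
      have e : u ^ m * t ^ n * ((2 * m + n).choose m : ℂ) * pochQuot a (2 * m + n) (m + n)
          - κ * (((2 * m + n).choose m : ℂ) / ((2 * m + n : ℕ) : ℂ) * u ^ m * t ^ n)
          = u ^ m * t ^ n * ((2 * m + n).choose m : ℂ)
            * (pochQuot a (2 * m + n) (m + n) - κ / ((2 * m + n : ℕ) : ℂ)) := by ring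
      rw [e, norm_mul]
      have e2 : ‖u ^ m * t ^ n * ((2 * m + n).choose m : ℂ)‖ = chooseWeight u t (m, n) := by
        simp only [norm_mul, norm_pow, RCLike.norm_natCast, chooseWeight]
        ring
      rw [e2]
      have h3 : C * (D + 1) / ((2 * m + n : ℕ) : ℝ) ^ 2
          ≤ 4 * C * ((D + 1) / ((2 * m + n : ℕ) + 1 : ℝ) ^ 2) := by
        rw [← mul_div_assoc, div_le_div_iff₀ (by positivity) (by positivity)]
        have : ((2 * m + n : ℕ) + 1 : ℝ) ^ 2 ≤ 4 * ((2 * m + n : ℕ) : ℝ) ^ 2 := by nlinarith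
        calc _ ≤ C * (D + 1) * (4 * ((2 * m + n : ℕ) : ℝ) ^ 2) := by gcongr
          _ = _ := by ring
      calc _ ≤ chooseWeight u t (m, n) * (4 * C * ((D + 1) / ((2 * m + n : ℕ) + 1 : ℝ) ^ 2)) := by
            gcongr
            exact h2.trans h3
        _ = (4 * C * (chooseWeight u t (m, n) * (D + 1) / ((2 * m + n : ℕ) + 1 : ℝ) ^ 2))
            * (‖w‖ ^ 0 / (Nat.factorial 0)) := by
            simp
            ring
        _ ≤ _ := by
            gcongr
            have : 0 ≤ 96 * (chooseWeight u t (m, n) * (D + 1) / ((2 * m + n : ℕ) + 1 : ℝ) ^ 2) := by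
              positivity
            linarith
  · rw [if_neg (by omega), sub_zero]
    refine (norm_triTerm_succ_le ha u t w m n p).trans ?_
    gcongr
    have h2 : chooseWeight u t (m, n) / ((2 * m + n : ℕ) + 1 : ℝ) ^ 2
        ≤ chooseWeight u t (m, n) * (D + 1) / ((2 * m + n : ℕ) + 1 : ℝ) ^ 2 := by
      gcongr
      nlinarith
    have h3 : 0 ≤ 4 * C * (chooseWeight u t (m, n) * (D + 1) / ((2 * m + n : ℕ) + 1 : ℝ) ^ 2) := by
      positivity
    linarith

/-! ### The model summed over `m` -/

/-- The smaller root `G` of `G (1 - G) = u`. -/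
theorem exists_small_root {u : ℂ} (hu : ‖u‖ < 1 / 4) : ∃ G : ℂ, G * (1 - G) = u ∧ ‖G‖ < 1 / 2 := by
  obtain ⟨s, hs⟩ := IsAlgClosed.exists_pow_nat_eq (1 - 4 * u) two_pos
  have key : ∀ G : ℂ, G * (1 - G) = u → ‖G‖ ≤ ‖1 - G‖ → ‖G‖ < 1 / 2 := by
    intro G hG h
    have h1 := congrArg norm hG
    rw [norm_mul] at h1
    nlinarith [norm_nonneg G, norm_nonneg (1 - G)]
  have e1 : (1 + s) / 2 * (1 - (1 + s) / 2) = u := by linear_combination (-1 / 4) * hs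
  rcases le_total ‖(1 + s) / 2‖ ‖1 - (1 + s) / 2‖ with h | h
  · exact ⟨_, e1, key _ e1 h⟩
  · have e2 : (1 - (1 + s) / 2) * (1 - (1 - (1 + s) / 2)) = u := by linear_combination e1
    exact ⟨_, e2, key _ e2 (by rwa [sub_sub_cancel])⟩

theorem one_sub_ne_zero_of_norm_lt {G : ℂ} (hG : ‖G‖ < 1 / 2) : 1 - G ≠ 0 := by
  intro h
  rw [← sub_eq_zero.1 h, norm_one] at hG
  norm_num at hG

section ChooseSeries

variable {u : ℂ}

theorem norm_choose_mul_pow_le {q : ℝ} (hq0 : 0 < q) (hq1 : q < 1) (m n : ℕ) :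
    ‖((2 * m + n).choose m : ℂ) * u ^ m‖ ≤ (‖u‖ / (q * (1 - q))) ^ m * (q⁻¹) ^ n := by
  have h := choose_mul_le_one hq0.le hq1.le m n
  have hqq : 0 < q * (1 - q) := mul_pos hq0 (by linarith)
  rw [norm_mul, norm_pow, RCLike.norm_natCast]
  calc ((2 * m + n).choose m : ℝ) * ‖u‖ ^ m
      = (((2 * m + n).choose m : ℝ) * (q * (1 - q)) ^ m * q ^ n)
        * ((‖u‖ / (q * (1 - q))) ^ m * (q⁻¹) ^ n) := by
        rw [div_pow, inv_pow]
        field_simp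
    _ ≤ 1 * ((‖u‖ / (q * (1 - q))) ^ m * (q⁻¹) ^ n) := by gcongr
    _ = _ := one_mul _

theorem summable_choose_mul_pow (hu : ‖u‖ < 1 / 4) (n : ℕ) :
    Summable fun m : ℕ => ((2 * m + n).choose m : ℂ) * u ^ m := by
  refine Summable.of_norm_bounded ((summable_geometric_of_lt_one (by positivity) ?_).mul_right _)
    fun m => norm_choose_mul_pow_le (q := 1 / 2) (by norm_num) (by norm_num) m n
  rw [div_lt_one (by norm_num)]
  linarith

/-- The series `S n = ∑ C(2 m + n, m) u ^ m` satisfy `S (n + 1) = S n + u S (n + 2)`. -/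
theorem tsum_choose_succ (hu : ‖u‖ < 1 / 4) (n : ℕ) :
    ∑' m : ℕ, ((2 * m + (n + 1)).choose m : ℂ) * u ^ m
      = ∑' m : ℕ, ((2 * m + n).choose m : ℂ) * u ^ m
        + u * ∑' m : ℕ, ((2 * m + (n + 2)).choose m : ℂ) * u ^ m := by
  rw [(summable_choose_mul_pow hu (n + 1)).tsum_eq_zero_add,
    (summable_choose_mul_pow hu n).tsum_eq_zero_add, ← tsum_mul_left, add_assoc]
  congr 1
  · simp
  rw [← Summable.tsum_add ((summable_nat_add_iff 1).2 (summable_choose_mul_pow hu n))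
    ((summable_choose_mul_pow hu (n + 2)).mul_left u)]
  refine tsum_congr fun m => ?_
  have h : (2 * (m + 1) + (n + 1)).choose (m + 1)
      = (2 * m + (n + 2)).choose m + (2 * (m + 1) + n).choose (m + 1) := by
    rw [show 2 * (m + 1) + (n + 1) = 2 * m + (n + 2) + 1 by ring, Nat.choose_succ_succ,
      show 2 * m + (n + 2) = 2 * (m + 1) + n by ring]
  rw [h]
  push_cast
  ring

/-- The growth of `S n = ∑ C(2 m + n, m) u ^ m` rules out the dominant solution of the recurrence,
so that `S (n + 1) = S n / (1 - G)`. -/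
theorem tsum_choose_succ_eq (hu : ‖u‖ < 1 / 4) {G : ℂ} (hG : G * (1 - G) = u) (hG2 : ‖G‖ < 1 / 2)
    (n : ℕ) :
    (1 - G) * ∑' m : ℕ, ((2 * m + (n + 1)).choose m : ℂ) * u ^ m
      = ∑' m : ℕ, ((2 * m + n).choose m : ℂ) * u ^ m := by
  set S : ℕ → ℂ := fun n => ∑' m : ℕ, ((2 * m + n).choose m : ℂ) * u ^ m with hS
  have hrec : ∀ n, S (n + 1) = S n + u * S (n + 2) := tsum_choose_succ hu
  have hG1 := one_sub_ne_zero_of_norm_lt hG2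
  set d : ℕ → ℂ := fun n => (1 - G) * S (n + 1) - S n with hd
  have hdrec : ∀ n, d n = G * d (n + 1) := by
    intro n
    have h := hrec n
    simp only [hd]
    rw [← hG] at h
    linear_combination h
  have hdpow : ∀ k n, d n = G ^ k * d (n + k) := by
    intro k
    induction k with
    | zero => simp
    | succ k ih =>
      intro n
      rw [ih, hdrec, pow_succ, ← add_assoc]
      ring
  have hbound : ∃ K : ℝ, ∀ n, ‖S n‖ ≤ K * 2 ^ n := by
    have hlt : ‖u‖ / (1 / 2 * (1 - 1 / 2)) < 1 := by
      rw [div_lt_one (by norm_num)]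
      linarith
    have hg := summable_geometric_of_lt_one (by positivity) hlt
    refine ⟨∑' m : ℕ, (‖u‖ / (1 / 2 * (1 - 1 / 2))) ^ m, fun n => ?_⟩
    rw [← tsum_mul_right]
    have := tsum_of_norm_bounded (hg.mul_right (2 ^ n)).hasSum fun m =>
      (norm_choose_mul_pow_le (u := u) (q := 1 / 2) (by norm_num) (by norm_num) m n).trans_eq
        (by norm_num)
    exact this
  obtain ⟨K, hK⟩ := hbound
  have hlim : Tendsto (fun k : ℕ => (2 * ‖G‖) ^ k * (‖1 - G‖ * (K * 2 ^ (n + 1)) + K * 2 ^ n)) atTop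
      (𝓝 (0 * (‖1 - G‖ * (K * 2 ^ (n + 1)) + K * 2 ^ n))) :=
    (tendsto_pow_atTop_nhds_zero_of_lt_one (by positivity) (by linarith)).mul_const _
  rw [zero_mul] at hlim
  have hle : ∀ k, ‖d n‖ ≤ (2 * ‖G‖) ^ k * (‖1 - G‖ * (K * 2 ^ (n + 1)) + K * 2 ^ n) := by
    intro k
    rw [hdpow k n, norm_mul, norm_pow, mul_pow]
    have h1 : ‖d (n + k)‖ ≤ ‖1 - G‖ * (K * 2 ^ (n + k + 1)) + K * 2 ^ (n + k) := by
      refine (norm_sub_le _ _).trans (add_le_add ?_ (hK _))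
      rw [norm_mul]
      exact mul_le_mul_of_nonneg_left (hK _) (norm_nonneg _)
    refine (mul_le_mul_of_nonneg_left h1 (by positivity)).trans_eq ?_
    ring
  have h0 : ‖d n‖ ≤ 0 := ge_of_tendsto' hlim hle
  exact sub_eq_zero.1 (norm_le_zero_iff.1 h0)

/-- The ballot coefficients `n / (2 m + n) C(2 m + n, m)` have the generating function
`(1 - G) ^ (-n)`. -/
theorem hasSum_ballot (hu : ‖u‖ < 1 / 4) {G : ℂ} (hG : G * (1 - G) = u) (hG2 : ‖G‖ < 1 / 2)
    {n : ℕ} (hn : n ≠ 0) :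
    HasSum (fun m : ℕ => ((2 * m + n).choose m : ℂ) / ((2 * m + n : ℕ) : ℂ) * u ^ m)
      (((1 - G)⁻¹) ^ n / n) := by
  set S : ℕ → ℂ := fun n => ∑' m : ℕ, ((2 * m + n).choose m : ℂ) * u ^ m with hS
  have hG1 := one_sub_ne_zero_of_norm_lt hG2
  -- `b n m` is the ballot coefficient, in a form that also covers `n = 0`
  set b : ℕ → ℕ → ℂ := fun n m => ((2 * m + n).choose m : ℂ)
    - if m = 0 then 0 else 2 * ((2 * m + n - 1).choose (m - 1) : ℂ) with hb
  have hbsum : ∀ n, HasSum (fun m => b n m * u ^ m) (S n - 2 * u * S (n + 1)) := by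
    intro n
    have h1 := (summable_choose_mul_pow hu n).hasSum
    have h2 := (summable_choose_mul_pow hu (n + 1)).hasSum.mul_left (2 * u)
    have h3 : HasSum (fun m => (if m = 0 then 0 else 2 * ((2 * m + n - 1).choose (m - 1) : ℂ)) * u ^ m)
        (2 * u * S (n + 1)) := by
      rw [← hasSum_nat_add_iff' 1]
      simp only [Finset.range_one, Finset.sum_singleton, if_true, zero_mul, sub_zero]
      refine h2.congr_fun fun m => ?_
      rw [if_neg (Nat.succ_ne_zero m), Nat.add_sub_cancel,
        show 2 * (m + 1) + n - 1 = 2 * m + (n + 1) by omega]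
      ring
    refine (h1.sub h3).congr_fun fun m => ?_
    simp only [hb]
    ring
  have hSpow : ∀ n, S n = S 0 * ((1 - G)⁻¹) ^ n := by
    intro n
    induction n with
    | zero => simp
    | succ n ih =>
      have h := tsum_choose_succ_eq hu hG hG2 n
      rw [pow_succ, ← mul_assoc, ← ih, eq_mul_inv_iff_mul_eq₀ hG1, mul_comm]
      exact h
  have hb0 : ∀ m, b 0 m * u ^ m = if m = 0 then 1 else 0 := by
    intro m
    simp only [hb]
    rcases m with _ | m
    · simp
    · have h : (2 * (m + 1) + 0).choose (m + 1) = 2 * (2 * m + 1).choose m := by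
        rw [show 2 * (m + 1) + 0 = 2 * m + 1 + 1 by ring, Nat.choose_succ_succ,
          ← Nat.choose_symm_half]
        ring
      rw [h, if_neg (Nat.succ_ne_zero m), if_neg (Nat.succ_ne_zero m), Nat.add_sub_cancel,
        show 2 * (m + 1) + 0 - 1 = 2 * m + 1 by omega]
      push_cast
      ring
  have hval : ∀ n, S n - 2 * u * S (n + 1) = (1 - 2 * G) * S 0 * ((1 - G)⁻¹) ^ n := by
    intro n
    rw [hSpow (n + 1), hSpow n, ← hG, pow_succ]
    field_simp
  have hone : (1 - 2 * G) * S 0 = 1 := by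
    have h1 := hbsum 0
    rw [hval, pow_zero, mul_one] at h1
    have h2 : HasSum (fun m : ℕ => b 0 m * u ^ m) 1 :=
      (hasSum_ite_eq 0 (1 : ℂ)).congr_fun hb0
    exact h1.unique h2
  have h := (hbsum n).div_const (n : ℂ)
  rw [hval, hone, one_mul] at h
  refine h.congr_fun fun m => ?_
  have hn' : (n : ℂ) ≠ 0 := by exact_mod_cast hn
  have hN : ((2 * m + n : ℕ) : ℂ) ≠ 0 := by exact_mod_cast (by omega : 2 * m + n ≠ 0)
  have hbm : b n m * ((2 * m + n : ℕ) : ℂ) = n * ((2 * m + n).choose m : ℂ) := by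
    simp only [hb]
    rcases m with _ | m
    · simp
    · rw [if_neg (Nat.succ_ne_zero m), Nat.add_sub_cancel]
      have h1 := Nat.add_one_mul_choose_eq (2 * (m + 1) + n - 1) m
      rw [Nat.sub_add_cancel (by omega)] at h1
      have h2 : ((2 * (m + 1) + n : ℕ) : ℂ) * ((2 * (m + 1) + n - 1).choose m : ℂ)
          = ((2 * (m + 1) + n).choose (m + 1) : ℂ) * (m + 1) := by exact_mod_cast h1
      have h3 : ((2 * (m + 1) + n : ℕ) : ℂ) = 2 * (m + 1) + n := by push_cast; ring
      rw [sub_mul, mul_assoc 2, mul_comm _ ((2 * (m + 1) + n : ℕ) : ℂ),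
        mul_comm ((2 * (m + 1) + n - 1).choose m : ℂ), h2, h3]
      ring
  rw [div_mul_eq_mul_div, div_eq_div_iff hN hn']
  linear_combination (-(u ^ m)) * hbm

end ChooseSeries

theorem hasSum_modelTerm_fst {u ζ G : ℂ} (hu : ‖u‖ < 1 / 4) (hG : G * (1 - G) = u)
    (hG2 : ‖G‖ < 1 / 2) (n : ℕ) :
    HasSum (fun m => modelTerm u (u * ζ) (m, n)) ((ζ * G) ^ n / n) := by
  rcases eq_or_ne n 0 with rfl | hn
  · simp [modelTerm]
  · have hG1 := one_sub_ne_zero_of_norm_lt hG2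
    have h := (hasSum_ballot hu hG hG2 hn).mul_right ((u * ζ) ^ n)
    have e : ((1 - G)⁻¹) ^ n / n * (u * ζ) ^ n = (ζ * G) ^ n / n := by
      rw [div_mul_eq_mul_div, ← mul_pow, ← hG]
      congr 2
      field_simp
    rw [e] at h
    refine h.congr_fun fun m => ?_
    simp only [modelTerm]
    rw [if_neg hn]

/-! ### The model summed over triangles -/

theorem sum_modelTerm_succ {u ζ q : ℂ} (hq : q * ζ = 1) (k : ℕ) :
    ∑ n ∈ Finset.range (k + 1 + 1), modelTerm u (u * ζ) (k + 1 - n, n)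
      = (u * ζ) ^ (k + 1) / (k + 1)
        * ∑ j ∈ Finset.range (k + 1), ((j + k).choose k : ℂ) * q ^ j := by
  rw [← Finset.sum_range_reflect, Finset.sum_range_succ, Finset.mul_sum]
  have hlast : modelTerm u (u * ζ) (k + 1 - (k + 1 + 1 - 1 - (k + 1)), k + 1 + 1 - 1 - (k + 1)) = 0 := by
    simp [modelTerm]
  rw [hlast, add_zero]
  refine Finset.sum_congr rfl fun j hj => ?_
  have hj' : j ≤ k := Nat.lt_succ_iff.1 (Finset.mem_range.1 hj)
  rw [show k + 1 + 1 - 1 - j = k + 1 - j by omega, show k + 1 - (k + 1 - j) = j by omega, modelTerm]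
  simp only
  rw [if_neg (by omega), show 2 * j + (k + 1 - j) = j + k + 1 by omega]
  have h1 := Nat.add_one_mul_choose_eq (j + k) k
  have h2 : (j + k + 1).choose j = (j + k + 1).choose (k + 1) := by
    rw [← Nat.choose_symm (show j ≤ j + k + 1 by omega)]
    congr 1
    omega
  have h3 : ((j + k + 1 : ℕ) : ℂ) * ((j + k).choose k : ℂ)
      = ((j + k + 1).choose (k + 1) : ℂ) * (k + 1) := by exact_mod_cast h1
  have h4 : ((j + k + 1 : ℕ) : ℂ) ≠ 0 := by exact_mod_cast (j + k).succ_ne_zero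
  have h5 : (k + 1 : ℂ) ≠ 0 := by exact_mod_cast k.succ_ne_zero
  have h6 : u ^ j * (u * ζ) ^ (k + 1 - j) = (u * ζ) ^ (k + 1) * q ^ j := by
    have e : (u * ζ) ^ (k + 1) = (u * ζ) ^ (k + 1 - j) * (u * ζ) ^ j := by
      rw [← pow_add]
      congr 1
      omega
    rw [e, mul_assoc, ← mul_pow, show u * ζ * q = u by linear_combination u * hq]
    ring
  rw [h2, mul_assoc, h6]
  have h7 : ((j + k + 1).choose (k + 1) : ℂ) / ((j + k + 1 : ℕ) : ℂ)
      = ((j + k).choose k : ℂ) / (k + 1) := by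
    rw [div_eq_div_iff h4 h5]
    linear_combination -h3
  rw [h7]
  ring

/-- The tail beyond the diagonal of the negative binomial series of `(1 - q) ^ (-(k + 1))`. -/
theorem norm_tsum_choose_tail_le {q : ℂ} (hq : ‖q‖ < 1 / 2) (k : ℕ) :
    ‖∑' j : ℕ, ((j + (k + 1) + k).choose k : ℂ) * q ^ (j + (k + 1))‖ ≤ (4 * ‖q‖) ^ (k + 1) := by
  have hhalf := hasSum_choose_mul_geometric_of_norm_lt_one (𝕜 := ℝ) k (r := 1 / 2)
    (by rw [Real.norm_eq_abs, abs_of_pos] <;> norm_num)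
  have hhalf2 : Summable fun j : ℕ => ((j + (k + 1) + k).choose k : ℝ) * (1 / 2) ^ (j + (k + 1)) :=
    (summable_nat_add_iff (f := fun n : ℕ => ((n + k).choose k : ℝ) * (1 / 2) ^ n) (k + 1)).2
      hhalf.summable
  have hhalf3 : ∑' j : ℕ, ((j + (k + 1) + k).choose k : ℝ) * (1 / 2) ^ (j + (k + 1)) ≤ 2 ^ (k + 1) := by
    have h := hhalf.summable.sum_add_tsum_nat_add (k + 1)
    rw [hhalf.tsum_eq] at h
    have e : (1 : ℝ) / (1 - 1 / 2) ^ (k + 1) = 2 ^ (k + 1) := by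
      rw [show (1 : ℝ) - 1 / 2 = 2⁻¹ by norm_num, inv_pow, one_div, inv_inv]
    have h0 : 0 ≤ ∑ j ∈ Finset.range (k + 1), ((j + k).choose k : ℝ) * (1 / 2) ^ j :=
      Finset.sum_nonneg fun j _ => by positivity
    linarith
  refine (tsum_of_norm_bounded (hhalf2.mul_left ((2 * ‖q‖) ^ (k + 1))).hasSum fun j => ?_).trans ?_
  · rw [norm_mul, norm_pow, RCLike.norm_natCast]
    have e : ‖q‖ ^ (j + (k + 1)) = (2 * ‖q‖) ^ (j + (k + 1)) * (1 / 2) ^ (j + (k + 1)) := by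
      rw [← mul_pow]
      congr 1
      ring
    have h1 : (2 * ‖q‖) ^ (j + (k + 1)) ≤ (2 * ‖q‖) ^ (k + 1) :=
      pow_le_pow_of_le_one (by positivity) (by linarith) (by omega)
    rw [e, ← mul_assoc, mul_comm _ ((2 * ‖q‖) ^ (j + (k + 1))), mul_assoc]
    exact mul_le_mul_of_nonneg_right h1 (by positivity)
  · rw [tsum_mul_left]
    refine (mul_le_mul_of_nonneg_left hhalf3 (by positivity)).trans_eq ?_
    rw [← mul_pow]
    congr 1
    ring

/-- The triangle sums of the model are `v ^ M / M` up to a geometrically small error: they are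
truncations of the negative binomial series of `(1 - q) ^ (-M)`. -/
theorem norm_sum_modelTerm_sub_le {u ζ q : ℂ} (hq : q * ζ = 1) (hq2 : ‖q‖ < 1 / 2) (M : ℕ) :
    ‖∑ n ∈ Finset.range (M + 1), modelTerm u (u * ζ) (M - n, n) - (u * ζ / (1 - q)) ^ M / M‖
      ≤ (4 * ‖u‖) ^ M := by
  rcases M with _ | k
  · simp [modelTerm]
  rw [sum_modelTerm_succ hq]
  have hs := hasSum_choose_mul_geometric_of_norm_lt_one k (show ‖q‖ < 1 by linarith)
  have hsum := hs.summable.sum_add_tsum_nat_add (k + 1)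
  rw [hs.tsum_eq] at hsum
  have htail_le := norm_tsum_choose_tail_le hq2 k
  generalize ∑' j : ℕ, ((j + (k + 1) + k).choose k : ℂ) * q ^ (j + (k + 1)) = tail at *
  generalize ∑ j ∈ Finset.range (k + 1), ((j + k).choose k : ℂ) * q ^ j = head at *
  have e1 : (u * ζ) ^ (k + 1) / (k + 1) * head
      - (u * ζ / (1 - q)) ^ (k + 1) / ((k + 1 : ℕ) : ℂ) = -((u * ζ) ^ (k + 1) / (k + 1) * tail) := by
    rw [div_pow, Nat.cast_succ, div_eq_mul_one_div ((u * ζ) ^ (k + 1)) ((1 - q) ^ (k + 1)), ← hsum]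
    ring
  rw [e1, norm_neg, norm_mul, norm_div, norm_pow]
  have h5 : (1 : ℝ) ≤ ‖(k + 1 : ℂ)‖ := by
    rw [← Nat.cast_succ, RCLike.norm_natCast]
    exact_mod_cast Nat.succ_le_succ (Nat.zero_le k)
  calc ‖u * ζ‖ ^ (k + 1) / ‖(k + 1 : ℂ)‖ * ‖tail‖
      ≤ ‖u * ζ‖ ^ (k + 1) * (4 * ‖q‖) ^ (k + 1) :=
        mul_le_mul (div_le_self (by positivity) h5) htail_le (norm_nonneg _) (by positivity)
    _ = (4 * (‖u‖ * ‖q * ζ‖)) ^ (k + 1) := by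
        rw [← mul_pow, norm_mul, norm_mul]
        ring
    _ = _ := by rw [hq, norm_one, mul_one]

/-! ### The logarithmic series on the unit circle -/

theorem one_sub_mem_slitPlane {v : ℂ} (hv : ‖v‖ ≤ 1) (hv1 : v ≠ 1) : 1 - v ∈ Complex.slitPlane := by
  by_contra h
  rw [Complex.mem_slitPlane_iff, not_or, not_lt, not_not, Complex.sub_re, Complex.sub_im,
    Complex.one_re, Complex.one_im] at h
  have h1 := (Complex.abs_re_le_norm v).trans hv
  have h2 := (abs_le.1 h1).2
  apply hv1
  apply Complex.ext
  · rw [Complex.one_re]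
    linarith [h.1]
  · rw [Complex.one_im]
    linarith [h.2]

theorem tendsto_log_scaled {v : ℂ} (hv : ‖v‖ ≤ 1) (hv1 : v ≠ 1) :
    Tendsto (fun σ : ℝ => -Complex.log (1 - σ * v)) (𝓝[<] 1) (𝓝 (-Complex.log (1 - v))) := by
  have hc : ContinuousAt (fun σ : ℝ => -Complex.log (1 - σ * v)) 1 := by
    have : 1 - ((1 : ℝ) : ℂ) * v ∈ Complex.slitPlane := by
      simpa using one_sub_mem_slitPlane hv hv1
    have hc' : ContinuousAt (fun σ : ℝ => 1 - (σ : ℂ) * v) 1 := by fun_prop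
    exact (hc'.clog this).neg
  have := hc.tendsto.mono_left (nhdsWithin_le_nhds (s := Set.Iio 1))
  simpa using this

/-- On the closed unit disc except at `1`, the series `∑ v ^ n / n` converges to `-log (1 - v)`. -/
theorem seriesTendsto_pow_div {v : ℂ} (hv : ‖v‖ ≤ 1) (hv1 : v ≠ 1) :
    SeriesTendsto (fun n : ℕ => v ^ n / n) (-Complex.log (1 - v)) := by
  have h1v : 0 < ‖1 - v‖ := norm_pos_iff.2 (sub_ne_zero.2 hv1.symm)
  have hcauchy : CauchySeq fun N => ∑ n ∈ Finset.range N, (1 / ((n : ℝ) + 1)) • v ^ n := by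
    refine Antitone.cauchySeq_series_mul_of_tendsto_zero_of_bounded (b := 2 / ‖1 - v‖) ?_
      tendsto_one_div_add_atTop_nhds_zero_nat ?_
    · intro i j hij
      have : (i : ℝ) ≤ j := by exact_mod_cast hij
      simp only
      gcongr
    · intro n
      rw [geom_sum_eq hv1, norm_div, norm_sub_rev v 1]
      gcongr
      refine (norm_sub_le _ _).trans ?_
      rw [norm_pow, norm_one]
      linarith [pow_le_one₀ (n := n) (norm_nonneg v) hv]
  obtain ⟨l, hl⟩ := cauchySeq_tendsto_of_complete hcauchy
  have hl2 : Tendsto (fun N => ∑ n ∈ Finset.range N, v ^ n / (n : ℂ)) atTop (𝓝 (v * l)) := by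
    rw [← tendsto_add_atTop_iff_nat 1]
    refine (hl.const_mul v).congr fun N => ?_
    rw [Finset.sum_range_succ', Finset.mul_sum]
    simp only [Nat.cast_zero, div_zero, add_zero]
    refine Finset.sum_congr rfl fun n _ => ?_
    rw [Complex.real_smul]
    push_cast
    ring
  -- Abel's theorem identifies the limit
  have habel := Complex.tendsto_tsum_powerSeries_nhdsWithin_lt hl2
  rw [tendsto_map'_iff] at habel
  have hev : ∀ᶠ σ : ℝ in 𝓝[<] 1, -Complex.log (1 - σ * v)
      = ((fun z : ℂ => ∑' n : ℕ, v ^ n / (n : ℂ) * z ^ n) ∘ Complex.ofReal) σ := by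
    have h0 : ∀ᶠ σ : ℝ in 𝓝[<] 1, 0 < σ := nhdsWithin_le_nhds (lt_mem_nhds one_pos)
    filter_upwards [h0, self_mem_nhdsWithin] with σ h0 h1
    have h2 : ‖(σ : ℂ) * v‖ < 1 := by
      rw [norm_mul, Complex.norm_real, Real.norm_of_nonneg h0.le]
      have : σ < 1 := h1
      nlinarith [norm_nonneg v]
    rw [← (Complex.hasSum_taylorSeries_neg_log h2).tsum_eq]
    refine tsum_congr fun n => ?_
    rw [mul_pow]
    ring
  have hlim := (tendsto_log_scaled hv hv1).congr' hev
  rw [tendsto_nhds_unique hlim habel]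
  exact hl2

/-! ### Both orders of summation give the same value -/

theorem norm_one_sub_ge (q : ℂ) : 1 - ‖q‖ ≤ ‖1 - q‖ := by
  have := norm_sub_norm_le (1 : ℂ) q
  rwa [norm_one] at this

/-- Equality in `1 - |q| ≤ |1 - q|` forces `q` to be a nonnegative real. -/
theorem eq_norm_of_norm_one_sub {q : ℂ} {Q : ℝ} (hq : ‖q‖ = Q) (h1 : ‖1 - q‖ = 1 - Q) :
    q = Q := by
  have h2 := Complex.sq_norm q
  have h3 := Complex.sq_norm (1 - q)
  rw [hq, Complex.normSq_apply] at h2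
  rw [h1, Complex.normSq_apply, Complex.sub_re, Complex.sub_im, Complex.one_re, Complex.one_im] at h3
  have hre : q.re = Q := by nlinarith
  have him : q.im = 0 := by
    rw [hre] at h2
    nlinarith
  apply Complex.ext
  · rw [hre, Complex.ofReal_re]
  · rw [him, Complex.ofReal_im]

theorem summable_modelTerm {u t : ℂ} {q : ℝ} (ht : ‖t‖ < q) (hu : ‖u‖ < q * (1 - q)) :
    Summable (modelTerm u t) := by
  refine Summable.of_norm_bounded (summable_chooseWeight ht hu) ?_
  rintro ⟨m, n⟩
  have h0 := chooseWeight_nonneg u t (m, n)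
  simp only [modelTerm]
  split_ifs with h
  · simpa using h0
  · have hN : (1 : ℝ) ≤ (2 * m + n : ℕ) := by exact_mod_cast (by omega : 1 ≤ 2 * m + n)
    simp only [norm_mul, norm_div, norm_pow, RCLike.norm_natCast, chooseWeight]
    gcongr
    exact div_le_self (by positivity) hN

/-- On the boundary, outside the case that `u` and `ζ` are both positive, the model summed over `m`
first and the model summed over triangles both converge, to the same value. Only one of the two
can be conditionally convergent; they are compared at `σ ζ`, `σ → 1-`, where everything converges
absolutely. -/
theorem exists_seriesTendsto_model {u ζ : ℂ} {Q : ℝ} (h0 : 0 < Q) (h1 : Q < 1 / 2)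
    (hu : ‖u‖ = (1 - Q) * Q) (hζ : ‖ζ‖ = Q⁻¹)
    (hpos : ¬ ∃ s t : ℝ, 0 < s ∧ 0 < t ∧ u = s ∧ ζ = t) :
    ∃ s, SeriesTendsto (fun n => ∑' m, modelTerm u (u * ζ) (m, n)) s ∧
      SeriesTendsto (fun M => ∑ n ∈ Finset.range (M + 1), modelTerm u (u * ζ) (M - n, n)) s := by
  have hu4 : ‖u‖ < 1 / 4 := by
    rw [hu]
    nlinarith
  obtain ⟨G, hG, hG2⟩ := exists_small_root hu4
  have hζ0 : ζ ≠ 0 := norm_pos_iff.1 (by rw [hζ]; positivity)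
  have hq : ‖ζ⁻¹‖ = Q := by rw [norm_inv, hζ, inv_inv]
  -- positivity of `ζ⁻¹` together with `u = ζ⁻¹ (1 - ζ⁻¹)` is the excluded case
  have hexcl : ∀ q : ℂ, q * (1 - q) = u → q ≠ ζ⁻¹ := by
    intro q hqu hqq
    have hnq : ‖q‖ = Q := hqq ▸ hq
    have hn : ‖1 - q‖ = 1 - Q := by
      have h := congrArg norm hqu
      rw [norm_mul, hnq, hu] at h
      exact mul_left_cancel₀ h0.ne' (h.trans (mul_comm _ _))
    have hqQ := eq_norm_of_norm_one_sub hnq hn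
    refine hpos ⟨Q * (1 - Q), Q⁻¹, mul_pos h0 (by linarith), inv_pos.2 h0, ?_, ?_⟩
    · rw [← hqu, hqQ]
      push_cast
      ring
    · rw [← inv_inv ζ, ← hqq, hqQ]
      push_cast
      ring
  -- the base `w` of the series over `n`
  have hGQ : ‖G‖ ≤ Q := by
    have h := congrArg norm hG
    rw [norm_mul, hu] at h
    have h2 := norm_one_sub_ge G
    by_contra hlt
    rw [not_le] at hlt
    nlinarith [norm_nonneg G]
  have hw : ‖ζ * G‖ ≤ 1 := by
    rw [norm_mul, hζ, inv_mul_le_iff₀ h0, mul_one]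
    exact hGQ
  have hw1 : ζ * G ≠ 1 := fun h => hexcl G hG (eq_inv_of_mul_eq_one_right h)
  -- the base `v` of the series over triangles
  have h1q : ∀ σ : ℂ, ‖σ‖ ≤ 1 → 2 * Q < ‖σ‖ → 1 - (σ * ζ)⁻¹ ≠ 0 := by
    intro σ h2 h3 h
    have h4 : ‖(σ * ζ)⁻¹‖ = 1 := by rw [← sub_eq_zero.1 h, norm_one]
    rw [norm_inv, norm_mul, hζ, mul_inv, inv_inv, inv_mul_eq_div, div_eq_one_iff_eq
      (by linarith [norm_nonneg σ])] at h4
    linarith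
  have hvle : ∀ σ : ℝ, 2 * Q < σ → σ ≤ 1 → ‖u * (σ * ζ) / (1 - (σ * ζ)⁻¹)‖ ≤ 1 ∧
      (σ < 1 → ‖u * (σ * ζ) / (1 - (σ * ζ)⁻¹)‖ < 1) := by
    intro σ h2 h3
    have hσ0 : 0 < σ := by linarith
    have hσn : ‖(σ : ℂ)‖ = σ := by rw [Complex.norm_real, Real.norm_of_nonneg hσ0.le]
    have hne := h1q σ (by rw [hσn]; exact h3) (by rw [hσn]; exact h2)
    have hge := norm_one_sub_ge ((σ : ℂ) * ζ)⁻¹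
    have hn : ‖((σ : ℂ) * ζ)⁻¹‖ = Q / σ := by
      rw [norm_inv, norm_mul, hσn, hζ, mul_inv, inv_inv, inv_mul_eq_div]
    rw [hn] at hge
    have hnum : ‖u * (σ * ζ)‖ = σ * (1 - Q) := by
      rw [norm_mul, norm_mul, hσn, hu, hζ]
      field_simp
    have hkey : σ * (1 - Q) = (1 - Q / σ) + (σ - 1) * (σ - Q * σ - Q) / σ := by
      field_simp
      ring
    have hpos2 : 0 < σ - Q * σ - Q := by nlinarith
    rw [norm_div, hnum, div_le_one (norm_pos_iff.2 hne), div_lt_one (norm_pos_iff.2 hne)]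
    constructor
    · have : (σ - 1) * (σ - Q * σ - Q) / σ ≤ 0 :=
        div_nonpos_of_nonpos_of_nonneg (mul_nonpos_of_nonpos_of_nonneg (by linarith) hpos2.le) hσ0.le
      linarith
    · intro h4
      have : (σ - 1) * (σ - Q * σ - Q) / σ < 0 :=
        div_neg_of_neg_of_pos (mul_neg_of_neg_of_pos (by linarith) hpos2) hσ0
      linarith
  set V : ℝ → ℂ := fun σ => u * (σ * ζ) / (1 - (σ * ζ)⁻¹) with hV
  set A : ℝ → ℕ → ℂ := fun σ M =>
    ∑ n ∈ Finset.range (M + 1), modelTerm u (u * (σ * ζ)) (M - n, n) with hA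
  have hV1 : V 1 = u * ζ / (1 - ζ⁻¹) := by simp [hV]
  have hne1 : 1 - ζ⁻¹ ≠ 0 := by
    have := h1q 1 (by simp) (by rw [norm_one]; linarith)
    rwa [one_mul] at this
  have hv : ‖V 1‖ ≤ 1 := (hvle 1 (by linarith) le_rfl).1
  have hv1 : V 1 ≠ 1 := by
    rw [hV1, Ne, div_eq_one_iff_eq hne1]
    intro h
    refine hexcl ζ⁻¹ ?_ rfl
    rw [← h]
    field_simp
  have hVc : ContinuousAt V 1 := by
    have hz1 : ((1 : ℝ) : ℂ) * ζ ≠ 0 := by simpa using hζ0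
    have hz2 : 1 - (((1 : ℝ) : ℂ) * ζ)⁻¹ ≠ 0 := by simpa using hne1
    have hc : ContinuousAt (fun σ : ℝ => (σ : ℂ) * ζ) 1 := by fun_prop
    exact (continuousAt_const.mul hc).div (continuousAt_const.sub (hc.inv₀ hz1)) hz2
  -- errors of the triangle sums, uniformly in `σ`
  have hqσ : ∀ σ : ℝ, 2 * Q < σ → σ ≤ 1 → ‖((σ : ℂ) * ζ)⁻¹‖ < 1 / 2 := by
    intro σ h2 h3
    have hσ0 : 0 < σ := by linarith
    rw [norm_inv, norm_mul, Complex.norm_real, Real.norm_of_nonneg hσ0.le, hζ, mul_inv, inv_inv,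
      inv_mul_eq_div, div_lt_iff₀ hσ0]
    linarith
  have herr : ∀ σ : ℝ, 2 * Q < σ → σ ≤ 1 → ∀ M, ‖A σ M - V σ ^ M / M‖ ≤ (4 * ‖u‖) ^ M := by
    intro σ h2 h3 M
    have hσ0 : (σ : ℂ) ≠ 0 := by exact_mod_cast (by linarith : σ ≠ 0)
    exact norm_sum_modelTerm_sub_le (inv_mul_cancel₀ (mul_ne_zero hσ0 hζ0)) (hqσ σ h2 h3) M
  have hgeo : Summable fun M : ℕ => (4 * ‖u‖) ^ M :=
    summable_geometric_of_lt_one (by positivity) (by linarith)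
  have herrlim : Tendsto (fun σ : ℝ => ∑' M : ℕ, (A σ M - V σ ^ M / M)) (𝓝[<] 1)
      (𝓝 (∑' M : ℕ, (A 1 M - V 1 ^ M / M))) := by
    refine tendsto_tsum_of_dominated_convergence hgeo (fun M => ?_) ?_
    · have hAc : ContinuousAt (fun σ => A σ M) 1 := by
        simp only [hA]
        refine tendsto_finsetSum _ fun n _ => ?_
        simp only [modelTerm]
        split_ifs
        · exact tendsto_const_nhds
        · have hc : ContinuousAt (fun σ : ℝ => (u * ((σ : ℂ) * ζ)) ^ n) 1 := by fun_prop
          exact (continuousAt_const.mul hc)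
      exact ((hAc.sub ((hVc.pow M).div_const _)).tendsto.mono_left nhdsWithin_le_nhds)
    · have hQev : ∀ᶠ σ : ℝ in 𝓝[<] 1, 2 * Q < σ :=
        nhdsWithin_le_nhds (lt_mem_nhds (by linarith))
      filter_upwards [hQev, self_mem_nhdsWithin] with σ h2 h3
      exact herr σ h2 (le_of_lt h3)
  -- equality of the two orders for `σ < 1`
  have heq : ∀ᶠ σ : ℝ in 𝓝[<] 1, -Complex.log (1 - σ * (ζ * G))
      = -Complex.log (1 - V σ) + ∑' M : ℕ, (A σ M - V σ ^ M / M) := by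
    have hQev : ∀ᶠ σ : ℝ in 𝓝[<] 1, 2 * Q < σ :=
      nhdsWithin_le_nhds (lt_mem_nhds (by linarith))
    filter_upwards [hQev, self_mem_nhdsWithin] with σ h2 h3
    have h3 : σ < 1 := h3
    have hσ0 : 0 < σ := by linarith
    have hσn : ‖(σ : ℂ)‖ = σ := by rw [Complex.norm_real, Real.norm_of_nonneg hσ0.le]
    have hsum : Summable (modelTerm u (u * (σ * ζ))) := by
      have ht : ‖u * (σ * ζ)‖ = σ * (1 - Q) := by
        rw [norm_mul, norm_mul, hσn, hu, hζ]
        field_simp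
      -- any `q` strictly between `max (σ (1 - Q), 1 / 2)` and `1 - Q` will do
      obtain ⟨q, hq1, hq2⟩ := exists_between
        (show max (σ * (1 - Q)) (1 / 2) < 1 - Q from max_lt (by nlinarith) (by linarith))
      refine summable_modelTerm (q := q) ?_ ?_
      · rw [ht]
        exact (le_max_left _ _).trans_lt hq1
      · have := (le_max_right _ _).trans_lt hq1
        rw [hu]
        nlinarith
    have hA1 := hasSum_triangle hsum
    have hn := ((Equiv.prodComm ℕ ℕ).hasSum_iff.2 hsum.hasSum).prod_fiberwise
      fun n => hasSum_modelTerm_fst (ζ := σ * ζ) hu4 hG hG2 n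
    have hw' : ‖(σ : ℂ) * ζ * G‖ < 1 := by
      rw [mul_assoc, norm_mul, hσn]
      nlinarith [norm_nonneg (ζ * G)]
    have hlog := Complex.hasSum_taylorSeries_neg_log hw'
    have hlogV := Complex.hasSum_taylorSeries_neg_log ((hvle σ h2 h3.le).2 h3)
    have hdiff := hA1.sub hlogV
    rw [hdiff.tsum_eq, ← mul_assoc (σ : ℂ) ζ G, ← hn.unique hlog]
    simp only [hV]
    ring
  have hlim1 := tendsto_log_scaled hw hw1
  have hlimV : Tendsto (fun σ : ℝ => -Complex.log (1 - V σ)) (𝓝[<] 1) (𝓝 (-Complex.log (1 - V 1))) :=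
    (((continuousAt_const.sub hVc).clog (one_sub_mem_slitPlane hv hv1)).neg).tendsto.mono_left
      nhdsWithin_le_nhds
  have hval := tendsto_nhds_unique hlim1 ((hlimV.add herrlim).congr' (heq.mono fun _ h => h.symm))
  refine ⟨-Complex.log (1 - ζ * G), ?_, ?_⟩
  · have h := seriesTendsto_pow_div hw hw1
    refine h.congr fun N => Finset.sum_congr rfl fun n _ => ?_
    exact (hasSum_modelTerm_fst hu4 hG hG2 n).tsum_eq.symm
  · rw [hval]
    have hsE : Summable fun M : ℕ => A 1 M - V 1 ^ M / M :=
      Summable.of_norm_bounded hgeo (herr 1 (by linarith) le_rfl)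
    have h := (seriesTendsto_pow_div hv hv1).add hsE.hasSum.tendsto_sum_nat
    refine h.congr fun N => ?_
    rw [← Finset.sum_add_distrib]
    refine Finset.sum_congr rfl fun M _ => ?_
    simp [hA]

/-! ### The boundary of the domain of absolute convergence -/

/-- On the boundary, the series of functions `H₁₀` and every series over triangles whose terms are
those of `X'`, combined with an absolutely convergent triple series, converge accordingly. -/
theorem exists_seriesTendsto_XpH10Term {a : ℝ} (ha : IsHalf a) {ζ₁ ζ₂ : ℂ} (ζ₃ : ℂ) {Q : ℝ}
    (h0 : 0 < Q) (h1 : Q < 1 / 2) (hζ₁ : ‖ζ₁‖ = (1 - Q) * Q) (hζ₂ : ‖ζ₂‖ = Q⁻¹)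
    (hpos : ¬ ∃ s t : ℝ, 0 < s ∧ 0 < t ∧ ζ₁ = s ∧ ζ₂ = t) :
    ∃ s, SeriesTendsto (XpH10Term a (a + 1) ζ₁ ζ₂ ζ₃) s ∧
      ∀ (T : ℕ → ℕ → ℂ) (α β : ℂ) (g : ℕ × ℕ × ℕ → ℂ), Summable g →
        (∀ m n, T (m + n) n = α * ∑' p, triTerm a ζ₁ (ζ₁ * ζ₂) ζ₃ (m, n, p) + β * ∑' p, g (m, n, p)) →
        SeriesTendsto (fun M => ∑ n ∈ Finset.range (M + 1), T M n) (α * s + β * ∑' q, g q) := by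
  have ht : ‖ζ₁ * ζ₂‖ = 1 - Q := by
    rw [norm_mul, hζ₁, hζ₂]
    field_simp
  obtain ⟨κ, he⟩ := exists_summable_triTerm_sub ha ζ₃ h0 h1 hζ₁ ht
  obtain ⟨s, hs1, hs2⟩ := exists_seriesTendsto_model h0 h1 hζ₁ hζ₂ hpos
  have hu4 : ‖ζ₁‖ < 1 / 4 := by
    rw [hζ₁]
    nlinarith
  obtain ⟨G, hG, hG2⟩ := exists_small_root hu4
  set e : ℕ × ℕ × ℕ → ℂ := fun q => triTerm a ζ₁ (ζ₁ * ζ₂) ζ₃ q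
    - if q.2.2 = 0 then κ * modelTerm ζ₁ (ζ₁ * ζ₂) (q.1, q.2.1) else 0 with hedef
  refine ⟨∑' x, e x + κ * s, ?_, fun T α β g hg hT => ?_⟩
  · have hrow : ∀ n, XpH10Term a (a + 1) ζ₁ ζ₂ ζ₃ n
        = ∑' q : ℕ × ℕ, e (q.1, n, q.2) + κ * ∑' m, modelTerm ζ₁ (ζ₁ * ζ₂) (m, n) := by
      intro n
      have h2 : HasSum (fun q : ℕ × ℕ => e (q.1, n, q.2)) (∑' q : ℕ × ℕ, e (q.1, n, q.2)) :=
        (he.comp_injective (rotate_injective.comp (slice_injective n))).hasSum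
      have h3 := ((hasSum_modelTerm_fst (ζ := ζ₂) hu4 hG hG2 n).summable.hasSum).mul_left κ
      have hinj : Function.Injective fun m : ℕ => ((m, 0) : ℕ × ℕ) := fun x y h => by
        simpa using h
      have h4 : HasSum (fun q : ℕ × ℕ =>
          if q.2 = 0 then κ * modelTerm ζ₁ (ζ₁ * ζ₂) (q.1, n) else 0)
          (κ * ∑' m, modelTerm ζ₁ (ζ₁ * ζ₂) (m, n)) := by
        rw [← hinj.hasSum_iff]
        · exact h3.congr_fun fun m => by simp
        · rintro ⟨m, p⟩ hp
          refine if_neg fun h => hp ⟨m, ?_⟩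
          simp only at h
          rw [h]
      rw [XpH10Term_eq_tsum ha, ← (h2.add h4).tsum_eq]
      refine tsum_congr fun q => ?_
      simp only [hedef, sub_add_cancel]
    have h5 := ((Equiv.ofBijective _ ⟨rotate_injective, fun x => ⟨(x.2.1, x.1, x.2.2), rfl⟩⟩).hasSum_iff.2
      he.hasSum).prod_fiberwise fun n =>
        (he.comp_injective (rotate_injective.comp (slice_injective n))).hasSum
    refine (h5.tendsto_sum_nat.add (hs1.const_mul κ)).congr fun N => ?_
    rw [Finset.mul_sum, ← Finset.sum_add_distrib]
    exact Finset.sum_congr rfl fun n _ => (hrow n).symm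
  · refine seriesTendsto_of_split (h := fun q => κ * modelTerm ζ₁ (ζ₁ * ζ₂) q) hT (fun m n p => ?_)
      he hg ?_
    · simp only [hedef, sub_add_cancel]
    · refine (hs2.const_mul κ).congr fun N => ?_
      simp only [Finset.mul_sum]

/-! ### The three conditions in terms of `ζ₁`, `ζ₂` -/

section Conditions

variable {x y z : ℂ}

theorem norm_zeta_one (x z : ℂ) : ‖x / z ^ 2‖ = ‖x‖ / ‖z‖ ^ 2 := by
  rw [norm_div, norm_pow]

theorem norm_zeta_one_mul_two (x y : ℂ) (hz : z ≠ 0) :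
    ‖x / z ^ 2 * (y * z / 2)‖ = ‖x * y‖ / (2 * ‖z‖) := by
  have hz' : ‖z‖ ≠ 0 := norm_ne_zero_iff.2 hz
  rw [norm_mul, norm_zeta_one, norm_div, norm_mul, norm_mul, RCLike.norm_ofNat]
  field_simp

theorem sqrt_norm_sq_sub (x : ℂ) (hz : z ≠ 0) :
    √(‖z‖ ^ 2 - 4 * ‖x‖) = ‖z‖ * √(1 - 4 * ‖x / z ^ 2‖) := by
  have hz' : 0 < ‖z‖ := norm_pos_iff.2 hz
  have e : ‖z‖ ^ 2 - 4 * ‖x‖ = ‖z‖ ^ 2 * (1 - 4 * ‖x / z ^ 2‖) := by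
    rw [norm_zeta_one]
    field_simp
  rw [e, Real.sqrt_mul (sq_nonneg _), Real.sqrt_sq hz'.le]

theorem CondI.bounds (hz : z ≠ 0) (h : CondI x y z) :
    4 * ‖x / z ^ 2‖ ≤ 1 ∧ ‖y * z / 2‖ < 2 := by
  have hz' : 0 < ‖z‖ := norm_pos_iff.2 hz
  refine ⟨?_, ?_⟩
  · rw [norm_zeta_one, ← mul_div_assoc, div_le_one (by positivity)]
    exact h.1
  · rw [norm_div, RCLike.norm_ofNat]
    linarith [h.2]

theorem CondII.norm_lt (hz : z ≠ 0) (h : CondII x y z) : ‖x / z ^ 2‖ < 1 / 4 := by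
  have hz' : 0 < ‖z‖ := norm_pos_iff.2 hz
  rw [norm_zeta_one, div_lt_div_iff₀ (by positivity) (by norm_num)]
  linarith [h.1]

/-- With `s = √(1 - 4 |ζ₁|)`, any `q` between `max (|ζ₁ ζ₂|, 1 / 2)` and `(1 + s) / 2` serves. -/
theorem CondII.exists_radius (hz : z ≠ 0) (h : CondII x y z)
    (hlt : ‖x * y‖ < ‖z‖ + √(‖z‖ ^ 2 - 4 * ‖x‖)) :
    ∃ q : ℝ, ‖x / z ^ 2 * (y * z / 2)‖ < q ∧ ‖x / z ^ 2‖ < q * (1 - q) := by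
  have hz' : 0 < ‖z‖ := norm_pos_iff.2 hz
  have hr := h.norm_lt hz
  rw [sqrt_norm_sq_sub x hz] at hlt
  rw [norm_zeta_one_mul_two x y hz]
  set r := ‖x / z ^ 2‖
  have hs := Real.sqrt_pos.2 (show 0 < 1 - 4 * r by linarith)
  have hs2 := Real.sq_sqrt (show 0 ≤ 1 - 4 * r by linarith)
  set s := √(1 - 4 * r)
  have ht : ‖x * y‖ / (2 * ‖z‖) < (1 + s) / 2 := by
    rw [div_lt_div_iff₀ (by positivity) (by norm_num)]
    linarith
  obtain ⟨q, hq1, hq2⟩ := exists_between (max_lt ht (show (1 : ℝ) / 2 < (1 + s) / 2 by linarith))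
  refine ⟨q, (le_max_left _ _).trans_lt hq1, ?_⟩
  have := (le_max_right _ _).trans_lt hq1
  nlinarith

theorem CondII.exists_boundary (hz : z ≠ 0) (h : CondII x y z)
    (heq : ‖x * y‖ = ‖z‖ + √(‖z‖ ^ 2 - 4 * ‖x‖)) :
    ∃ Q : ℝ, 0 < Q ∧ Q < 1 / 2 ∧ ‖x / z ^ 2‖ = (1 - Q) * Q ∧ ‖y * z / 2‖ = Q⁻¹ := by
  have hz' : 0 < ‖z‖ := norm_pos_iff.2 hz
  have hr := h.norm_lt hz
  rw [sqrt_norm_sq_sub x hz] at heq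
  have ht := norm_zeta_one_mul_two x y hz
  rw [heq, norm_mul] at ht
  have hx : 0 < ‖x / z ^ 2‖ := by
    rw [norm_pos_iff]
    refine div_ne_zero (fun hx => ?_) (pow_ne_zero _ hz)
    rw [hx, zero_mul, norm_zero] at heq
    have : 0 ≤ ‖z‖ * √(1 - 4 * ‖(0 : ℂ) / z ^ 2‖) := by positivity
    linarith
  set r := ‖x / z ^ 2‖
  have hs := Real.sqrt_pos.2 (show 0 < 1 - 4 * r by linarith)
  have hs2 := Real.sq_sqrt (show 0 ≤ 1 - 4 * r by linarith)
  set s := √(1 - 4 * r)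
  have hs1 : s < 1 := by nlinarith
  have hQ : 0 < (1 - s) / 2 := by linarith
  have hrQ : r = (1 - (1 - s) / 2) * ((1 - s) / 2) := by linarith
  refine ⟨(1 - s) / 2, hQ, by linarith, hrQ, ?_⟩
  refine eq_inv_of_mul_eq_one_left ?_
  have e : (‖z‖ + ‖z‖ * s) / (2 * ‖z‖) = 1 - (1 - s) / 2 := by
    field_simp
    ring
  rw [e] at ht
  have h1 : 1 - (1 - s) / 2 ≠ 0 := by linarith
  apply mul_left_cancel₀ h1
  linear_combination ht - ‖y * z / 2‖ * hrQ

theorem CondIII.exists_radius (hz : z ≠ 0) (h : CondIII x y z) :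
    ∃ q : ℝ, ‖x / z ^ 2 * (y * z / 2)‖ < q ∧ ‖x / z ^ 2‖ < q * (1 - q) := by
  have hz' : 0 < ‖z‖ := norm_pos_iff.2 hz
  obtain ⟨R, S, hRS, hx, hxy⟩ := h
  refine ⟨S, ?_, ?_⟩
  · rw [norm_zeta_one_mul_two x y hz, div_lt_iff₀ (by positivity)]
    linarith
  · rw [norm_zeta_one, div_lt_iff₀ (by positivity), show S * (1 - S) = R by linarith]
    exact hx

end Conditions

theorem isHalf_half : IsHalf (1 / 2) := Or.inl rfl

theorem isHalf_neg_half : IsHalf (-1 / 2) := Or.inr rfl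

theorem ofReal_half : ((1 / 2 : ℝ) : ℂ) = 1 / 2 := by norm_num

theorem ofReal_neg_half : ((-1 / 2 : ℝ) : ℂ) = -1 / 2 := by norm_num

theorem half_add_one : (1 / 2 : ℂ) + 1 = 3 / 2 := by norm_num

theorem neg_half_add_one : (-1 / 2 : ℂ) + 1 = 1 / 2 := by norm_num

theorem macdonaldTerm1_split (x y : ℂ) {z : ℂ} (hz : z ≠ 0) (m n : ℕ) :
    macdonaldTerm1 x y z (m + n) n
      = (√Real.pi : ℝ) / (2 * z) ^ (1 / 2 : ℂ) * ∑' p, triTerm (1 / 2) (x / z ^ 2)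
            (x / z ^ 2 * (y * z / 2)) (-(z ^ 2 / 4)) (m, n, p)
        + -(Real.pi * z / 2) ^ (1 / 2 : ℂ)
          * ∑' p, XTerm (3 / 2) (3 / 2) (x * z ^ 2 / 16) (-(x * y * z / 8)) (z ^ 2 / 4) (m, n, p) := by
  have h := macdonaldTerm1_eq x y hz m n
  have e := fun p => XpTerm_add (1 / 2) (x / z ^ 2) (y * z / 2) (-(z ^ 2 / 4)) m n p
  rw [ofReal_half, half_add_one] at e
  simp only [e] at h
  rw [h]
  ring

theorem macdonaldTerm2_split (x y : ℂ) {z : ℂ} (hz : z ≠ 0) (m n : ℕ) :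
    macdonaldTerm2 x y z (m + n) n
      = -(Real.pi * z / 2) ^ (1 / 2 : ℂ) * ∑' p, triTerm (-1 / 2) (x / z ^ 2)
            (x / z ^ 2 * (y * z / 2)) (-(z ^ 2 / 4)) (m, n, p)
        + (√Real.pi : ℝ) / (2 * z) ^ (1 / 2 : ℂ)
          * ∑' p, XTerm (1 / 2) (1 / 2) (x * z ^ 2 / 16) (-(x * y * z / 8)) (z ^ 2 / 4) (m, n, p) := by
  have h := macdonaldTerm2_eq x y hz m n
  have e := fun p => XpTerm_add (-1 / 2) (x / z ^ 2) (y * z / 2) (-(z ^ 2 / 4)) m n p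
  rw [ofReal_neg_half, neg_half_add_one] at e
  simp only [e] at h
  rw [h]
  ring

theorem mainTheorem3 (x y z : ℂ) (hz : z ≠ 0) :
    -- the square roots `√(π / (2 z))` and `√(π z / 2)`
    let c₁ : ℂ := (√Real.pi : ℝ) / (2 * z) ^ (1 / 2 : ℂ)
    let c₂ : ℂ := (Real.pi * z / 2) ^ (1 / 2 : ℂ)
    -- the arguments of `X`
    let ξ₁ : ℂ := x * z ^ 2 / 16
    let ξ₂ : ℂ := -(x * y * z / 8)
    let ξ₃ : ℂ := z ^ 2 / 4
    -- the arguments of `X′`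
    let ζ₁ : ℂ := x / z ^ 2
    let ζ₂ : ℂ := y * z / 2
    let ζ₃ : ℂ := -(z ^ 2 / 4)
    -- the evaluation of both double series, everything being absolutely convergent
    let evaluation : Prop :=
      Summable (XpTerm (1 / 2) (3 / 2) ζ₁ ζ₂ ζ₃) ∧
      Summable (XpTerm (-1 / 2) (1 / 2) ζ₁ ζ₂ ζ₃) ∧
      TriangleSummable (macdonaldTerm1 x y z) ∧
      TriangleSummable (macdonaldTerm2 x y z) ∧
      HasSum (fun m : ℕ => ∑ n ∈ Finset.range (m + 1), macdonaldTerm1 x y z m n)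
        (c₁ * XpSeries (1 / 2) (3 / 2) ζ₁ ζ₂ ζ₃ - c₂ * XSeries (3 / 2) (3 / 2) ξ₁ ξ₂ ξ₃) ∧
      HasSum (fun m : ℕ => ∑ n ∈ Finset.range (m + 1), macdonaldTerm2 x y z m n)
        (c₁ * XSeries (1 / 2) (1 / 2) ξ₁ ξ₂ ξ₃ - c₂ * XpSeries (-1 / 2) (1 / 2) ζ₁ ζ₂ ζ₃)
    -- the representations of `X`
    XRepresentations (3 / 2) (3 / 2) ξ₁ ξ₂ ξ₃ ∧
    XRepresentations (1 / 2) (1 / 2) ξ₁ ξ₂ ξ₃ ∧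
    -- condition (i)
    (CondI x y z →
      evaluation ∧
      (∀ n : ℕ, Summable (humbertXi2Term 1 (-n) (1 - 1 / 2 - 2 * n) ζ₂ (-ζ₃))) ∧
      (∀ n : ℕ, Summable (humbertXi2Term 1 (-n) (1 - (-1 / 2) - 2 * n) ζ₂ (-ζ₃))) ∧
      HasSum (XpXi2Term (1 / 2) (3 / 2) ζ₁ ζ₂ ζ₃) (XpSeries (1 / 2) (3 / 2) ζ₁ ζ₂ ζ₃) ∧
      HasSum (XpXi2Term (-1 / 2) (1 / 2) ζ₁ ζ₂ ζ₃) (XpSeries (-1 / 2) (1 / 2) ζ₁ ζ₂ ζ₃)) ∧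
    -- condition (ii): `X′` is the sum of its series of functions `H₁₀`
    (CondII x y z →
      (∀ n : ℕ, Summable (hornH10Term (1 / 2 + n) (3 / 2 + n) ζ₁ ζ₃)) ∧
      (∀ n : ℕ, Summable (hornH10Term (-1 / 2 + n) (1 / 2 + n) ζ₁ ζ₃)) ∧
      (∃ s₁ s₂ : ℂ,
        SeriesTendsto (XpH10Term (1 / 2) (3 / 2) ζ₁ ζ₂ ζ₃) s₁ ∧
        SeriesTendsto (XpH10Term (-1 / 2) (1 / 2) ζ₁ ζ₂ ζ₃) s₂ ∧
        SeriesTendsto (fun m : ℕ => ∑ n ∈ Finset.range (m + 1), macdonaldTerm1 x y z m n)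
          (c₁ * s₁ - c₂ * XSeries (3 / 2) (3 / 2) ξ₁ ξ₂ ξ₃) ∧
        SeriesTendsto (fun m : ℕ => ∑ n ∈ Finset.range (m + 1), macdonaldTerm2 x y z m n)
          (c₁ * XSeries (1 / 2) (1 / 2) ξ₁ ξ₂ ξ₃ - c₂ * s₂)) ∧
      -- off the boundary the convergence is absolute
      (‖x * y‖ < ‖z‖ + √(‖z‖ ^ 2 - 4 * ‖x‖) →
        evaluation ∧
        HasSum (XpH10Term (1 / 2) (3 / 2) ζ₁ ζ₂ ζ₃) (XpSeries (1 / 2) (3 / 2) ζ₁ ζ₂ ζ₃) ∧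
        HasSum (XpH10Term (-1 / 2) (1 / 2) ζ₁ ζ₂ ζ₃) (XpSeries (-1 / 2) (1 / 2) ζ₁ ζ₂ ζ₃))) ∧
    -- condition (iii)
    (CondIII x y z →
      evaluation ∧
      (∀ n : ℕ, Summable (hornH3Term (1 / 2 - n) 1 (3 / 2) ζ₁ (ζ₁ * ζ₂))) ∧
      (∀ n : ℕ, Summable (hornH3Term (-1 / 2 - n) 1 (1 / 2) ζ₁ (ζ₁ * ζ₂))) ∧
      HasSum (XpH3Term (1 / 2) (3 / 2) ζ₁ ζ₂ ζ₃) (XpSeries (1 / 2) (3 / 2) ζ₁ ζ₂ ζ₃) ∧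
      HasSum (XpH3Term (-1 / 2) (1 / 2) ζ₁ ζ₂ ζ₃) (XpSeries (-1 / 2) (1 / 2) ζ₁ ζ₂ ζ₃)) := by
  intro c₁ c₂ ξ₁ ξ₂ ξ₃ ζ₁ ζ₂ ζ₃ evaluation
  have hX1 : XRepresentations (3 / 2) (3 / 2) ξ₁ ξ₂ ξ₃ := by
    have := XRepresentations_of_half_le (a := 3 / 2) (b := 3 / 2) (by norm_num) (by norm_num) ξ₁ ξ₂ ξ₃
    rwa [show ((3 / 2 : ℝ) : ℂ) = 3 / 2 by norm_num] at this
  have hX2 : XRepresentations (1 / 2) (1 / 2) ξ₁ ξ₂ ξ₃ := by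
    have := XRepresentations_of_half_le (a := 1 / 2) (b := 1 / 2) le_rfl le_rfl ξ₁ ξ₂ ξ₃
    rwa [ofReal_half] at this
  have hT1 := macdonaldTerm1_split x y hz
  have hT2 := macdonaldTerm2_split x y hz
  have heval : Summable (fun q : ℕ × ℕ => chooseWeight ζ₁ (ζ₁ * ζ₂) q / ((2 * q.1 + q.2 : ℕ) + 1 : ℝ)) →
      evaluation := by
    intro h
    have h1 := summable_triTerm isHalf_half ζ₃ h
    have h2 := summable_triTerm isHalf_neg_half ζ₃ h
    have s1 := (summable_XpTerm_iff (1 / 2) ζ₁ ζ₂ ζ₃).2 h1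
    have s2 := (summable_XpTerm_iff (-1 / 2) ζ₁ ζ₂ ζ₃).2 h2
    have t1 := XpSeries_eq_tsum_triTerm (1 / 2) ζ₁ ζ₂ ζ₃
    have t2 := XpSeries_eq_tsum_triTerm (-1 / 2) ζ₁ ζ₂ ζ₃
    rw [ofReal_half, half_add_one] at s1 t1
    rw [ofReal_neg_half, neg_half_add_one] at s2 t2
    refine ⟨s1, s2, triangleSummable_of_split hT1 h1 hX1.1, triangleSummable_of_split hT2 h2 hX2.1,
      ?_, ?_⟩
    · rw [t1, sub_eq_add_neg, ← neg_mul]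
      exact hasSum_of_split hT1 h1 hX1.1
    · rw [t2, sub_eq_add_neg, ← neg_mul, add_comm]
      exact hasSum_of_split hT2 h2 hX2.1
  refine ⟨hX1, hX2, fun hI => ?_, fun hII => ?_, fun hIII => ?_⟩
  · obtain ⟨b1, b2⟩ := hI.bounds hz
    have ev := heval (summable_chooseWeight_div_of_le b1 b2)
    have s1 := ev.1
    have s2 := ev.2.1
    have r1 := fun n => summable_humbertXi2Term isHalf_half ζ₂ ζ₃ n
    have r2 := fun n => summable_humbertXi2Term isHalf_neg_half ζ₂ ζ₃ n
    have q1 := hasSum_XpXi2Term isHalf_half (ζ₁ := ζ₁) (ζ₂ := ζ₂) (ζ₃ := ζ₃)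
    have q2 := hasSum_XpXi2Term isHalf_neg_half (ζ₁ := ζ₁) (ζ₂ := ζ₂) (ζ₃ := ζ₃)
    rw [ofReal_half] at r1 q1
    rw [ofReal_neg_half] at r2 q2
    rw [half_add_one] at q1
    rw [neg_half_add_one] at q2
    exact ⟨ev, r1, r2, q1 s1, q2 s2⟩
  · have b := hII.norm_lt hz
    have r1 := fun n => summable_hornH10Term isHalf_half b ζ₃ n
    have r2 := fun n => summable_hornH10Term isHalf_neg_half b ζ₃ n
    have q1 := hasSum_XpH10Term isHalf_half (ζ₁ := ζ₁) (ζ₂ := ζ₂) (ζ₃ := ζ₃)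
    have q2 := hasSum_XpH10Term isHalf_neg_half (ζ₁ := ζ₁) (ζ₂ := ζ₂) (ζ₃ := ζ₃)
    rw [ofReal_half, half_add_one] at r1 q1
    rw [ofReal_neg_half, neg_half_add_one] at r2 q2
    have hstrict : ‖x * y‖ < ‖z‖ + √(‖z‖ ^ 2 - 4 * ‖x‖) → evaluation := by
      intro hlt
      obtain ⟨q, hq1, hq2⟩ := hII.exists_radius hz hlt
      exact heval (summable_chooseWeight_div hq1 hq2)
    refine ⟨r1, r2, ?_, fun hlt => ⟨hstrict hlt, q1 (hstrict hlt).1, q2 (hstrict hlt).2.1⟩⟩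
    rcases hII.2.1.lt_or_eq with hlt | heq
    · obtain ⟨s1, s2, -, -, e1, e2⟩ := hstrict hlt
      exact ⟨_, _, (q1 s1).tendsto_sum_nat, (q2 s2).tendsto_sum_nat, e1.tendsto_sum_nat,
        e2.tendsto_sum_nat⟩
    · obtain ⟨Q, hQ0, hQ1, hn1, hn2⟩ := hII.exists_boundary hz heq
      have hpos : ¬ ∃ s t : ℝ, 0 < s ∧ 0 < t ∧ ζ₁ = s ∧ ζ₂ = t := by
        rintro ⟨s, t, hs, ht, e1, e2⟩
        refine hII.2.2 heq ⟨s, 2 * t, hs, by linarith, e1, ?_⟩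
        push_cast
        rw [← e2]
        simp only [ζ₂]
        ring
      obtain ⟨s₁, k1, k2⟩ := exists_seriesTendsto_XpH10Term isHalf_half ζ₃ hQ0 hQ1 hn1 hn2 hpos
      obtain ⟨s₂, l1, l2⟩ := exists_seriesTendsto_XpH10Term isHalf_neg_half ζ₃ hQ0 hQ1 hn1 hn2 hpos
      rw [ofReal_half, half_add_one] at k1
      rw [ofReal_neg_half, neg_half_add_one] at l1
      refine ⟨s₁, s₂, k1, l1, ?_, ?_⟩
      · rw [sub_eq_add_neg, ← neg_mul]
        exact k2 _ _ _ _ hX1.1 hT1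
      · rw [sub_eq_add_neg, ← neg_mul, add_comm]
        exact l2 _ _ _ _ hX2.1 hT2
  · obtain ⟨q, hq1, hq2⟩ := hIII.exists_radius hz
    have ev := heval (summable_chooseWeight_div hq1 hq2)
    have s1 := ev.1
    have s2 := ev.2.1
    have r1 := fun n => summable_hornH3Term isHalf_half hq1 hq2 n
    have r2 := fun n => summable_hornH3Term isHalf_neg_half hq1 hq2 n
    have q1 := hasSum_XpH3Term isHalf_half (ζ₁ := ζ₁) (ζ₂ := ζ₂) (ζ₃ := ζ₃)
    have q2 := hasSum_XpH3Term isHalf_neg_half (ζ₁ := ζ₁) (ζ₂ := ζ₂) (ζ₃ := ζ₃)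
    rw [ofReal_half, half_add_one] at r1 q1
    rw [ofReal_neg_half, neg_half_add_one] at r2 q2
    exact ⟨ev, r1, r2, q1 s1, q2 s2⟩
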